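/- **Setting.** Let $d_1\ge 1$, $d_2\ge 0$, $0\le r\le d_1$, and let $p(x|\theta,\tau)$, $(\theta,\tau)\in\Theta\subset\mathbb{R}^{d_1+d_2}$, be a statistical model of probability densities, where $\Theta$ is a neighbourhood of the origin $O$. The true density is $q=p(\cdot|0,0)$ (a.s.), and $X$ has density $q$. Put $f(x|\theta,\tau)=\log\frac{p(x|0,0)}{p(x|\theta,\tau)}$ and $K(\theta,\tau)=\mathbb{E}_X[f(X|\theta,\tau)]$. Near $O$ the densities are positive, $f$ is square integrable and analytic in the parameters, $K$ is analytic, and expectation may be interchanged with partial derivatives in the parameters (for $f$ and for the likelihood ratio $p(X|\theta,\tau)/p(X|0,0)$). For $v\in\mathbb{R}^{d_1-r}$ let $$F_n(x|v,\tau)=\sum_{i_{r+1}+\cdots+i_{d_1}=n}\frac{1}{i_{r+1}!\cdots i_{d_1}!}\,\frac{\partial^n f}{\partial\theta_{r+1}^{i_{r+1}}\cdots\partial\theta_{d_1}^{i_{d_1}}}(x|0,\tau)\,v_{r+1}^{i_{r+1}}\cdots v_{d_1}^{i_{d_1}} .$$ **Assumptions.** For some neighbourhood of $\tau=0$ and an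 integer $m\ge1$: (0) $f(X|0,\tau)=0$ a.s. for every $\tau$ near $0$. (1) The random variables $\frac{\partial f}{\partial\theta_1}(X|0,0),\dots,\frac{\partial f}{\partial\theta_r}(X|0,0)$ are linearly independent. (2) $F_1(X|v,\tau)=\cdots=F_{m-1}(X|v,\tau)=0$ a.s. for all $v$ and all $\tau$ near $0$, and $m$ is the largest integer with this property; by convention, if $m=1$, then $r=d_1$. (3) If $m\ge2$, then each $v=(\theta_{r+1},\dots,\theta_{d_1})\ne0$ satisfies (i) $F_m(X|v,0)=0$ a.s., or (ii) $F_m(X|v,0)$ and the $r$ random variables in (1) are linearly independent. **Blow-ups.** Let $W_0=\{\theta=0\}$. (a) Blow up along $W_0$. (b) In a chart with exceptional surface $\{\theta_i=0\}$, $i>r$, blow up along $\{\theta_1=\cdots=\theta_r=\theta_i=0\}$. (c) Repeat (b) in the charts with exceptional surface $\{\theta_i=0\}$, $i>r$, until $m$ blow-ups have been made. Let $g$ be the composite map, $U_0=g^{-1}(W_0)$, and let $g_i$ be $g$ in the chart in which the $m$-th blow-up has exceptional surface $\{\theta_i=0\}$, $i>r$. **Conclusions.** 1. $g_i$ is given by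 $\theta_j=\theta_i^m\theta_j'$ for $j\le r$ and $\theta_j=\theta_i\theta_j'$ for $j>r$, $j\ne i$, while $\theta_i$ and $\tau$ are unchanged. 2. Let $$S=\bigcup_{i=r+1}^{d_1}\bigl\{(\theta_1',\dots,\theta_i,\dots,\theta_{d_1}',\tau)\ :\ \theta_1'=\cdots=\theta_r'=\theta_i=0,\ \tau=0,\ F_m(X|\theta_{r+1}',\dots,\theta_{i-1}',1,\theta_{i+1}',\dots,\theta_{d_1}',0)=0\text{ a.s.}\bigr\}\subset U_0 .$$ There is an open neighbourhood $\Omega$ of $\{Q\in U_0\setminus S:\tau(Q)=0\}$ such that $K\circ g$ is normal crossing at every $Q\in\Omega\cap(U_0\setminus S)$: in the chart coordinates $u$ centred at $Q$, $K\circ g=a(u)\prod_{i\le d_1}u_i^{k_i^{(Q)}}$ and $|\det g'|=|b(u)\prod_{i\le d_1}u_i^{h_i^{(Q)}}|$ with $a,b$ analytic and nonzero at $Q$ (the coordinates $\tau$ do not occur in the monomials). If every $v\ne0$ satisfies (3)(ii), then $\Omega$ can be taken to contain all points of $U_0$ with $\tau$ in a neighbourhood of $0$. If $r\ge1$, or if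 some $v\neq 0$ satisfies (3)(ii), then $$\inf_{Q\in\Omega\cap(U_0\setminus S)}\ \min_{1\le i\le d_1}\frac{h_i^{(Q)}+1}{k_i^{(Q)}}=\frac{d_1-r+rm}{2m}$$ (with $(h+1)/0=\infty$), and the multiplicity, i.e. the largest number of indices $i$ attaining this value at one point $Q$, is $1$. 3. If every $v=(\theta_{r+1},\dots,\theta_{d_1})\ne0$ satisfies (3)(ii), then the real log canonical threshold of $K$ at $O$, i.e. the minimum of $(h_i^{(Q)}+1)/k_i^{(Q)}$ over the points $Q$ above $O$ of a resolution of singularities of $K$ near $O$, is $\lambda_O=\frac{d_1-r+rm}{2m}$, and near $O$ the zero set of $K$ in $\Theta$ is $W_0$. -/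

import Mathlib

open MeasureTheory Filter Topology
open scoped ENNReal Manifold ContDiff

noncomputable section

namespace RealLogCanonical

/-! ### Normal crossings and the real log canonical threshold -/

/-- The quotient `(h + 1) / k`, which is `∞` when `k = 0`. -/
def ratio (h k : ℕ) : ℝ≥0∞ := ((h : ℝ≥0∞) + 1) / (k : ℝ≥0∞)

/-- `γ` is a map written in local coordinates `u` centred at the point of interest. In these
coordinates `F ∘ γ` is a unit times the monomial `u ^ k`, and the Jacobian determinant of `γ` is, up
to sign, a unit times the monomial `u ^ h`. -/
def IsNormalCrossing {ι : Type*} [Fintype ι] (F : (ι → ℝ) → ℝ) (γ : (ι → ℝ) → (ι → ℝ))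
    (k h : ι → ℕ) : Prop :=
  (∃ a : (ι → ℝ) → ℝ, AnalyticAt ℝ a 0 ∧ a 0 ≠ 0 ∧
    ∀ᶠ u in 𝓝 (0 : ι → ℝ), F (γ u) = a u * ∏ i, u i ^ k i) ∧
  (∃ b : (ι → ℝ) → ℝ, AnalyticAt ℝ b 0 ∧ b 0 ≠ 0 ∧
    ∀ᶠ u in 𝓝 (0 : ι → ℝ), |(fderiv ℝ γ u).det| = |b u * ∏ i, u i ^ h i|)

/-- A resolution of singularities of the real analytic function `F` near its zero `P`: an open
neighbourhood `W` of `P`, a real analytic manifold `U` and a proper real analytic map `g : U → W`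
which is an analytic isomorphism off the zero set and makes `F` normal crossing at every point of
`U₀ = g⁻¹(F⁻¹(0))`. The exponents at the points of `U₀` are recorded in `k` and `h`. -/
structure Resolution {ι : Type} [Fintype ι] (F : (ι → ℝ) → ℝ) (P : ι → ℝ) where
  /-- the neighbourhood of `P` -/
  W : Set (ι → ℝ)
  isOpen_W : IsOpen W
  mem_W : P ∈ W
  analytic_F : AnalyticOnNhd ℝ F W
  zero_F : F P = 0
  /-- the resolving manifold -/
  U : Type
  [top : TopologicalSpace U]
  [t2 : T2Space U]
  [sc : SecondCountableTopology U]
  [charted : ChartedSpace (ι → ℝ) U]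
  [mfd : IsManifold 𝓘(ℝ, ι → ℝ) ω U]
  /-- the resolving map -/
  g : U → (ι → ℝ)
  mapsTo : ∀ Q, g Q ∈ W
  analytic_g : ContMDiff 𝓘(ℝ, ι → ℝ) 𝓘(ℝ, ι → ℝ) ω g
  proper : ∀ C : Set (ι → ℝ), C ⊆ W → IsCompact C → IsCompact (g ⁻¹' C)
  iso : ∃ s : (ι → ℝ) → U,
    ContMDiffOn 𝓘(ℝ, ι → ℝ) 𝓘(ℝ, ι → ℝ) ω s {w | w ∈ W ∧ F w ≠ 0} ∧
    (∀ w ∈ W, F w ≠ 0 → g (s w) = w) ∧ (∀ Q, F (g Q) ≠ 0 → s (g Q) = Q)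
  /-- exponents of the function -/
  k : U → ι → ℕ
  /-- exponents of the Jacobian -/
  h : U → ι → ℕ
  crossing : ∀ Q, F (g Q) = 0 → ∃ φ ∈ IsManifold.maximalAtlas 𝓘(ℝ, ι → ℝ) ω U,
    Q ∈ φ.source ∧ φ Q = 0 ∧ IsNormalCrossing F (g ∘ φ.symm) (k Q) (h Q)

/-- The threshold read off from a resolution: the infimum of `(h_i + 1) / k_i` over the points `Q` of
the resolving manifold that lie above `P`. (By properness, this is also the infimum over all points
above the zero set, once `W` is small enough.) -/
def Resolution.threshold {ι : Type} [Fintype ι] {F : (ι → ℝ) → ℝ} {P : ι → ℝ}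
    (R : Resolution F P) : ℝ≥0∞ :=
  ⨅ (Q : R.U) (_ : R.g Q = P) (i : ι), ratio (R.h Q i) (R.k Q i)

/-- `l` is the real log canonical threshold of `F` at `P`: the value read off from a resolution of
singularities of `F` near `P`. (It is well known not to depend on the resolution.) -/
def IsRLCT {ι : Type} [Fintype ι] (F : (ι → ℝ) → ℝ) (P : ι → ℝ) (l : ℝ≥0∞) : Prop :=
  ∃ R : Resolution F P, R.threshold = l

/-! ### The statistical model -/

/-- The parameters `(θ, τ)`: `θ_j` is the coordinate `Sum.inl j`, `τ_j` is `Sum.inr j`. -/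
abbrev Param (d₁ d₂ : ℕ) : Type := Fin d₁ ⊕ Fin d₂ → ℝ

variable {χ : Type*} [MeasurableSpace χ] {d₁ d₂ : ℕ}

/-- The law of the random variable `X` with density `q` with respect to `μ`. -/
def trueLaw (μ : Measure χ) (q : χ → ℝ) : Measure χ :=
  μ.withDensity fun x => ENNReal.ofReal (q x)

/-- The log-likelihood ratio `f(x|w) = log (p(x|0) / p(x|w))`. -/
def logRatio (p : χ → Param d₁ d₂ → ℝ) (x : χ) (w : Param d₁ d₂) : ℝ :=
  Real.log (p x 0 / p x w)

/-- The Kullback-Leibler divergence `K(w) = E_X [f(X|w)]`. -/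
def klDiv (μ : Measure χ) (q : χ → ℝ) (p : χ → Param d₁ d₂ → ℝ) (w : Param d₁ d₂) : ℝ :=
  ∫ x, logRatio p x w ∂(trueLaw μ q)

/-- Expectation with respect to `P` and partial derivatives of all orders with respect to the
parameter are interchangeable for `F(X|w)`, for `w` near `0`. -/
def Interchangeable (P : Measure χ) (F : χ → Param d₁ d₂ → ℝ) : Prop :=
  ∀ n : ℕ, ∀ᶠ w in 𝓝 (0 : Param d₁ d₂), ∀ v : Fin n → Param d₁ d₂,
    Integrable (fun x => iteratedFDeriv ℝ n (F x) w v) P ∧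
    iteratedFDeriv ℝ n (fun w' => ∫ x, F x w' ∂P) w v = ∫ x, iteratedFDeriv ℝ n (F x) w v ∂P

/-- The standing assumptions: `p(·|w)`, `w ∈ Θ`, are probability densities with respect to `μ`, the
true density `q` is realized at the interior point `w = 0` of `Θ`, and near this point the
log-likelihood ratio exists, is analytic in `w` and square integrable, `K` is analytic, and
expectations and derivatives may be interchanged for the log-likelihood ratio and for the likelihood
ratio. -/
structure IsModel (μ : Measure χ) (q : χ → ℝ) (Θ : Set (Param d₁ d₂))
    (p : χ → Param d₁ d₂ → ℝ) : Prop where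
  nhds : Θ ∈ 𝓝 (0 : Param d₁ d₂)
  measurable_q : Measurable q
  nonneg_q : ∀ x, 0 ≤ q x
  lintegral_q : ∫⁻ x, ENNReal.ofReal (q x) ∂μ = 1
  measurable_p : ∀ w ∈ Θ, Measurable fun x => p x w
  nonneg_p : ∀ w ∈ Θ, ∀ x, 0 ≤ p x w
  lintegral_p : ∀ w ∈ Θ, ∫⁻ x, ENNReal.ofReal (p x w) ∂μ = 1
  realizable : ∀ᵐ x ∂(trueLaw μ q), q x = p x 0
  analytic_f : ∃ V ∈ 𝓝 (0 : Param d₁ d₂), ∀ᵐ x ∂μ,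
    (∀ w ∈ V, 0 < p x w) ∧ AnalyticOnNhd ℝ (logRatio p x) V
  memLp_f : ∀ᶠ w in 𝓝 (0 : Param d₁ d₂), MemLp (fun x => logRatio p x w) 2 (trueLaw μ q)
  analytic_K : AnalyticAt ℝ (klDiv μ q p) 0
  interchange_f : Interchangeable (trueLaw μ q) (logRatio p)
  interchange_p : Interchangeable (trueLaw μ q) fun x w => p x w / p x 0

/-- Linear independence over `ℝ` of finitely many random variables. -/
def LinIndepAS {κ : Type*} [Fintype κ] (P : Measure χ) (X : κ → χ → ℝ) : Prop :=
  ∀ a : κ → ℝ, (∀ᵐ x ∂P, ∑ i, a i * X i x = 0) → a = 0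

/-- `∂f(x|θ,τ)/∂θ_j` at `(θ, τ) = 0`, for the first `r` parameters. -/
def score (p : χ → Param d₁ d₂ → ℝ) {r : ℕ} (hr : r ≤ d₁) (j : Fin r) (x : χ) : ℝ :=
  fderiv ℝ (logRatio p x) 0 (Pi.single (Sum.inl (Fin.castLE hr j)) 1)

/-- The homogeneous part of order `n` of the Taylor expansion of `f(x|·,τ)` at `θ = 0`, for the
constant `τ`, evaluated at `θ = v`, i.e. `∑_{|α| = n} (1/α!) ∂_θ^α f(x|0,τ) v^α`. -/
def taylorTerm (p : χ → Param d₁ d₂ → ℝ) (n : ℕ) (v : Fin d₁ → ℝ) (τ : Fin d₂ → ℝ) (x : χ) : ℝ :=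
  (n.factorial : ℝ)⁻¹ *
    iteratedFDeriv ℝ n (logRatio p x) (Sum.elim 0 τ) (fun _ => Sum.elim v 0)

/-- The vector `(0, …, 0, v_{r+1}, …, v_{d₁})`. So `taylorTerm p n (tail r v) τ` is
`F_n(·|v_{r+1}, …, v_{d₁}, τ)`. -/
def tail (r : ℕ) (v : Fin d₁ → ℝ) : Fin d₁ → ℝ := fun j => if (j : ℕ) < r then 0 else v j

/-- `F_m(X|v_{r+1}, …, v_{d₁})` at `τ = 0` vanishes almost surely. -/
def VanishingDir (μ : Measure χ) (q : χ → ℝ) (p : χ → Param d₁ d₂ → ℝ) (r m : ℕ)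
    (v : Fin d₁ → ℝ) : Prop :=
  ∀ᵐ x ∂(trueLaw μ q), taylorTerm p m (tail r v) 0 x = 0

/-- `F_m(X|v_{r+1}, …, v_{d₁})` at `τ = 0` and the `r` first derivatives are linearly independent. -/
def IndependentDir (μ : Measure χ) (q : χ → ℝ) (p : χ → Param d₁ d₂ → ℝ) {r : ℕ} (hr : r ≤ d₁)
    (m : ℕ) (v : Fin d₁ → ℝ) : Prop :=
  LinIndepAS (trueLaw μ q)
    fun o : Option (Fin r) => o.elim (taylorTerm p m (tail r v) 0) (score p hr)

/-- The assumptions (0)-(3) on the model, for given `r` and `m`. -/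
structure MainAssumption (μ : Measure χ) (q : χ → ℝ) (p : χ → Param d₁ d₂ → ℝ) {r : ℕ}
    (hr : r ≤ d₁) (m : ℕ) : Prop where
  /-- (0): the true distribution is realized by `θ = 0` alone -/
  feasible : ∀ᶠ τ in 𝓝 (0 : Fin d₂ → ℝ), ∀ᵐ x ∂(trueLaw μ q), logRatio p x (Sum.elim 0 τ) = 0
  /-- (1) -/
  indep : LinIndepAS (trueLaw μ q) (score p hr)
  one_le : 1 ≤ m
  /-- (2) -/
  vanish : ∀ᶠ τ in 𝓝 (0 : Fin d₂ → ℝ), ∀ n, 1 ≤ n → n < m → ∀ v : Fin d₁ → ℝ,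
    ∀ᵐ x ∂(trueLaw μ q), taylorTerm p n (tail r v) τ x = 0
  /-- (2): `m` is the largest possible -/
  maximal : m ≠ 1 → ¬ ∀ᶠ τ in 𝓝 (0 : Fin d₂ → ℝ), ∀ v : Fin d₁ → ℝ,
    ∀ᵐ x ∂(trueLaw μ q), taylorTerm p m (tail r v) τ x = 0
  /-- (2): the convention for `m = 1` -/
  conv : m = 1 → r = d₁
  /-- (3) -/
  dichotomy : 2 ≤ m → ∀ v : Fin d₁ → ℝ, tail r v ≠ 0 →
    VanishingDir μ q p r m v ∨ IndependentDir μ q p hr m v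

/-! ### The sequence of blow-ups -/

/-- The chart with exceptional surface `{u_j = 0}` of the blow-up of `ℝ^ι` along the coordinate
subspace `{u_k = 0 for all k ∈ J}`, where `j ∈ J`. -/
def coordBlowup {ι : Type*} (J : Set ι) (j : ι) (u : ι → ℝ) : ι → ℝ := by
  classical exact fun k => if k ∈ J ∧ k ≠ j then u j * u k else u k

/-- The charts that arise in the procedure. A term of `BlowupChart d₁ r n j` is a chart that arises
after `n` blow-ups and in which the exceptional surface of the last of them is `{θ_j = 0}`. First
`{θ = 0}` is blown up; then, in a chart with exceptional surface `{θ_i = 0}`, `i > r`, the subvariety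
`{θ_1 = ⋯ = θ_r = θ_i = 0}`. (Indices are counted from `0`, so `i > r` reads `r ≤ i`.) -/
inductive BlowupChart (d₁ r : ℕ) : ℕ → Fin d₁ → Type
  | first (j : Fin d₁) : BlowupChart d₁ r 1 j
  | next {n : ℕ} {i : Fin d₁} (c : BlowupChart d₁ r n i) (hi : r ≤ (i : ℕ)) (j : Fin d₁)
      (hj : (j : ℕ) < r ∨ j = i) : BlowupChart d₁ r (n + 1) j

/-- The blow-down map to the parameter space, in the coordinates of a chart. -/
def BlowupChart.toMap (d₂ : ℕ) {d₁ r : ℕ} :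
    {n : ℕ} → {j : Fin d₁} → BlowupChart d₁ r n j → Param d₁ d₂ → Param d₁ d₂
  | _, _, .first j => coordBlowup (Set.range Sum.inl) (Sum.inl j)
  | _, _, .next (i := i) c _ j _ =>
      c.toMap d₂ ∘ coordBlowup {k | ∃ l : Fin d₁, k = Sum.inl l ∧ ((l : ℕ) < r ∨ l = i)} (Sum.inl j)

/-- The charts of the result: those in which the procedure has stopped, because the exceptional
surface is `{θ_j = 0}` with `j ≤ r`, or because `m` blow-ups have been made. -/
structure FinalChart (d₁ r m : ℕ) where
  /-- the number of blow-ups made in this chart -/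
  n : ℕ
  /-- the index of the last exceptional surface -/
  last : Fin d₁
  /-- the chart -/
  chart : BlowupChart d₁ r n last
  le : n ≤ m
  halted : r ≤ (last : ℕ) → n = m

/-- The blow-down map in a final chart. -/
def FinalChart.map (d₂ : ℕ) {d₁ r m : ℕ} (c : FinalChart d₁ r m) : Param d₁ d₂ → Param d₁ d₂ :=
  c.chart.toMap d₂

/-- `W₀ = {θ = 0}`. -/
def centre (d₁ d₂ : ℕ) : Set (Param d₁ d₂) := {w | ∀ j : Fin d₁, w (Sum.inl j) = 0}

/-- `U₀ = g⁻¹(W₀)` in a final chart. -/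
def excSet (d₂ : ℕ) {d₁ r m : ℕ} (c : FinalChart d₁ r m) : Set (Param d₁ d₂) :=
  c.map d₂ ⁻¹' centre d₁ d₂

/-- The exceptional subset `S` of `U₀` in a final chart; it only meets the charts with last
exceptional surface `{θ_i = 0}`, `i > r`. -/
def badSet (μ : Measure χ) (q : χ → ℝ) (p : χ → Param d₁ d₂ → ℝ) {r m : ℕ}
    (c : FinalChart d₁ r m) : Set (Param d₁ d₂) :=
  {u | r ≤ (c.last : ℕ) ∧ (∀ j : Fin d₁, (j : ℕ) < r → u (Sum.inl j) = 0) ∧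
    u (Sum.inl c.last) = 0 ∧ (∀ j : Fin d₂, u (Sum.inr j) = 0) ∧
    VanishingDir μ q p r m (Function.update (fun j => u (Sum.inl j)) c.last 1)}

/-- The number `(d₁ - r + r m) / (2 m)`. -/
def lam (d₁ r m : ℕ) : ℝ≥0∞ := ENNReal.ofReal (((d₁ : ℝ) - r + r * m) / (2 * m))

end RealLogCanonical

end

open RealLogCanonical

/-! Everything rests on one expansion. The likelihood ratio is e^{-f} and has mean one, so K = E[f +
e^{-f} - 1]. Along a weighted curve (t^m ξ_1, …, t^m ξ_r, t ξ_{r+1}, …, t ξ_{d₁}, τ), assumptions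
(0) and (2) give f = c t^m + o(t^m), where c is the first derivative of f in the direction (ξ_1, …,
ξ_r) plus F_m in the remaining direction. As s + e^{-s} - 1 = s²/2 + O(s³), it follows that K =
D(ξ,τ) t^{2m} + o(t^{2m}) with D = E[c²]/2 (`hasLeadingForm_klDiv`). By (1) and (3), D(ξ,0) = 0
forces ξ_1 = ⋯ = ξ_r = 0 and F_m = 0 a.s. in the remaining direction
(`MainAssumption.eq_zero_of_leadCoeff`). The analysis of the charts then uses only K and D.

Scale the first r coordinates by s and the others by y. Division of analytic functions turns the
expansion into K = y^{2m} A₀ + s y^m A₁ + s² R (`exists_expansion`). Where y^m = s z this is s²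
times an analytic function whose value at s = y = 0 is a nonzero multiple of a value of D
(`exists_factorization`). Every chart of the blow-ups is monomial: s = ∏ u^ν, y is the product of
the exceptional coordinates, and z is a complementary monomial (`BlowupChart.toMap_eq`,
`mono_red_pow`). Hence, over τ = 0 and off S, K ∘ g is locally ∏ u^{2ν} times a unit. The Jacobian
is a monomial with exponents rν + d₁ - r - 1 (`BlowupChart.det_fderiv`). The quotient (d₁ - r +
rν)/(2ν) does not increase with ν ≤ m, and ν = m can occur only on the last exceptional surface of a
chart; this gives the infimum and the multiplicity.

The threshold requires a manifold and a proper map. The charts are glued inside the product of the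
parameter space with m projective spaces, the n-th of which receives the point (θ_1 : ⋯ : θ_r :
θ_{r+1}^n : ⋯ : θ_{d₁}^n) (`toricAtlas`). Properness reduces to covering the points off the centre
by chart points with bounded coordinates (`ToricIndex.exists_ratios`). If all directions are
independent, D(·,0) vanishes only at 0, and compactness of the sphere of directions shows that K
vanishes only on W₀ near the origin (`uniform_nonvanishing`). -/

noncomputable section

namespace RealLogCanonical

/-! ### Division of analytic functions by a linear coordinate -/

section Division

variable {E : Type*} [NormedAddCommGroup E] [NormedSpace ℝ E]

/-- The power series of the difference quotient `(G(y) - G(π y)) / L(y)` where `π y = y - L(y) e` and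
`p` is the power series of `G`. -/
def divSeries (p : FormalMultilinearSeries ℝ E ℝ) (π : E →L[ℝ] E) (e : E) :
    FormalMultilinearSeries ℝ E ℝ := fun n =>
  ∑ k : Fin (n + 1), ((p (n + 1)).compContinuousLinearMap
    (fun i => if i < k then π else ContinuousLinearMap.id ℝ E)).curryMid k e

/-- Telescoping: the arguments `y` are replaced by `y - L y • e` one slot at a time, and by
multilinearity each replacement contributes `L y` times the form with `e` in that slot. -/
theorem divSeries_diag (p : FormalMultilinearSeries ℝ E ℝ) (L : E →L[ℝ] ℝ) (e y : E) (n : ℕ) :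
    L y * divSeries p (ContinuousLinearMap.id ℝ E - L.smulRight e) e n (fun _ => y) =
      p (n + 1) (fun _ => y) - p (n + 1) (fun _ => y - L y • e) := by
  set z := y - L y • e with hz
  let T : ℕ → ℝ := fun k => p (n + 1) (fun i => if (i : ℕ) < k then z else y)
  have h0 : T 0 = p (n + 1) (fun _ => y) := by simp [T]
  have h1 : T (n + 1) = p (n + 1) (fun _ => z) := by
    simp only [T]; congr 1; ext i; simp [i.isLt]
  rw [← h0, ← h1, ← Finset.sum_range_sub' T (n + 1), ← Fin.sum_univ_eq_sum_range (fun k => T k - T (k + 1))]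
  simp only [divSeries, sum_apply, Finset.mul_sum]
  refine Finset.sum_congr rfl fun k _ => ?_
  rw [ContinuousMultilinearMap.curryMid_apply, ContinuousMultilinearMap.compContinuousLinearMap_apply]
  set w : Fin (n + 1) → E := fun i => if (i : ℕ) < k then z else y with hw
  have e1 : (fun i => (if i < k then ContinuousLinearMap.id ℝ E - L.smulRight e
      else ContinuousLinearMap.id ℝ E) (k.insertNth (α := fun _ => E) e (fun _ => y) i)) =
      Function.update w k e := by
    funext i
    rcases lt_trichotomy i k with h | h | h
    · rw [Function.update_of_ne h.ne, if_pos h]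
      obtain ⟨j, rfl⟩ := Fin.exists_succAbove_eq h.ne
      have h' : ¬ k ≤ k.succAbove j := not_le.2 h
      simp [hw, hz, h']
    · subst h; simp
    · rw [Function.update_of_ne h.ne', if_neg h.not_gt]
      obtain ⟨j, rfl⟩ := Fin.exists_succAbove_eq h.ne'
      have h' : ¬ k.succAbove j < k := h.not_gt
      simp [hw, h']
  rw [e1]
  have e2 : T k = p (n + 1) (Function.update w k y) := by
    simp only [T]; congr 1; funext i
    by_cases h : i = k
    · subst h; simp
    · simp [h, hw]
  have e3 : T (k + 1) = p (n + 1) (Function.update w k z) := by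
    simp only [T]; congr 1; funext i
    by_cases h : i = k
    · subst h; simp
    · have : (i : ℕ) ≠ k := fun h' => h (Fin.ext h')
      have h2 : (i : ℕ) < k + 1 ↔ (i : ℕ) < k := by omega
      simp [h, hw, h2]
  rw [e2, e3, ← ContinuousMultilinearMap.map_update_sub]
  have : y - z = L y • e := by simp [hz]
  rw [this, ContinuousMultilinearMap.map_update_smul, smul_eq_mul]

theorem divSeries_radius_pos (p : FormalMultilinearSeries ℝ E ℝ) (hp : 0 < p.radius) (π : E →L[ℝ] E)
    (e : E) : 0 < (divSeries p π e).radius := by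
  obtain ⟨C, r, hC, hr, hb⟩ := p.le_mul_pow_of_radius_pos hp
  set B : ℝ := max ‖π‖ 1 with hB
  have hB1 : 1 ≤ B := le_max_right _ _
  have hB0 : 0 < B := by linarith
  have bound : ∀ n, ‖divSeries p π e n‖ ≤ (n + 1) * (C * r ^ (n + 1) * B ^ (n + 1) * ‖e‖) := by
    intro n
    have : ∀ k : Fin (n + 1), ‖((p (n + 1)).compContinuousLinearMap
        (fun i => if i < k then π else ContinuousLinearMap.id ℝ E)).curryMid k e‖ ≤
        C * r ^ (n + 1) * B ^ (n + 1) * ‖e‖ := by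
      intro k
      refine (ContinuousLinearMap.le_opNorm _ _).trans ?_
      gcongr
      rw [ContinuousMultilinearMap.norm_curryMid]
      refine (ContinuousMultilinearMap.norm_compContinuousLinearMap_le _ _).trans ?_
      gcongr
      · exact hb _
      · calc ∏ i : Fin (n + 1), ‖(if i < k then π else ContinuousLinearMap.id ℝ E)‖
            ≤ ∏ i : Fin (n + 1), B := by
              refine Finset.prod_le_prod (fun _ _ => norm_nonneg _) fun i _ => ?_
              split_ifs
              · exact le_max_left _ _
              · exact ContinuousLinearMap.norm_id_le.trans hB1
          _ = B ^ (n + 1) := by simp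
    refine (norm_sum_le _ _).trans ((Finset.sum_le_sum fun k _ => this k).trans ?_)
    simp
  -- The factor `2` absorbs the number `n + 1 ≤ 2 ^ n` of summands in `divSeries`.
  set ρ : NNReal := ⟨(2 * r * B)⁻¹, by positivity⟩ with hρ
  have hρ0 : (0 : ℝ≥0∞) < ρ := by
    rw [ENNReal.coe_pos]; exact_mod_cast (by positivity : 0 < (2 * r * B)⁻¹)
  refine hρ0.trans_le (FormalMultilinearSeries.le_radius_of_bound _ (C * r * B * ‖e‖) fun n => ?_)
  have h2 : ((n : ℝ) + 1) ≤ 2 ^ n := by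
    exact_mod_cast Nat.lt_two_pow_self (n := n)
  have : (ρ : ℝ) = (2 * r * B)⁻¹ := rfl
  rw [this]
  calc ‖divSeries p π e n‖ * (2 * r * B)⁻¹ ^ n
      ≤ (2 ^ n * (C * r ^ (n + 1) * B ^ (n + 1) * ‖e‖)) * (2 * r * B)⁻¹ ^ n := by
        gcongr
        exact (bound n).trans (by gcongr)
    _ = C * r * B * ‖e‖ := by
        rw [inv_pow, mul_pow, mul_pow, pow_succ, pow_succ]
        field_simp

/-- **Hadamard's lemma** for analytic functions. -/
theorem exists_analyticAt_div {G : E → ℝ} {x₀ : E} (hG : AnalyticAt ℝ G x₀) (L : E →L[ℝ] ℝ) (e : E)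
    (hx : L x₀ = 0) : ∃ H : E → ℝ, AnalyticAt ℝ H x₀ ∧
      ∀ᶠ x in 𝓝 x₀, G x = G (x - L x • e) + L x * H x := by
  obtain ⟨p, hp⟩ := hG
  set π : E →L[ℝ] E := ContinuousLinearMap.id ℝ E - L.smulRight e with hπ
  set q := divSeries p π e with hq
  have hqr : 0 < q.radius := divSeries_radius_pos p hp.radius_pos π e
  have hs := q.hasFPowerSeriesOnBall hqr
  refine ⟨fun x => q.sum (x - x₀), ⟨q, ?_⟩, ?_⟩
  · have := (hs.comp_sub x₀).hasFPowerSeriesAt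
    simpa using this
  have hE := hp.eventually_hasSum
  have hE' : ∀ᶠ y in 𝓝 (0 : E), HasSum (fun n => p n fun _ => π y) (G (x₀ + π y)) := by
    have : Tendsto π (𝓝 0) (𝓝 0) := by simpa using π.continuous.tendsto 0
    exact this.eventually hE
  have hQ := hs.hasFPowerSeriesAt.eventually_hasSum
  have key : ∀ᶠ y in 𝓝 (0 : E), G (x₀ + y) = G (x₀ + π y) + L y * q.sum y := by
    filter_upwards [hE, hE', hQ] with y h1 h2 h3
    have h4 := h1.sub h2
    -- The constant terms of the two series cancel, so the difference starts in degree one; the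
    -- shift matches the degree lost in `divSeries`.
    rw [← hasSum_nat_add_iff' 1] at h4
    have h5 := h3.mul_left (L y)
    have : (fun n => p (n + 1) (fun _ => y) - p (n + 1) (fun _ => π y)) =
        fun n => L y * q n (fun _ => y) := by
      funext n
      rw [hq, hπ, divSeries_diag]
      simp
    rw [this] at h4
    have h6 := h4.unique h5
    have h7 : p 0 (fun _ => y) = p 0 (fun _ => π y) := by congr 1; ext i; exact i.elim0
    simp [h7] at h6
    linarith
  have ht : Tendsto (fun x => x - x₀) (𝓝 x₀) (𝓝 0) := by
    have : Continuous fun x : E => x - x₀ := by fun_prop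
    simpa using this.tendsto x₀
  filter_upwards [ht.eventually key] with x hx'
  have : x₀ + (x - x₀) = x := by abel
  rw [this] at hx'
  rw [hx']
  have h8 : L (x - x₀) = L x := by simp [hx]
  have h9 : x₀ + π (x - x₀) = x - L x • e := by
    simp only [hπ, sub_apply, ContinuousLinearMap.id_apply,
      ContinuousLinearMap.smulRight_apply, h8]
    abel
  rw [h8, h9]

/-- An analytic function that vanishes to order `N` in the direction `e` along `L = 0` is divisible
by `L ^ N`. -/
theorem exists_analyticAt_div_pow (N : ℕ) {G : E → ℝ} {x₀ : E} (hG : AnalyticAt ℝ G x₀)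
    (L : E →L[ℝ] ℝ) (e : E) (hx : L x₀ = 0) (he : L e = 1)
    (hO : ∀ᶠ x in 𝓝 x₀, L x = 0 →
      (fun t : ℝ => G (x + t • e)) =O[𝓝[≠] 0] fun t => t ^ N) :
    ∃ H : E → ℝ, AnalyticAt ℝ H x₀ ∧ ∀ᶠ x in 𝓝 x₀, G x = L x ^ N * H x := by
  induction N generalizing G with
  | zero => exact ⟨G, hG, by simp⟩
  | succ N ih =>
    obtain ⟨H, hH, hGH⟩ := exists_analyticAt_div hG L e hx
    have hcont : ∀ x : E, Tendsto (fun t : ℝ => x + t • e) (𝓝[≠] 0) (𝓝 x) := by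
      intro x
      have : Continuous fun t : ℝ => x + t • e := by fun_prop
      have h := this.tendsto 0
      simp only [zero_smul, add_zero] at h
      exact h.mono_left nhdsWithin_le_nhds
    -- On the hyperplane the value of `G` is its limit along the punctured line, which the bound
    -- forces to be zero. So `G` is divisible by `L`, and the quotient inherits the bound with one
    -- power less.
    have hzero : ∀ᶠ x in 𝓝 x₀, L x = 0 → G x = 0 := by
      filter_upwards [hO, hG.eventually_analyticAt] with x h1 h2 hLx
      have h3 := (h1 hLx).trans_tendsto (by
        show Tendsto (fun t : ℝ => t ^ (N + 1)) (𝓝[≠] 0) (𝓝 0)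
        have : Continuous fun t : ℝ => t ^ (N + 1) := by fun_prop
        have h := this.tendsto 0
        simp only [ne_eq, Nat.add_eq_zero_iff, one_ne_zero, and_false, not_false_eq_true,
          zero_pow] at h
        exact h.mono_left nhdsWithin_le_nhds)
      exact tendsto_nhds_unique (h2.continuousAt.tendsto.comp (hcont x)) h3
    have hproj : Tendsto (fun x => x - L x • e) (𝓝 x₀) (𝓝 x₀) := by
      have : Continuous fun x : E => x - L x • e := by fun_prop
      simpa [hx] using this.tendsto x₀
    have hGH' : ∀ᶠ x in 𝓝 x₀, G x = L x * H x := by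
      filter_upwards [hGH, hproj.eventually hzero] with x h1 h2
      rw [h1, h2 (by simp [he]), zero_add]
    obtain ⟨H', hH', h⟩ := ih (G := H) hH (by
      filter_upwards [hO, hGH'.eventually_nhds] with x h1 h2 hLx
      have h3 : ∀ᶠ t in 𝓝[≠] (0 : ℝ), G (x + t • e) = t * H (x + t • e) := by
        filter_upwards [(hcont x).eventually h2] with t ht
        rw [ht]; simp [hLx, he]
      have h4 := (h1 hLx).congr' h3 (EventuallyEq.refl _ _)
      have h5 : (fun t : ℝ => t⁻¹ * (t * H (x + t • e))) =O[𝓝[≠] 0]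
          fun t : ℝ => t⁻¹ * t ^ (N + 1) := (Asymptotics.isBigO_refl _ _).mul h4
      refine h5.congr' ?_ ?_
      · filter_upwards [self_mem_nhdsWithin] with t ht
        have : t ≠ 0 := ht
        field_simp
      · filter_upwards [self_mem_nhdsWithin] with t ht
        have : t ≠ 0 := ht
        rw [pow_succ']
        field_simp)
    refine ⟨H', hH', ?_⟩
    filter_upwards [hGH', h] with x h1 h2
    rw [h1, h2]; ring

end Division

/-! ### Taylor coefficients from asymptotic expansions -/

/-- The Taylor polynomial with Peano remainder of an analytic function of one variable. -/
theorem AnalyticAt.sub_taylor_isLittleO {h : ℝ → ℝ} (hh : AnalyticAt ℝ h 0) (N : ℕ) :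
    (fun t => h t - ∑ n ∈ Finset.range (N + 1), (n.factorial : ℝ)⁻¹ * iteratedDeriv n h 0 * t ^ n)
      =o[𝓝 0] fun t => t ^ N := by
  obtain ⟨p, hp⟩ := hh
  obtain ⟨r, hr⟩ := hp
  have h1 := hr.hasFPowerSeriesAt.isBigO_sub_partialSum_pow (N + 1)
  have h2 : (fun t : ℝ => ‖t‖ ^ (N + 1)) =o[𝓝 0] fun t => t ^ N := by
    rw [← Asymptotics.isLittleO_norm_right]
    simp only [norm_pow]
    exact (Asymptotics.isLittleO_pow_pow (𝕜 := ℝ) (lt_add_one N)).norm_norm.congr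
      (fun x => by simp) (fun x => by simp)
  refine (h1.trans_isLittleO h2).congr_left fun t => ?_
  rw [zero_add, FormalMultilinearSeries.partialSum]
  congr 1
  refine Finset.sum_congr rfl fun n _ => ?_
  have h3 := hr.factorial_smul t n
  rw [iteratedFDeriv_apply_eq_iteratedDeriv_mul_prod] at h3
  simp only [Finset.prod_const, Finset.card_univ, Fintype.card_fin, smul_eq_mul, nsmul_eq_mul] at h3
  have : (n.factorial : ℝ) ≠ 0 := by positivity
  field_simp
  linarith

/-- If `∑ c_n t ^ n = o(t ^ N)` then the coefficients vanish. -/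
theorem coeff_eq_zero_of_isLittleO (N : ℕ) (c : ℕ → ℝ)
    (h : (fun t : ℝ => ∑ n ∈ Finset.range (N + 1), c n * t ^ n) =o[𝓝 0] fun t => t ^ N) :
    ∀ n ≤ N, c n = 0 := by
  intro n
  induction n using Nat.strong_induction_on with
  | _ n ih =>
    intro hn
    have h1 : (fun t : ℝ => ∑ k ∈ Finset.range (N + 1), c k * t ^ k) =o[𝓝 0] fun t => t ^ n :=
      h.trans_isBigO (Asymptotics.IsBigO.of_bound 1 (by
        filter_upwards [Metric.ball_mem_nhds (0 : ℝ) one_pos] with t ht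
        rw [mem_ball_zero_iff] at ht
        rw [one_mul, norm_pow, norm_pow]
        exact pow_le_pow_of_le_one (norm_nonneg _) ht.le hn))
    have h2 : (fun t : ℝ => ∑ k ∈ Finset.range (N + 1), c k * t ^ k - c n * t ^ n)
        =o[𝓝 0] fun t => t ^ n := by
      have : (fun t : ℝ => ∑ k ∈ Finset.range (N + 1), c k * t ^ k - c n * t ^ n) =
          fun t => ∑ k ∈ (Finset.range (N + 1)).erase n, c k * t ^ k := by
        funext t
        rw [← Finset.add_sum_erase _ _ (Finset.mem_range.2 (Nat.lt_succ_of_le hn))]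
        ring
      rw [this]
      have hterm : ∀ k ∈ (Finset.range (N + 1)).erase n,
          (fun t : ℝ => c k * t ^ k) =o[𝓝 0] fun t => t ^ n := by
        intro k hk
        obtain ⟨hk1, hk2⟩ := Finset.mem_erase.1 hk
        rcases lt_or_gt_of_ne hk1 with h3 | h3
        · simp [ih k h3 (by omega)]
        · exact (Asymptotics.isLittleO_pow_pow (𝕜 := ℝ) h3).const_mul_left (c k)
      exact Asymptotics.IsLittleO.fun_sum hterm
    have h3 : (fun t : ℝ => c n * t ^ n) =o[𝓝 0] fun t => t ^ n := by
      refine (h1.sub h2).congr_left fun t => by ring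
    by_contra hc
    have h4 : (fun t : ℝ => t ^ n) =o[𝓝[≠] 0] fun t : ℝ => t ^ n :=
      ((Asymptotics.isLittleO_const_mul_left_iff hc).1 h3).mono nhdsWithin_le_nhds
    refine Asymptotics.isLittleO_irrefl (Eventually.frequently ?_) h4
    filter_upwards [self_mem_nhdsWithin] with t ht
    exact pow_ne_zero _ ht

/-- The Taylor coefficients of an analytic function that is `C t ^ N + o(t ^ N)`. -/
theorem AnalyticAt.iteratedDeriv_of_isLittleO {h : ℝ → ℝ} (hh : AnalyticAt ℝ h 0) {N : ℕ} {C : ℝ}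
    (ho : (fun t => h t - C * t ^ N) =o[𝓝 0] fun t => t ^ N) :
    (∀ n < N, iteratedDeriv n h 0 = 0) ∧ iteratedDeriv N h 0 = N.factorial * C := by
  have h1 := (AnalyticAt.sub_taylor_isLittleO hh N).sub ho
  have h2 := coeff_eq_zero_of_isLittleO N
    (fun n => (if n = N then C else 0) - (n.factorial : ℝ)⁻¹ * iteratedDeriv n h 0) (by
      refine h1.congr_left fun t => ?_
      simp only [sub_mul, Finset.sum_sub_distrib, ite_mul, zero_mul, Finset.sum_ite_eq',
        Finset.mem_range, Nat.lt_succ_self, if_true]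
      ring)
  refine ⟨fun n hn => ?_, ?_⟩
  · have := h2 n hn.le
    rw [if_neg hn.ne] at this
    have h3 : (n.factorial : ℝ)⁻¹ ≠ 0 := by positivity
    simpa [h3] using this
  · have := h2 N le_rfl
    rw [if_pos rfl] at this
    have h3 : (N.factorial : ℝ) ≠ 0 := by positivity
    field_simp at this
    linarith

/-- Converse of `AnalyticAt.iteratedDeriv_of_isLittleO`. -/
theorem AnalyticAt.isLittleO_of_iteratedDeriv {h : ℝ → ℝ} (hh : AnalyticAt ℝ h 0) {N : ℕ}
    (h0 : ∀ n < N, iteratedDeriv n h 0 = 0) :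
    (fun t => h t - ((N.factorial : ℝ)⁻¹ * iteratedDeriv N h 0) * t ^ N) =o[𝓝 0] fun t => t ^ N := by
  refine (AnalyticAt.sub_taylor_isLittleO hh N).congr_left fun t => ?_
  rw [Finset.sum_range_succ, Finset.sum_eq_zero, zero_add]
  intro n hn
  rw [h0 n (Finset.mem_range.1 hn)]; ring

/-- If `φ = c t ^ m + o(t ^ m)` then `φ + exp (-φ) - 1 = c² / 2 t ^ (2 m) + o(t ^ (2 m))`. -/
theorem isLittleO_add_exp_neg {φ : ℝ → ℝ} {c : ℝ} {m : ℕ} (hm : 1 ≤ m)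
    (h : (fun t => φ t - c * t ^ m) =o[𝓝 0] fun t => t ^ m) :
    (fun t => (φ t + Real.exp (-φ t) - 1) - c ^ 2 / 2 * t ^ (2 * m)) =o[𝓝 0]
      fun t => t ^ (2 * m) := by
  have hO : φ =O[𝓝 0] fun t => t ^ m := by
    have h2 : (fun t : ℝ => c * t ^ m) =O[𝓝 0] fun t => t ^ m :=
      (Asymptotics.isBigO_refl _ _).const_mul_left c
    exact (h.isBigO.add h2).congr_left fun t => by ring
  have ht : Tendsto (fun t : ℝ => t ^ m) (𝓝 0) (𝓝 0) := by
    have : Continuous fun t : ℝ => t ^ m := by fun_prop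
    have h := this.tendsto 0
    rwa [zero_pow (by omega)] at h
  have hφ0 : Tendsto φ (𝓝 0) (𝓝 0) := hO.trans_tendsto ht
  have hexp : (fun s : ℝ => s + Real.exp (-s) - 1 - s ^ 2 / 2) =O[𝓝 0] fun s => s ^ 3 := by
    refine Asymptotics.IsBigO.of_bound 1 ?_
    filter_upwards [Metric.ball_mem_nhds (0 : ℝ) one_pos] with s hs
    rw [mem_ball_zero_iff] at hs
    have h3 := Real.exp_bound (x := -s) (by simpa using hs.le) (n := 3) (by norm_num)
    simp only [Finset.sum_range_succ, Finset.sum_range_zero] at h3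
    norm_num [Nat.factorial] at h3
    rw [Real.norm_eq_abs, norm_pow, Real.norm_eq_abs, one_mul]
    have h4 : s + Real.exp (-s) - 1 - s ^ 2 / 2 = Real.exp (-s) - (1 + -s + s ^ 2 / 2) := by ring
    rw [h4]
    refine h3.trans ?_
    have := pow_nonneg (abs_nonneg s) 3
    linarith
  have h1 : (fun t => φ t + Real.exp (-φ t) - 1 - φ t ^ 2 / 2) =o[𝓝 0] fun t => t ^ (2 * m) := by
    have h2 := hexp.comp_tendsto hφ0
    have h3 : (fun t => φ t ^ 3) =O[𝓝 0] fun t : ℝ => t ^ (3 * m) := by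
      refine (hO.pow 3).congr_right fun t => by ring
    exact (h2.trans h3).trans_isLittleO (Asymptotics.isLittleO_pow_pow (by omega))
  -- The difference of squares `φ² - c² t ^ (2 m)`, of which only the first factor needs to be
  -- small.
  have h2 : (fun t => (φ t - c * t ^ m) * (φ t + c * t ^ m)) =o[𝓝 0] fun t => t ^ m * t ^ m :=
    h.mul_isBigO (hO.add ((Asymptotics.isBigO_refl _ _).const_mul_left c))
  have h3 : (fun t => 1 / 2 * ((φ t - c * t ^ m) * (φ t + c * t ^ m))) =o[𝓝 0]
      fun t => t ^ (2 * m) :=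
    (h2.const_mul_left (1 / 2)).congr_right fun t => by ring
  exact (h1.add h3).congr_left fun t => by ring

/-! ### The expansion of the divergence along weighted curves -/

section Curve

variable {E : Type*} [NormedAddCommGroup E] [NormedSpace ℝ E]

theorem isLittleO_line {f : E → ℝ} {w₀ : E} (hf : AnalyticAt ℝ f w₀) (V : E) (m : ℕ) :
    (fun t : ℝ => f (w₀ + t • V) - ∑ n ∈ Finset.range (m + 1),
      (n.factorial : ℝ)⁻¹ * iteratedFDeriv ℝ n f w₀ (fun _ => V) * t ^ n) =o[𝓝 0] fun t => t ^ m := by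
  obtain ⟨p, r, hr⟩ := hf
  have h1 := hr.hasFPowerSeriesAt.isBigO_sub_partialSum_pow (m + 1)
  have ht : Tendsto (fun t : ℝ => t • V) (𝓝 0) (𝓝 0) := by
    have : Continuous fun t : ℝ => t • V := by fun_prop
    simpa using this.tendsto 0
  have h2 : (fun t : ℝ => ‖t • V‖ ^ (m + 1)) =o[𝓝 0] fun t => t ^ m := by
    have h3 : (fun t : ℝ => ‖V‖ ^ (m + 1) * ‖t ^ (m + 1)‖) =o[𝓝 0] fun t => t ^ m :=
      ((Asymptotics.isLittleO_pow_pow (𝕜 := ℝ) (lt_add_one m)).norm_left).const_mul_left _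
    refine h3.congr_left fun t => ?_
    rw [norm_smul, mul_pow, norm_pow]; ring
  refine ((h1.comp_tendsto ht).trans_isLittleO h2).congr_left fun t => ?_
  simp only [Function.comp, FormalMultilinearSeries.partialSum]
  congr 1
  refine Finset.sum_congr rfl fun n _ => ?_
  have h3 := hr.factorial_smul V n
  rw [nsmul_eq_mul] at h3
  rw [← h3]
  have h4 : p n (fun _ => t • V) = t ^ n * p n (fun _ => V) := by
    have := (p n).map_smul_univ (fun _ => t) (fun _ => V)
    simpa using this
  rw [h4]
  have : (n.factorial : ℝ) ≠ 0 := by positivity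
  field_simp

/-- The leading term of a function along a curve `w₀ + t ^ m A + t V`. -/
theorem isLittleO_weighted_curve {f : E → ℝ} {w₀ : E} (hf : AnalyticAt ℝ f w₀) (hf0 : f w₀ = 0)
    (A V : E) {m : ℕ} (hm : 1 ≤ m)
    (hV : ∀ n, 1 ≤ n → n < m → iteratedFDeriv ℝ n f w₀ (fun _ => V) = 0) :
    (fun t : ℝ => f (w₀ + t ^ m • A + t • V) -
      (fderiv ℝ f w₀ A + (m.factorial : ℝ)⁻¹ * iteratedFDeriv ℝ m f w₀ (fun _ => V)) * t ^ m)
      =o[𝓝 0] fun t => t ^ m := by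
  have h1 := isLittleO_line hf V m
  have h1' : (fun t : ℝ => f (w₀ + t • V) -
      (m.factorial : ℝ)⁻¹ * iteratedFDeriv ℝ m f w₀ (fun _ => V) * t ^ m)
      =o[𝓝 0] fun t => t ^ m := by
    refine h1.congr_left fun t => ?_
    rw [Finset.sum_range_succ, Finset.sum_eq_zero, zero_add]
    intro n hn
    rcases Nat.eq_zero_or_pos n with rfl | h
    · simp [hf0]
    · rw [hV n h (Finset.mem_range.1 hn)]; ring
  -- Strict differentiability is needed because the increment `t ^ m • A` is taken at the moving
  -- point `w₀ + t • V`.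
  have h2 := hf.hasStrictFDerivAt.isLittleO
  have hc : Tendsto (fun t : ℝ => (w₀ + t ^ m • A + t • V, w₀ + t • V)) (𝓝 0) (𝓝 (w₀, w₀)) := by
    have : Continuous fun t : ℝ => (w₀ + t ^ m • A + t • V, w₀ + t • V) := by fun_prop
    have h := this.tendsto 0
    simpa [zero_pow (show m ≠ 0 by omega)] using h
  have h3 := h2.comp_tendsto hc
  have h4 : (fun t : ℝ => t ^ m • A) =O[𝓝 0] fun t => t ^ m := by
    refine Asymptotics.IsBigO.of_bound ‖A‖ (Eventually.of_forall fun t => ?_)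
    rw [norm_smul, mul_comm]
  have h5 : (fun t : ℝ => f (w₀ + t ^ m • A + t • V) - f (w₀ + t • V) - t ^ m * fderiv ℝ f w₀ A)
      =o[𝓝 0] fun t => t ^ m := by
    refine (h3.trans_isBigO (h4.congr_left fun t => ?_)).congr_left fun t => ?_
    · simp only [Function.comp]; abel
    · simp only [Function.comp]
      have : w₀ + t ^ m • A + t • V - (w₀ + t • V) = t ^ m • A := by abel
      rw [this, map_smul, smul_eq_mul]
  exact (h5.add h1').congr_left fun t => by ring

/-- Faà di Bruno's formula for a curve: the derivatives of `G ∘ γ` are fixed linear combinations of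
the derivatives of `G`. -/
theorem iteratedDeriv_comp_curve {G : E → ℝ} {γ : ℝ → E} {N : ℕ} (hG : ContDiffAt ℝ N G (γ 0))
    (hγ : ContDiffAt ℝ N γ 0) {n : ℕ} (hn : n ≤ N) :
    iteratedDeriv n (G ∘ γ) 0 = ∑ c : OrderedFinpartition n, iteratedFDeriv ℝ c.length G (γ 0)
      (c.applyOrderedFinpartition (fun i => iteratedFDeriv ℝ (c.partSize i) γ 0) (fun _ => 1)) := by
  rw [iteratedDeriv_eq_iteratedFDeriv, iteratedFDeriv_comp hG hγ (by exact_mod_cast hn)]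
  simp [FormalMultilinearSeries.taylorComp, FormalMultilinearSeries.compAlongOrderedFinpartition_apply,
    ftaylorSeries]

/-- The Faà di Bruno coefficients depend on `γ` alone, not on `x`, so the interchange of expectation
and derivatives at a point passes to derivatives along a curve. Taylor coefficients thus replace a
limit `t → 0` under the integral, for which no dominating function is assumed. -/
theorem integral_iteratedDeriv_curve {χ : Type*} [MeasurableSpace χ] {P : Measure χ}
    {F : χ → E → ℝ} {γ : ℝ → E} {N : ℕ} (hγ : ContDiffAt ℝ N γ 0)
    (hF : ∀ᵐ x ∂P, ContDiffAt ℝ N (F x) (γ 0))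
    (hK : ContDiffAt ℝ N (fun w => ∫ x, F x w ∂P) (γ 0))
    (hint : ∀ n ≤ N, ∀ v : Fin n → E,
      Integrable (fun x => iteratedFDeriv ℝ n (F x) (γ 0) v) P ∧
      iteratedFDeriv ℝ n (fun w' => ∫ x, F x w' ∂P) (γ 0) v =
        ∫ x, iteratedFDeriv ℝ n (F x) (γ 0) v ∂P) {n : ℕ} (hn : n ≤ N) :
    Integrable (fun x => iteratedDeriv n (F x ∘ γ) 0) P ∧
      iteratedDeriv n ((fun w => ∫ x, F x w ∂P) ∘ γ) 0 = ∫ x, iteratedDeriv n (F x ∘ γ) 0 ∂P := by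
  have h1 : (fun x => iteratedDeriv n (F x ∘ γ) 0) =ᵐ[P] fun x =>
      ∑ c : OrderedFinpartition n, iteratedFDeriv ℝ c.length (F x) (γ 0)
      (c.applyOrderedFinpartition (fun i => iteratedFDeriv ℝ (c.partSize i) γ 0) (fun _ => 1)) := by
    filter_upwards [hF] with x hx
    exact iteratedDeriv_comp_curve hx hγ hn
  have h2 := fun c : OrderedFinpartition n => hint c.length (c.length_le.trans hn)
    (c.applyOrderedFinpartition (fun i => iteratedFDeriv ℝ (c.partSize i) γ 0) (fun _ => 1))
  refine ⟨(integrable_congr h1).2 (integrable_finsetSum _ fun c _ => (h2 c).1), ?_⟩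
  rw [iteratedDeriv_comp_curve hK hγ hn, integral_congr_ae h1,
    integral_finsetSum _ fun c _ => (h2 c).1]
  exact Finset.sum_congr rfl fun c _ => (h2 c).2

end Curve

/-! ### The model -/

section Model

variable {χ : Type*} [MeasurableSpace χ] {d₁ d₂ : ℕ} {μ : Measure χ} {q : χ → ℝ}
  {Θ : Set (Param d₁ d₂)} {p : χ → Param d₁ d₂ → ℝ}

theorem IsModel.ae_pos_zero (h : IsModel μ q Θ p) : ∀ᵐ x ∂μ, 0 < p x 0 := by
  obtain ⟨V, hV, hx⟩ := h.analytic_f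
  filter_upwards [hx] with x hx
  exact hx.1 0 (mem_of_mem_nhds hV)

/-- Realizability holds only almost surely under `q`, which yields `q ≤ p(·|0)` almost everywhere
under `μ`. Both sides have total mass one, so they agree. -/
theorem IsModel.trueLaw_eq (h : IsModel μ q Θ p) :
    trueLaw μ q = μ.withDensity fun x => ENNReal.ofReal (p x 0) := by
  have h0 : (0 : Param d₁ d₂) ∈ Θ := mem_of_mem_nhds h.nhds
  have hq : Measurable fun x => ENNReal.ofReal (q x) := h.measurable_q.ennreal_ofReal
  have hp : Measurable fun x => ENNReal.ofReal (p x 0) := (h.measurable_p 0 h0).ennreal_ofReal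
  have hr := h.realizable
  rw [trueLaw, ae_withDensity_iff hq] at hr
  refine withDensity_congr_ae (ae_eq_of_ae_le_of_lintegral_le ?_ ?_ hp.aemeasurable ?_)
  · filter_upwards [hr] with x hx
    by_cases hx0 : ENNReal.ofReal (q x) = 0
    · rw [hx0]; exact zero_le
    · rw [hx hx0]
  · rw [h.lintegral_q]; exact ENNReal.one_ne_top
  · rw [h.lintegral_q, h.lintegral_p 0 h0]

/-- The normalization that makes `K` the mean of `f + exp (-f) - 1`. Division by `p x 0` is harmless
because it is positive `μ`-almost everywhere. -/
theorem IsModel.integral_ratio (h : IsModel μ q Θ p) {w : Param d₁ d₂} (hw : w ∈ Θ) :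
    ∫ x, p x w / p x 0 ∂(trueLaw μ q) = 1 := by
  have h0 : (0 : Param d₁ d₂) ∈ Θ := mem_of_mem_nhds h.nhds
  have hm : Measurable fun x => p x w / p x 0 := (h.measurable_p w hw).div (h.measurable_p 0 h0)
  rw [integral_eq_lintegral_of_nonneg_ae
    (Eventually.of_forall fun x => div_nonneg (h.nonneg_p w hw x) (h.nonneg_p 0 h0 x))
    hm.aestronglyMeasurable, h.trueLaw_eq,
    lintegral_withDensity_eq_lintegral_mul _ (h.measurable_p 0 h0).ennreal_ofReal
      hm.ennreal_ofReal]
  have : ∫⁻ x, ((fun x => ENNReal.ofReal (p x 0)) * fun x => ENNReal.ofReal (p x w / p x 0)) x ∂μ =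
      ∫⁻ x, ENNReal.ofReal (p x w) ∂μ := by
    refine lintegral_congr_ae ?_
    filter_upwards [h.ae_pos_zero] with x hx
    rw [Pi.mul_apply, ← ENNReal.ofReal_mul hx.le, mul_div_cancel₀ _ hx.ne']
  rw [this, h.lintegral_p w hw]; simp

theorem trueLaw_ae {s : χ → Prop} (h : ∀ᵐ x ∂μ, s x) : ∀ᵐ x ∂(trueLaw μ q), s x :=
  (withDensity_absolutelyContinuous _ _).ae_le h

theorem Interchangeable.eventually_le {P : Measure χ} {F : χ → Param d₁ d₂ → ℝ}
    (h : Interchangeable P F) (N : ℕ) : ∀ᶠ w in 𝓝 (0 : Param d₁ d₂), ∀ n ≤ N,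
      ∀ v : Fin n → Param d₁ d₂, Integrable (fun x => iteratedFDeriv ℝ n (F x) w v) P ∧
      iteratedFDeriv ℝ n (fun w' => ∫ x, F x w' ∂P) w v = ∫ x, iteratedFDeriv ℝ n (F x) w v ∂P := by
  have := (Set.finite_Iic N).eventually_all (l := 𝓝 (0 : Param d₁ d₂)) (p := fun n w => ∀ v : Fin n → Param d₁ d₂,
      Integrable (fun x => iteratedFDeriv ℝ n (F x) w v) P ∧
      iteratedFDeriv ℝ n (fun w' => ∫ x, F x w' ∂P) w v = ∫ x, iteratedFDeriv ℝ n (F x) w v ∂P)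
  exact this.2 fun n _ => h n

/-- The parameter with `θ_l = s ξ_l` for the first `r` indices, `θ_l = y ξ_l` for the others. -/
def weighted (r : ℕ) (s y : ℝ) (ξ : Fin d₁ → ℝ) (τ : Fin d₂ → ℝ) : Param d₁ d₂ :=
  Sum.elim (fun l => if (l : ℕ) < r then s * ξ l else y * ξ l) τ

/-- The vector `(v_1, …, v_r, 0, …, 0)`. -/
def head (r : ℕ) (v : Fin d₁ → ℝ) : Fin d₁ → ℝ := fun j => if (j : ℕ) < r then v j else 0

theorem weighted_eq_add (r : ℕ) (s y : ℝ) (ξ : Fin d₁ → ℝ) (τ : Fin d₂ → ℝ) :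
    weighted r s y ξ τ = (Sum.elim 0 τ : Param d₁ d₂) + s • (Sum.elim (head r ξ) 0 : Param d₁ d₂) +
      y • (Sum.elim (tail r ξ) 0 : Param d₁ d₂) := by
  funext i
  rcases i with l | l
  · by_cases h : (l : ℕ) < r <;> simp [weighted, head, tail, h]
  · simp [weighted]

/-- The leading coefficient of `f(x|t ^ m ξ_1, …, t ^ m ξ_r, t ξ_{r+1}, …, t ξ_{d₁}, τ)`. -/
def leadCoeff (p : χ → Param d₁ d₂ → ℝ) (r m : ℕ) (ξ : Fin d₁ → ℝ) (τ : Fin d₂ → ℝ) (x : χ) : ℝ :=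
  fderiv ℝ (logRatio p x) (Sum.elim 0 τ) (Sum.elim (head r ξ) 0) + taylorTerm p m (tail r ξ) τ x

theorem continuous_elim_zero : Continuous fun τ : Fin d₂ → ℝ => (Sum.elim 0 τ : Param d₁ d₂) := by
  refine continuous_pi fun i => ?_
  rcases i with i | i
  · simpa using continuous_const
  · simpa using continuous_apply i

theorem tendsto_elim_zero :
    Tendsto (fun τ : Fin d₂ → ℝ => (Sum.elim 0 τ : Param d₁ d₂)) (𝓝 0) (𝓝 0) := by
  have := (continuous_elim_zero (d₁ := d₁) (d₂ := d₂)).tendsto 0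
  rwa [show (Sum.elim 0 0 : Param d₁ d₂) = 0 by ext i; cases i <;> rfl] at this

/-- `K(t ^ m ξ_1, …, t ^ m ξ_r, t ξ_{r+1}, …, t ξ_{d₁}, τ) = D(ξ, τ) t ^ (2 m) + o(t ^ (2 m))`. -/
def HasLeadingForm (K : Param d₁ d₂ → ℝ) (r m : ℕ) (D : (Fin d₁ → ℝ) → (Fin d₂ → ℝ) → ℝ)
    (τ : Fin d₂ → ℝ) : Prop :=
  AnalyticAt ℝ K (Sum.elim 0 τ) ∧ ∀ ξ : Fin d₁ → ℝ,
    (fun t : ℝ => K (weighted r (t ^ m) t ξ τ) - D ξ τ * t ^ (2 * m)) =o[𝓝 0] fun t => t ^ (2 * m)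

/-- For almost every `x`, `f + exp (-f) - 1` along the weighted curve is half the squared leading
coefficient times `t ^ (2 m)`, up to smaller order, which fixes its Taylor coefficients up to order
`2 m`. Those coefficients, and not the remainders, are integrated over `x`; the analyticity of `K`
then gives back an expansion of `K`. -/
theorem hasLeadingForm_klDiv (h : IsModel μ q Θ p) {r m : ℕ} {hr : r ≤ d₁}
    (ha : MainAssumption μ q p hr m) :
    ∀ᶠ τ in 𝓝 (0 : Fin d₂ → ℝ), HasLeadingForm (klDiv μ q p) r m
      (fun ξ τ => ∫ x, leadCoeff p r m ξ τ x ^ 2 / 2 ∂(trueLaw μ q)) τ ∧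
      ∀ ξ, Integrable (fun x => leadCoeff p r m ξ τ x ^ 2 / 2) (trueLaw μ q) := by
  have hm := ha.one_le
  obtain ⟨V, hV, hVx⟩ := h.analytic_f
  filter_upwards [ha.feasible, ha.vanish,
    tendsto_elim_zero.eventually (h.interchange_f.eventually_le (2 * m)),
    tendsto_elim_zero.eventually (h.interchange_p.eventually_le (2 * m)),
    tendsto_elim_zero.eventually h.analytic_K.eventually_analyticAt,
    tendsto_elim_zero.eventually (eventually_mem_nhds_iff.2 hV),
    tendsto_elim_zero.eventually (eventually_mem_nhds_iff.2 h.nhds)] with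
    τ h0 h2 hf hp hK hVτ hΘτ
  set P := trueLaw μ q with hP
  set w₀ : Param d₁ d₂ := Sum.elim 0 τ with hw₀
  have main : ∀ ξ : Fin d₁ → ℝ, Integrable (fun x => leadCoeff p r m ξ τ x ^ 2 / 2) P ∧
      (fun t : ℝ => klDiv μ q p (weighted r (t ^ m) t ξ τ) -
        (∫ x, leadCoeff p r m ξ τ x ^ 2 / 2 ∂P) * t ^ (2 * m)) =o[𝓝 0] fun t => t ^ (2 * m) := by
    intro ξ
    set γ : ℝ → Param d₁ d₂ := fun t =>
      w₀ + t ^ m • Sum.elim (head r ξ) 0 + t • Sum.elim (tail r ξ) 0 with hγ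
    have hγ0 : γ 0 = w₀ := by simp [hγ, show m ≠ 0 by omega]
    have hγc : ContDiff ℝ ω γ := by
      simp only [hγ]; fun_prop
    have hγa : AnalyticAt ℝ γ 0 := hγc.contDiffAt.analyticAt
    have hφ : ∀ᵐ x ∂P, AnalyticAt ℝ (logRatio p x) w₀ ∧
        (∀ᶠ w in 𝓝 w₀, p x w / p x 0 = Real.exp (-logRatio p x w)) ∧
        (fun t => logRatio p x (γ t) - leadCoeff p r m ξ τ x * t ^ m) =o[𝓝 0] fun t => t ^ m := by
      have hvan : ∀ᵐ x ∂P, ∀ n, 1 ≤ n → n < m → taylorTerm p n (tail r ξ) τ x = 0 := by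
        rw [ae_all_iff]; intro n
        by_cases h1 : 1 ≤ n
        · by_cases h3 : n < m
          · filter_upwards [h2 n h1 h3 ξ] with x hx _ _ using hx
          · exact Eventually.of_forall fun x _ h4 => absurd h4 h3
        · exact Eventually.of_forall fun x h4 => absurd h4 h1
      filter_upwards [trueLaw_ae hVx, h0, hvan] with x hx hx0 hxn
      have hfx : AnalyticAt ℝ (logRatio p x) w₀ := hx.2 w₀ (mem_of_mem_nhds hVτ)
      refine ⟨hfx, ?_, ?_⟩
      · filter_upwards [hVτ] with w hw
        have h1 := hx.1 w hw
        have h3 := hx.1 0 (mem_of_mem_nhds hV)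
        rw [logRatio, ← Real.log_inv, inv_div, Real.exp_log (div_pos h1 h3)]
      · refine isLittleO_weighted_curve hfx hx0 _ _ hm fun n hn1 hn2 => ?_
        have := hxn n hn1 hn2
        rw [taylorTerm] at this
        have h3 : (n.factorial : ℝ)⁻¹ ≠ 0 := by positivity
        exact (mul_eq_zero.1 this).resolve_left h3
    have hKc : ContDiffAt ℝ ((2 * m : ℕ) : WithTop ℕ∞) (fun w => ∫ x, logRatio p x w ∂P) (γ 0) := by
      rw [hγ0]; exact hK.contDiffAt
    have hone : (fun w => ∫ x, p x w / p x 0 ∂P) =ᶠ[𝓝 w₀] fun _ => 1 := by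
      filter_upwards [hΘτ] with w hw using h.integral_ratio hw
    have hf' := fun n (hn : n ≤ 2 * m) => integral_iteratedDeriv_curve (P := P) (F := logRatio p)
      (γ := γ) (N := 2 * m) hγa.contDiffAt (by
        filter_upwards [hφ] with x hx
        rw [hγ0]; exact hx.1.contDiffAt) hKc (by rw [hγ0]; exact hf) hn
    have hrat : ∀ x, AnalyticAt ℝ (logRatio p x) w₀ →
        (∀ᶠ w in 𝓝 w₀, p x w / p x 0 = Real.exp (-logRatio p x w)) →
        AnalyticAt ℝ (fun w => p x w / p x 0) w₀ := fun x h1 h2 =>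
      (h1.neg.rexp).congr (by filter_upwards [h2] with w hw using hw.symm)
    have hp' := fun n (hn : n ≤ 2 * m) => integral_iteratedDeriv_curve (P := P)
      (F := fun x w => p x w / p x 0) (γ := γ) (N := 2 * m) hγa.contDiffAt (by
        filter_upwards [hφ] with x hx
        rw [hγ0]
        exact (hrat x hx.1 hx.2.1).contDiffAt)
      (by rw [hγ0]; exact (analyticAt_const.congr hone.symm).contDiffAt)
      (by rw [hγ0]; exact hp) hn
    have hγt : Tendsto γ (𝓝 0) (𝓝 w₀) := by
      have := hγc.continuous.tendsto 0
      rwa [hγ0] at this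
    have hone' : ∀ n, 1 ≤ n →
        iteratedDeriv n ((fun w => ∫ x, p x w / p x 0 ∂P) ∘ γ) 0 = 0 := by
      intro n hn
      have h3 : ((fun w => ∫ x, p x w / p x 0 ∂P) ∘ γ) =ᶠ[𝓝 0] fun _ => (1 : ℝ) :=
        hγt.eventually hone
      rw [h3.iteratedDeriv_eq, iteratedDeriv_const, if_neg (by omega)]
    -- Order zero is excluded: there the sum is one, and the constant `-1` does not affect the
    -- higher derivatives.
    have hsum : ∀ᵐ x ∂P, (∀ n, 1 ≤ n → n < 2 * m →
          iteratedDeriv n (logRatio p x ∘ γ) 0 +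
            iteratedDeriv n ((fun w => p x w / p x 0) ∘ γ) 0 = 0) ∧
          iteratedDeriv (2 * m) (logRatio p x ∘ γ) 0 +
            iteratedDeriv (2 * m) ((fun w => p x w / p x 0) ∘ γ) 0 =
            (2 * m).factorial * (leadCoeff p r m ξ τ x ^ 2 / 2) := by
      filter_upwards [hφ] with x hx
      obtain ⟨hx1, hx2, hx3⟩ := hx
      have a1 : AnalyticAt ℝ (logRatio p x ∘ γ) 0 := by
        rw [← hγ0] at hx1; exact hx1.comp hγa
      have a2 : AnalyticAt ℝ ((fun w => p x w / p x 0) ∘ γ) 0 := by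
        have := hrat x hx1 hx2
        rw [← hγ0] at this; exact AnalyticAt.comp (g := fun w => p x w / p x 0) this hγa
      have a3 := (a1.add a2).sub (analyticAt_const (v := (1 : ℝ)))
      have e1 := isLittleO_add_exp_neg hm hx3
      have e2 : (fun t => (logRatio p x ∘ γ + (fun w => p x w / p x 0) ∘ γ - fun _ => (1 : ℝ) : ℝ → ℝ) t -
          leadCoeff p r m ξ τ x ^ 2 / 2 * t ^ (2 * m)) =o[𝓝 0] fun t => t ^ (2 * m) := by
        refine e1.congr' ?_ (EventuallyEq.refl _ _)
        filter_upwards [hγt.eventually hx2] with t ht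
        simp only [Pi.sub_apply, Pi.add_apply, Function.comp, ht]
      have e3 := AnalyticAt.iteratedDeriv_of_isLittleO a3 e2
      have e4 : ∀ n, 1 ≤ n → iteratedDeriv n
          (logRatio p x ∘ γ + (fun w => p x w / p x 0) ∘ γ - fun _ => (1 : ℝ)) 0 =
          iteratedDeriv n (logRatio p x ∘ γ) 0 +
            iteratedDeriv n ((fun w => p x w / p x 0) ∘ γ) 0 := by
        intro n hn
        rw [iteratedDeriv_sub (a1.add a2).contDiffAt contDiffAt_const,
          iteratedDeriv_add a1.contDiffAt a2.contDiffAt, iteratedDeriv_const,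
          if_neg (by omega), sub_zero]
      refine ⟨fun n hn1 hn2 => ?_, ?_⟩
      · rw [← e4 n hn1]; exact e3.1 n hn2
      · rw [← e4 _ (by omega)]; exact e3.2
    -- Adding the likelihood ratio changes no derivative of `K` of positive order, because its mean
    -- is constantly one.
    have hKn : ∀ n, 1 ≤ n → n ≤ 2 * m →
        Integrable (fun x => iteratedDeriv n (logRatio p x ∘ γ) 0 +
            iteratedDeriv n ((fun w => p x w / p x 0) ∘ γ) 0) P ∧
        iteratedDeriv n (klDiv μ q p ∘ γ) 0 = ∫ x, (iteratedDeriv n (logRatio p x ∘ γ) 0 +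
            iteratedDeriv n ((fun w => p x w / p x 0) ∘ γ) 0) ∂P := by
      intro n hn1 hn2
      refine ⟨(hf' n hn2).1.add (hp' n hn2).1, ?_⟩
      rw [integral_add (hf' n hn2).1 (hp' n hn2).1, ← (hp' n hn2).2, hone' n hn1, add_zero,
        ← (hf' n hn2).2]
      rfl
    have hfac : ((2 * m).factorial : ℝ) ≠ 0 := by positivity
    have hlast : (fun x => iteratedDeriv (2 * m) (logRatio p x ∘ γ) 0 +
            iteratedDeriv (2 * m) ((fun w => p x w / p x 0) ∘ γ) 0) =ᵐ[P] fun x =>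
            (2 * m).factorial * (leadCoeff p r m ξ τ x ^ 2 / 2) := by
      filter_upwards [hsum] with x hx using hx.2
    have hKγ : AnalyticAt ℝ (klDiv μ q p ∘ γ) 0 := by
      rw [← hγ0] at hK; exact hK.comp hγa
    refine ⟨?_, ?_⟩
    · have := (integrable_congr hlast).1 (hKn (2 * m) (by omega) le_rfl).1
      exact (integrable_const_mul_iff (IsUnit.mk0 _ hfac) _).1 this
    · have hzero : ∀ n < 2 * m, iteratedDeriv n (klDiv μ q p ∘ γ) 0 = 0 := by
        intro n hn
        rcases Nat.eq_zero_or_pos n with rfl | hn1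
        · rw [iteratedDeriv_zero, Function.comp, hγ0, klDiv]
          exact integral_eq_zero_of_ae h0
        · rw [(hKn n hn1 hn.le).2]
          refine integral_eq_zero_of_ae ?_
          filter_upwards [hsum] with x hx using hx.1 n hn1 hn
      have h5 := AnalyticAt.isLittleO_of_iteratedDeriv hKγ hzero
      rw [(hKn (2 * m) (by omega) le_rfl).2, integral_congr_ae hlast,
        integral_const_mul, inv_mul_cancel_left₀ hfac] at h5
      refine h5.congr_left fun t => ?_
      rw [Function.comp, weighted_eq_add]
  exact ⟨⟨hK, fun ξ => (main ξ).2⟩, fun ξ => (main ξ).1⟩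

theorem leadCoeff_zero (hr : r ≤ d₁) (m : ℕ) (ξ : Fin d₁ → ℝ) (x : χ) :
    leadCoeff p r m ξ 0 x =
      ∑ j, ξ (Fin.castLE hr j) * score p hr j x + taylorTerm p m (tail r ξ) 0 x := by
  have h0 : (Sum.elim 0 0 : Param d₁ d₂) = 0 := by ext i; cases i <;> rfl
  have h1 : (Sum.elim (head r ξ) 0 : Param d₁ d₂) =
      ∑ j : Fin r, ξ (Fin.castLE hr j) • Pi.single (Sum.inl (Fin.castLE hr j)) (1 : ℝ) := by
    funext i
    rw [Finset.sum_apply]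
    rcases i with l | l
    · simp only [Sum.elim_inl, head, Pi.smul_apply, smul_eq_mul, Pi.single_apply, Sum.inl.injEq]
      by_cases h : (l : ℕ) < r
      · rw [if_pos h, Finset.sum_eq_single ⟨l, h⟩]
        · simp [Fin.castLE]
        · intro b _ hb
          rw [if_neg (fun h' => hb (Fin.ext (by simp [h']))), mul_zero]
        · simp
      · rw [if_neg h]
        symm
        refine Finset.sum_eq_zero fun b _ => ?_
        rw [if_neg (fun h' => h (by rw [h']; exact b.2)), mul_zero]
    · simp
  rw [leadCoeff, h0, h1, map_sum]
  simp [score]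

theorem tail_eq_zero (v : Fin d₁ → ℝ) : tail d₁ v = 0 := by
  funext j; simp [tail]

theorem taylorTerm_zero {m : ℕ} (hm : 1 ≤ m) (τ : Fin d₂ → ℝ) (x : χ) :
    taylorTerm p m (0 : Fin d₁ → ℝ) τ x = 0 := by
  have h0 : (Sum.elim 0 0 : Param d₁ d₂) = 0 := by ext i; cases i <;> rfl
  rw [taylorTerm, h0, ContinuousMultilinearMap.map_coord_zero _ (⟨0, hm⟩ : Fin m) rfl, mul_zero]

/-- If `r = d₁`, the tail of every direction is zero, so every `F_n` with `n ≥ 1` vanishes and no `m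
≥ 2` is maximal. The converse is the convention for `m = 1`. -/
theorem MainAssumption.lt_iff {r m : ℕ} {hr : r ≤ d₁} (ha : MainAssumption μ q p hr m) :
    r < d₁ ↔ 2 ≤ m := by
  have hm := ha.one_le
  constructor
  · intro h
    by_contra h1
    exact h.ne (ha.conv (by omega))
  · intro h
    by_contra h1
    obtain rfl : r = d₁ := by omega
    refine ha.maximal (by omega) (Eventually.of_forall fun τ v => Eventually.of_forall fun x => ?_)
    rw [tail_eq_zero, taylorTerm_zero hm]

/-- The zero direction counts as vanishing. A direction with nonzero tail exists only if `r < d₁`,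
hence `m ≥ 2`, where assumption (3) is available. -/
theorem MainAssumption.vanishing_or_independent {r m : ℕ} {hr : r ≤ d₁}
    (ha : MainAssumption μ q p hr m) (v : Fin d₁ → ℝ) :
    VanishingDir μ q p r m v ∨ IndependentDir μ q p hr m v := by
  by_cases hv : tail r v = 0
  · left
    refine Eventually.of_forall fun x => ?_
    rw [hv, taylorTerm_zero ha.one_le]
  · refine ha.dichotomy (ha.lt_iff.1 ?_) v hv
    refine lt_of_le_of_ne hr fun h => hv ?_
    subst h; exact tail_eq_zero v

theorem IndependentDir.not_vanishing {r m : ℕ} {hr : r ≤ d₁} {v : Fin d₁ → ℝ}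
    (h : IndependentDir μ q p hr m v) : ¬ VanishingDir μ q p r m v := by
  intro hv
  have := h (fun o => o.elim 1 fun _ => 0) (by
    filter_upwards [hv] with x hx
    simp [Fintype.sum_option, hx])
  simpa using congrFun this none

/-- A square with mean zero vanishes almost surely, so the scores and `F_m` satisfy a linear
relation in which `F_m` has coefficient one. This is impossible in an independent direction; in a
vanishing direction the relation is among the scores alone, and assumption (1) kills its
coefficients. -/
theorem MainAssumption.eq_zero_of_leadCoeff {r m : ℕ} {hr : r ≤ d₁}
    (ha : MainAssumption μ q p hr m) {ξ : Fin d₁ → ℝ}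
    (hi : Integrable (fun x => leadCoeff p r m ξ 0 x ^ 2 / 2) (trueLaw μ q))
    (h : ∫ x, leadCoeff p r m ξ 0 x ^ 2 / 2 ∂(trueLaw μ q) = 0) :
    (∀ l : Fin d₁, (l : ℕ) < r → ξ l = 0) ∧ VanishingDir μ q p r m ξ := by
  rw [integral_eq_zero_iff_of_nonneg (fun x => by positivity) hi] at h
  have h1 : ∀ᵐ x ∂(trueLaw μ q),
      ∑ j, ξ (Fin.castLE hr j) * score p hr j x + taylorTerm p m (tail r ξ) 0 x = 0 := by
    filter_upwards [h] with x hx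
    rw [← leadCoeff_zero]
    simpa using hx
  rcases ha.vanishing_or_independent ξ with hv | hv
  · refine ⟨fun l hl => ?_, hv⟩
    have h2 := ha.indep (fun j => ξ (Fin.castLE hr j)) (by
      filter_upwards [h1, hv] with x hx1 hx2
      rwa [hx2, add_zero] at hx1)
    exact congrFun h2 ⟨l, hl⟩
  · have h2 := hv (fun o => o.elim 1 fun j => ξ (Fin.castLE hr j)) (by
      filter_upwards [h1] with x hx
      simpa [Fintype.sum_option, add_comm] using hx)
    simpa using congrFun h2 none

/-- The properties of the divergence on which the analysis of the blow-ups rests. -/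
theorem exists_leadingForm (h : IsModel μ q Θ p) {r m : ℕ} {hr : r ≤ d₁}
    (ha : MainAssumption μ q p hr m) : ∃ D : (Fin d₁ → ℝ) → (Fin d₂ → ℝ) → ℝ,
      (∀ᶠ τ in 𝓝 (0 : Fin d₂ → ℝ), HasLeadingForm (klDiv μ q p) r m D τ) ∧
      ∀ ξ, D ξ 0 = 0 → (∀ l : Fin d₁, (l : ℕ) < r → ξ l = 0) ∧ VanishingDir μ q p r m ξ :=
  ⟨_, (hasLeadingForm_klDiv h ha).mono fun _ h => h.1, fun _ => ha.eq_zero_of_leadCoeff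
    ((hasLeadingForm_klDiv h ha).self_of_nhds.2 _)⟩

end Model

/-! ### Factorization of a function with a weighted leading form -/

section Factorization

variable {d₁ d₂ : ℕ} {K : Param d₁ d₂ → ℝ} {r m : ℕ} {D : (Fin d₁ → ℝ) → (Fin d₂ → ℝ) → ℝ}

/-- The leading coefficient is the limit of `K / t ^ (2 m)`; this is how values of `D` are read off
from any other factorization of `K`. -/
theorem HasLeadingForm.eq_of_tendsto {τ : Fin d₂ → ℝ} (h : HasLeadingForm K r m D τ)
    {ξ : Fin d₁ → ℝ} {b : ℝ → ℝ} {b₀ : ℝ} (hb : Tendsto b (𝓝[≠] 0) (𝓝 b₀))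
    (hK : ∀ᶠ t in 𝓝[≠] (0 : ℝ), K (weighted r (t ^ m) t ξ τ) = t ^ (2 * m) * b t) : D ξ τ = b₀ := by
  have h1 := ((h.2 ξ).mono nhdsWithin_le_nhds : _ =o[𝓝[≠] (0 : ℝ)] _).tendsto_div_nhds_zero
  have h2 : Tendsto (fun t => b t - D ξ τ) (𝓝[≠] 0) (𝓝 0) := by
    refine h1.congr' ?_
    filter_upwards [hK, self_mem_nhdsWithin] with t ht ht0
    have : t ≠ 0 := ht0
    rw [ht]
    field_simp
  have h3 := tendsto_nhds_unique h2 (hb.sub_const (D ξ τ))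
  linarith

theorem HasLeadingForm.isBigO {τ : Fin d₂ → ℝ} (h : HasLeadingForm K r m D τ) (ξ : Fin d₁ → ℝ) :
    (fun t : ℝ => K (weighted r (t ^ m) t ξ τ)) =O[𝓝[≠] 0] fun t => t ^ (2 * m) := by
  have h1 := ((h.2 ξ).mono nhdsWithin_le_nhds : _ =o[𝓝[≠] (0 : ℝ)] _).isBigO
  have h2 : (fun t : ℝ => D ξ τ * t ^ (2 * m)) =O[𝓝[≠] 0] fun t => t ^ (2 * m) :=
    (Asymptotics.isBigO_refl _ _).const_mul_left _
  exact (h1.add h2).congr_left fun t => by ring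

theorem weighted_zero (r : ℕ) (ξ : Fin d₁ → ℝ) (τ : Fin d₂ → ℝ) :
    weighted r 0 0 ξ τ = (Sum.elim 0 τ : Param d₁ d₂) := by
  funext i; rcases i with l | l <;> simp [weighted]

theorem HasLeadingForm.zero {τ : Fin d₂ → ℝ} (h : HasLeadingForm K r m D τ) (hm : 1 ≤ m) :
    K (Sum.elim 0 τ) = 0 := by
  have h2 := (h.2 0).isBigO
  obtain ⟨c, hc⟩ := h2.bound
  have h3 := hc.self_of_nhds
  simp [show m ≠ 0 by omega, weighted_zero] at h3
  exact h3

/-- Multiplication of the first `r` coordinates by `s`, of the others by `y`. -/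
def wscale (r : ℕ) (s y : ℝ) (ξ : Fin d₁ → ℝ) : Fin d₁ → ℝ :=
  fun l => if (l : ℕ) < r then s * ξ l else y * ξ l

theorem weighted_wscale (r : ℕ) (s y a b : ℝ) (ξ : Fin d₁ → ℝ) (τ : Fin d₂ → ℝ) :
    weighted r s y (wscale r a b ξ) τ = weighted r (s * a) (y * b) ξ τ := by
  funext i
  rcases i with l | l
  · by_cases h : (l : ℕ) < r <;> simp [weighted, wscale, h, mul_assoc]
  · rfl

/-- The weighted curve of the scaled direction is the curve of `ξ` with parameter `t * c`, whence
the weighted homogeneity. -/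
theorem HasLeadingForm.wscale {τ : Fin d₂ → ℝ} (h : HasLeadingForm K r m D τ) {c : ℝ} (hc : c ≠ 0)
    (ξ : Fin d₁ → ℝ) : D (wscale r (c ^ m) c ξ) τ = c ^ (2 * m) * D ξ τ := by
  have ht : Tendsto (fun t : ℝ => t * c) (𝓝[≠] 0) (𝓝[≠] 0) := by
    refine tendsto_nhdsWithin_iff.2 ⟨?_, ?_⟩
    · have : Continuous fun t : ℝ => t * c := by fun_prop
      have h := this.tendsto 0
      rw [zero_mul] at h
      exact h.mono_left nhdsWithin_le_nhds
    · filter_upwards [self_mem_nhdsWithin] with t ht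
      exact mul_ne_zero ht hc
  have h1 := (((h.2 ξ).mono nhdsWithin_le_nhds : _ =o[𝓝[≠] (0 : ℝ)] _).tendsto_div_nhds_zero).comp ht
  refine h.eq_of_tendsto (b := fun t => c ^ (2 * m) *
    (K (weighted r ((t * c) ^ m) (t * c) ξ τ) / (t * c) ^ (2 * m))) (Tendsto.const_mul _ ?_) ?_
  · have h2 := h1.add_const (D ξ τ)
    rw [zero_add] at h2
    refine h2.congr' ?_
    filter_upwards [self_mem_nhdsWithin] with t ht
    have : t ≠ 0 := ht
    simp only [Function.comp]
    field_simp
    ring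
  · filter_upwards [self_mem_nhdsWithin] with t ht
    have : t ≠ 0 := ht
    rw [weighted_wscale, ← mul_pow]
    field_simp
    rw [mul_pow]; ring

/-- The coordinates `(s, y, ξ, τ)`. -/
abbrev WSpace (d₁ d₂ : ℕ) : Type := ℝ × ℝ × (Fin d₁ → ℝ) × (Fin d₂ → ℝ)

/-- `weighted` as a function on a vector space. -/
def weightedMap (r : ℕ) (x : WSpace d₁ d₂) : Param d₁ d₂ := weighted r x.1 x.2.1 x.2.2.1 x.2.2.2

theorem contDiff_weightedMap (r : ℕ) : ContDiff ℝ ω (weightedMap r : WSpace d₁ d₂ → _) := by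
  rw [contDiff_pi]
  intro i
  rcases i with l | l
  · by_cases h : (l : ℕ) < r
    · simp only [weightedMap, weighted, Sum.elim_inl, h, if_true]; fun_prop
    · simp only [weightedMap, weighted, Sum.elim_inl, h, if_false]; fun_prop
  · simp only [weightedMap, weighted, Sum.elim_inr]; fun_prop

/-- Two divisions by `s` give `G = G(0, y) + s H(0, y) + s² R`. The powers of `y` in the first two
coefficients come from the weighted curves: those with vanishing head bound `G(0, y)`, and those
with `s = y ^ m` then bound `H(0, y)`. -/
theorem exists_expansion (hm : 1 ≤ m) {τ₀ : Fin d₂ → ℝ} (hK : ∀ᶠ τ in 𝓝 τ₀, HasLeadingForm K r m D τ)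
    (ξ₀ : Fin d₁ → ℝ) : ∃ A₀ A₁ R : WSpace d₁ d₂ → ℝ,
      AnalyticAt ℝ A₀ (0, 0, ξ₀, τ₀) ∧ AnalyticAt ℝ A₁ (0, 0, ξ₀, τ₀) ∧
      AnalyticAt ℝ R (0, 0, ξ₀, τ₀) ∧
      ∀ᶠ x in 𝓝 ((0, 0, ξ₀, τ₀) : WSpace d₁ d₂), K (weightedMap r x) =
        x.2.1 ^ (2 * m) * A₀ x + x.1 * x.2.1 ^ m * A₁ x + x.1 ^ 2 * R x := by
  set x₀ : WSpace d₁ d₂ := (0, 0, ξ₀, τ₀) with hx₀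
  set G : WSpace d₁ d₂ → ℝ := fun x => K (weightedMap r x) with hG
  have hGa : AnalyticAt ℝ G x₀ := by
    have h1 := hK.self_of_nhds.1
    rw [← weighted_zero r ξ₀ τ₀] at h1
    exact AnalyticAt.comp (g := K) (f := weightedMap r) (x := x₀) h1
      (contDiff_weightedMap r).contDiffAt.analyticAt
  let L₁ : WSpace d₁ d₂ →L[ℝ] ℝ := ContinuousLinearMap.fst ℝ _ _
  let L₂ : WSpace d₁ d₂ →L[ℝ] ℝ := (ContinuousLinearMap.fst ℝ _ _).comp (ContinuousLinearMap.snd ℝ _ _)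
  let e₁ : WSpace d₁ d₂ := (1, 0, 0, 0)
  let e₂ : WSpace d₁ d₂ := (0, 1, 0, 0)
  let π : WSpace d₁ d₂ →L[ℝ] WSpace d₁ d₂ := ContinuousLinearMap.id ℝ _ - L₁.smulRight e₁
  have hπ : ∀ x, π x = (0, x.2) := by
    rintro ⟨s, y, ξ, τ⟩; simp [π, L₁, e₁]
  have hsub : ∀ x : WSpace d₁ d₂, x - L₁ x • e₁ = π x := fun x => rfl
  have hπx₀ : π x₀ = x₀ := by rw [hπ]
  have hπt : Tendsto π (𝓝 x₀) (𝓝 x₀) := by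
    have := π.continuous.tendsto x₀; rwa [hπx₀] at this
  have hπa : AnalyticAt ℝ π x₀ := π.analyticAt _
  obtain ⟨H, hH, hGH⟩ := exists_analyticAt_div hGa L₁ e₁ rfl
  obtain ⟨R, hR, hHR⟩ := exists_analyticAt_div hH L₁ e₁ rfl
  have hexp : ∀ᶠ x in 𝓝 x₀, G x = G (π x) + x.1 * H (π x) + x.1 ^ 2 * R x := by
    filter_upwards [hGH, hHR] with x h1 h2
    rw [hsub] at h1 h2
    have : L₁ x = x.1 := rfl
    rw [h1, h2, this]; ring
  have hτ : Tendsto (fun x : WSpace d₁ d₂ => x.2.2.2) (𝓝 x₀) (𝓝 τ₀) := by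
    have : Continuous fun x : WSpace d₁ d₂ => x.2.2.2 := by fun_prop
    exact this.tendsto x₀
  have hpt : ∀ (x : WSpace d₁ d₂) (t : ℝ), L₂ x = 0 → π (x + t • e₂) = (0, t, x.2.2.1, x.2.2.2) := by
    rintro ⟨s, y, ξ, τ⟩ t h
    have : y = 0 := h
    simp [hπ, e₂, this]
  -- the part of order zero in `s`
  obtain ⟨A₀, hA₀, hGA₀⟩ := exists_analyticAt_div_pow (2 * m) (G := G ∘ π) (x₀ := x₀)
    (by rw [← hπx₀] at hGa; exact hGa.comp hπa) L₂ e₂ rfl (by simp [L₂, e₂]) (by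
      filter_upwards [hτ.eventually hK] with x hx hLx
      -- With the head of the direction set to zero, the weighted curve stays in `s = 0`.
      refine (hx.isBigO (tail r x.2.2.1)).congr_left fun t => ?_
      simp only [Function.comp, hpt x t hLx, hG]
      congr 1
      funext i
      rcases i with l | l
      · by_cases h : (l : ℕ) < r <;> simp [weightedMap, weighted, tail, h]
      · rfl)
  -- the part of order one in `s`
  obtain ⟨A₁, hA₁, hHA₁⟩ := exists_analyticAt_div_pow m (G := H ∘ π) (x₀ := x₀)
    (by rw [← hπx₀] at hH; exact hH.comp hπa) L₂ e₂ rfl (by simp [L₂, e₂]) (by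
      filter_upwards [hτ.eventually hK, hπt.eventually hexp.eventually_nhds,
        hπt.eventually hR.eventually_analyticAt] with x hx hx2 hx3 hLx
      have hxy : x.2.1 = 0 := hLx
      set x' : WSpace d₁ d₂ := π x with hx'
      have hcur : Tendsto (fun t : ℝ => ((t ^ m, t, x.2.2.1, x.2.2.2) : WSpace d₁ d₂)) (𝓝[≠] 0)
          (𝓝 x') := by
        have : Continuous fun t : ℝ => ((t ^ m, t, x.2.2.1, x.2.2.2) : WSpace d₁ d₂) := by fun_prop
        have h := this.tendsto 0
        have h2 : x' = (0, 0, x.2.2.1, x.2.2.2) := by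
          rw [hx', hπ, ← hxy]
        rw [h2]
        rw [zero_pow (by omega)] at h
        exact h.mono_left nhdsWithin_le_nhds
      have h1 := hcur.eventually hx2
      -- On `s = t ^ m` every term other than `s H` is `O(t ^ (2 m))`, so `t ^ m H` is as well, and
      -- `H = O(t ^ m)`.
      have hO1 : (fun t : ℝ => G (t ^ m, t, x.2.2.1, x.2.2.2)) =O[𝓝[≠] 0] fun t => t ^ (2 * m) :=
        hx.isBigO x.2.2.1
      have hO2 : (fun t : ℝ => G (0, t, x.2.2.1, x.2.2.2)) =O[𝓝[≠] 0] fun t => t ^ (2 * m) := by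
        refine (hx.isBigO (tail r x.2.2.1)).congr_left fun t => ?_
        simp only [hG]
        congr 1
        funext i
        rcases i with l | l
        · by_cases h : (l : ℕ) < r <;> simp [weightedMap, weighted, tail, h]
        · rfl
      have hO3 : (fun t : ℝ => (t ^ m) ^ 2 * R (t ^ m, t, x.2.2.1, x.2.2.2)) =O[𝓝[≠] 0]
          fun t => t ^ (2 * m) := by
        have h2 : (fun t : ℝ => R (t ^ m, t, x.2.2.1, x.2.2.2)) =O[𝓝[≠] 0] fun _ => (1 : ℝ) :=
          (hx3.continuousAt.tendsto.comp hcur).isBigO_one ℝ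
        refine ((Asymptotics.isBigO_refl (fun t : ℝ => (t ^ m) ^ 2) _).mul h2).congr_right
          fun t => by ring
      have hO4 := (hO1.sub hO2).sub hO3
      have hO5 : (fun t : ℝ => (t ^ m)⁻¹ * (t ^ m * H (0, t, x.2.2.1, x.2.2.2))) =O[𝓝[≠] 0]
          fun t => (t ^ m)⁻¹ * t ^ (2 * m) := by
        refine (Asymptotics.isBigO_refl _ _).mul (hO4.congr' ?_ (EventuallyEq.refl _ _))
        filter_upwards [h1] with t ht
        rw [ht, hπ]; ring
      refine hO5.congr' ?_ ?_
      · filter_upwards [self_mem_nhdsWithin] with t ht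
        have : t ≠ 0 := ht
        simp only [Function.comp, hpt x t hLx]
        field_simp
      · filter_upwards [self_mem_nhdsWithin] with t ht
        have : t ≠ 0 := ht
        rw [two_mul, pow_add]
        field_simp)
  refine ⟨A₀, A₁, R, hA₀, hA₁, hR, ?_⟩
  filter_upwards [hexp, hGA₀, hHA₁] with x h1 h2 h3
  have : L₂ x = x.2.1 := rfl
  simp only [Function.comp, this] at h2 h3
  change G x = _
  rw [h1, h2, h3]; ring

/-- Along `y ^ m = s z` a function with a weighted leading form is divisible by `s ^ 2`, and the
quotient only vanishes where the leading form does. -/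
theorem exists_factorization (hm : 1 ≤ m) {τ₀ : Fin d₂ → ℝ}
    (hK : ∀ᶠ τ in 𝓝 τ₀, HasLeadingForm K r m D τ) (ξ₀ : Fin d₁ → ℝ) (z₀ : ℝ) :
    ∃ B : ℝ × WSpace d₁ d₂ → ℝ, AnalyticAt ℝ B (z₀, 0, 0, ξ₀, τ₀) ∧
      (∀ᶠ x in 𝓝 ((z₀, 0, 0, ξ₀, τ₀) : ℝ × WSpace d₁ d₂), x.2.2.1 ^ m = x.2.1 * x.1 →
        K (weightedMap r x.2) = x.2.1 ^ 2 * B x) ∧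
      ∃ ξ : Fin d₁ → ℝ, (D ξ τ₀ = 0 → B (z₀, 0, 0, ξ₀, τ₀) = 0) ∧
        (B (z₀, 0, 0, ξ₀, τ₀) = 0 → D ξ τ₀ = 0) ∧
        (∀ l : Fin d₁, (l : ℕ) < r → ξ l = 0 → ξ₀ l = 0) ∧ (z₀ ≠ 0 → tail r ξ = tail r ξ₀) := by
  obtain ⟨A₀, A₁, R, hA₀, hA₁, hR, hexp⟩ := exists_expansion hm hK ξ₀
  have hK0 := hK.self_of_nhds
  have han : ∀ {A : WSpace d₁ d₂ → ℝ}, AnalyticAt ℝ A (0, 0, ξ₀, τ₀) →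
      AnalyticAt ℝ (fun x : ℝ × WSpace d₁ d₂ => A x.2) (z₀, 0, 0, ξ₀, τ₀) := fun h =>
    AnalyticAt.comp (f := Prod.snd) (x := ((z₀, 0, 0, ξ₀, τ₀) : ℝ × WSpace d₁ d₂)) h analyticAt_snd
  have hcur : ∀ a b : ℝ, Tendsto (fun t : ℝ => ((a * t ^ m, b * t, ξ₀, τ₀) : WSpace d₁ d₂)) (𝓝[≠] 0)
      (𝓝 (0, 0, ξ₀, τ₀)) := by
    intro a b
    have : Continuous fun t : ℝ => ((a * t ^ m, b * t, ξ₀, τ₀) : WSpace d₁ d₂) := by fun_prop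
    have h := this.tendsto 0
    rw [zero_pow (by omega), mul_zero, mul_zero] at h
    exact h.mono_left nhdsWithin_le_nhds
  -- Limits along the curves `s = a t ^ m`, `y = b t` identify the quadratic expression in the three
  -- coefficients with values of `D`.
  have hval : ∀ a b : ℝ, D (wscale r a b ξ₀) τ₀ = b ^ (2 * m) * A₀ (0, 0, ξ₀, τ₀) +
      a * b ^ m * A₁ (0, 0, ξ₀, τ₀) + a ^ 2 * R (0, 0, ξ₀, τ₀) := by
    intro a b
    have t0 := hA₀.continuousAt.tendsto.comp (hcur a b)
    have t1 := hA₁.continuousAt.tendsto.comp (hcur a b)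
    have t2 := hR.continuousAt.tendsto.comp (hcur a b)
    refine hK0.eq_of_tendsto (((t0.const_mul (b ^ (2 * m))).add (t1.const_mul (a * b ^ m))).add
      (t2.const_mul (a ^ 2))) ?_
    filter_upwards [(hcur a b).eventually hexp] with t ht
    rw [weighted_wscale]
    have h1 : weighted r (t ^ m * a) (t * b) ξ₀ τ₀ = weightedMap r (a * t ^ m, b * t, ξ₀, τ₀) := by
      simp [weightedMap, mul_comm]
    rw [h1, ht]
    simp only [Function.comp]
    ring
  refine ⟨fun x => x.1 ^ 2 * A₀ x.2 + x.1 * A₁ x.2 + R x.2, ?_, ?_, ?_⟩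
  · exact (((analyticAt_fst.pow 2).mul (han hA₀)).add (analyticAt_fst.mul (han hA₁))).add (han hR)
  · have : Tendsto (Prod.snd : ℝ × WSpace d₁ d₂ → _) (𝓝 (z₀, 0, 0, ξ₀, τ₀)) (𝓝 (0, 0, ξ₀, τ₀)) :=
      continuous_snd.tendsto _
    filter_upwards [this.eventually hexp] with x hx hxz
    rw [hx, two_mul, pow_add, hxz]; ring
  -- The value in question is `z₀² A₀ + z₀ A₁ + R`. For `z₀ ≠ 0` it is `z₀²` times the case `a =
  -- z₀⁻¹`, `b = 1` of `hval`; for `z₀ = 0` only `R` remains, which is the case `a = 1`, `b = 0`.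
  · by_cases hz : z₀ = 0
    · refine ⟨wscale r 1 0 ξ₀, ?_, ?_, ?_, fun h => absurd hz h⟩
      · rw [hval, hz]; simp [show m ≠ 0 by omega]
      · rw [hval, hz]; simp [show m ≠ 0 by omega]
      · intro l hl; simp [wscale, hl]
    · have h1 : D (wscale r z₀⁻¹ 1 ξ₀) τ₀ * z₀ ^ 2 =
          z₀ ^ 2 * A₀ (0, 0, ξ₀, τ₀) + z₀ * A₁ (0, 0, ξ₀, τ₀) + R (0, 0, ξ₀, τ₀) := by
        rw [hval]; field_simp; ring
      refine ⟨wscale r z₀⁻¹ 1 ξ₀, ?_, ?_, ?_, ?_⟩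
      · intro h; simp only [← h1, h, zero_mul]
      · intro h
        simp only [← h1] at h
        exact (mul_eq_zero.1 h).resolve_right (pow_ne_zero _ hz)
      · intro l hl; simp [wscale, hl, hz]
      · intro _
        funext l
        by_cases h : (l : ℕ) < r <;> simp [tail, wscale, h]

end Factorization

/-! ### Uniformity over directions -/

section Uniform

variable {d₁ d₂ : ℕ} {K : Param d₁ d₂ → ℝ} {r m : ℕ} {D : (Fin d₁ → ℝ) → (Fin d₂ → ℝ) → ℝ}

/-- Weighted polar coordinates. -/
theorem exists_weighted_polar (r : ℕ) {m : ℕ} (hm : 1 ≤ m) {θ : Fin d₁ → ℝ} (hθ : θ ≠ 0) :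
    ∃ (t : ℝ) (ξ : Fin d₁ → ℝ), 0 < t ∧ ‖ξ‖ = 1 ∧ (t ^ m ≤ ‖θ‖ ∨ t ≤ ‖θ‖) ∧
      θ = wscale r (t ^ m) t ξ := by
  obtain ⟨l₀, hl₀⟩ := Function.ne_iff.1 hθ
  have hm0 : m ≠ 0 := by omega
  -- The radius `t` is the maximum of these weighted sizes. Whether it is attained among the first
  -- `r` coordinates decides between the bounds `t ^ m ≤ ‖θ‖` and `t ≤ ‖θ‖`.
  set g : Fin d₁ → ℝ := fun l => if (l : ℕ) < r then |θ l| ^ ((m : ℝ)⁻¹) else |θ l| with hg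
  have : Nonempty (Fin d₁) := ⟨l₀⟩
  obtain ⟨k, hk⟩ := Finite.exists_max g
  have hpos : 0 < g k := by
    refine lt_of_lt_of_le ?_ (hk l₀)
    have h1 : 0 < |θ l₀| := abs_pos.2 hl₀
    simp only [hg]
    split_ifs
    · exact Real.rpow_pos_of_pos h1 _
    · exact h1
  have hge : ∀ l, g l ≤ g k := hk
  set t := g k with ht
  have hroot : ∀ l : Fin d₁, (l : ℕ) < r → g l ^ m = |θ l| := by
    intro l hl
    simp only [hg, hl, if_true]
    exact Real.rpow_inv_natCast_pow (abs_nonneg _) hm0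
  have htm : 0 < t ^ m := pow_pos hpos m
  refine ⟨t, wscale r (t ^ m)⁻¹ t⁻¹ θ, hpos, le_antisymm ?_ ?_, ?_, ?_⟩
  · rw [pi_norm_le_iff_of_nonneg zero_le_one]
    intro l
    rw [wscale, Real.norm_eq_abs]
    split_ifs with h
    · rw [abs_mul, abs_of_pos (inv_pos.2 htm), ← hroot l h, inv_mul_le_iff₀ htm, mul_one]
      exact pow_le_pow_left₀ (by simp only [hg, h, if_true]; positivity) (hge l) m
    · have h1 := hge l
      simp only [hg, h, if_false] at h1
      rw [abs_mul, abs_of_pos (inv_pos.2 hpos), inv_mul_le_iff₀ hpos, mul_one]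
      exact h1
  · have h1 : ‖wscale r (t ^ m)⁻¹ t⁻¹ θ k‖ = 1 := by
      rw [wscale, Real.norm_eq_abs]
      split_ifs with h
      · rw [abs_mul, abs_of_pos (inv_pos.2 htm), ← hroot k h, inv_mul_cancel₀ htm.ne']
      · have h1 : t = |θ k| := by simp only [ht, hg, h, if_false]
        rw [abs_mul, abs_of_pos (inv_pos.2 hpos), ← h1, inv_mul_cancel₀ hpos.ne']
    rw [← h1]
    exact norm_le_pi_norm _ k
  · have h1 : |θ k| ≤ ‖θ‖ := norm_le_pi_norm θ k
    by_cases h : (k : ℕ) < r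
    · left; rw [ht, hroot k h]; exact h1
    · right
      have h2 : t = |θ k| := by simp only [ht, hg, h, if_false]
      rw [h2]; exact h1
  · funext l
    have h1 := hpos.ne'
    by_cases h : (l : ℕ) < r
    · simp only [wscale, h, if_true]; field_simp
    · simp only [wscale, h, if_false]; field_simp

/-- The factorization at `z = 1`, that is with `s = t ^ m` and `y = t`, has a nonvanishing quotient
near each direction on the sphere. Compactness makes the neighbourhood of `(t, τ)` uniform, and the
limit `t → 0` of the quotient is `D`. -/
theorem uniform_nonvanishing (hm : 1 ≤ m)
    (hK : ∀ᶠ τ in 𝓝 (0 : Fin d₂ → ℝ), HasLeadingForm K r m D τ) (hD : ∀ ξ, D ξ 0 = 0 → ξ = 0) :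
    ∀ᶠ a in 𝓝 ((0, 0) : ℝ × (Fin d₂ → ℝ)), ∀ ξ ∈ Metric.sphere (0 : Fin d₁ → ℝ) 1,
      (a.1 ≠ 0 → K (weighted r (a.1 ^ m) a.1 ξ a.2) ≠ 0) ∧ D ξ a.2 ≠ 0 := by
  refine IsCompact.eventually_forall_of_forall_eventually (isCompact_sphere _ _) fun ξ₀ hξ₀ => ?_
  obtain ⟨B, hB, hfac, ξ, -, hBD, hh, ht⟩ := exists_factorization hm hK ξ₀ 1
  set x₀ : ℝ × WSpace d₁ d₂ := (1, 0, 0, ξ₀, 0) with hx₀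
  have hB0 : B x₀ ≠ 0 := by
    intro h
    have h1 := hD ξ (hBD h)
    have h2 : ξ₀ = 0 := by
      funext l
      by_cases hl : (l : ℕ) < r
      · exact hh l hl (by rw [h1]; rfl)
      · have h3 := congrFun (ht one_ne_zero) l
        simpa [tail, hl, h1] using h3.symm
    rw [h2] at hξ₀
    simp at hξ₀
  have hgood : ∀ᶠ x in 𝓝 x₀, B x ≠ 0 ∧ ContinuousAt B x ∧ ∀ᶠ x in 𝓝 x, x.2.2.1 ^ m = x.2.1 * x.1 →
      K (weightedMap r x.2) = x.2.1 ^ 2 * B x := by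
    filter_upwards [hB.continuousAt.eventually_ne hB0, hB.eventually_analyticAt,
      hfac.eventually_nhds] with x h1 h2 h3 using ⟨h1, h2.continuousAt, h3⟩
  have c1 : Tendsto (fun p : (ℝ × (Fin d₂ → ℝ)) × (Fin d₁ → ℝ) =>
      ((1, p.1.1 ^ m, p.1.1, p.2, p.1.2) : ℝ × WSpace d₁ d₂)) (𝓝 ((0, 0), ξ₀)) (𝓝 x₀) := by
    have : Continuous fun p : (ℝ × (Fin d₂ → ℝ)) × (Fin d₁ → ℝ) =>
      ((1, p.1.1 ^ m, p.1.1, p.2, p.1.2) : ℝ × WSpace d₁ d₂) := by fun_prop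
    simpa [hx₀, show m ≠ 0 by omega] using this.tendsto ((0, 0), ξ₀)
  have c2 : Tendsto (fun p : (ℝ × (Fin d₂ → ℝ)) × (Fin d₁ → ℝ) =>
      ((1, 0, 0, p.2, p.1.2) : ℝ × WSpace d₁ d₂)) (𝓝 ((0, 0), ξ₀)) (𝓝 x₀) := by
    have : Continuous fun p : (ℝ × (Fin d₂ → ℝ)) × (Fin d₁ → ℝ) =>
      ((1, 0, 0, p.2, p.1.2) : ℝ × WSpace d₁ d₂) := by fun_prop
    simpa [hx₀] using this.tendsto ((0, 0), ξ₀)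
  have c3 : Tendsto (fun p : (ℝ × (Fin d₂ → ℝ)) × (Fin d₁ → ℝ) => p.1.2) (𝓝 ((0, 0), ξ₀)) (𝓝 0) := by
    have : Continuous fun p : (ℝ × (Fin d₂ → ℝ)) × (Fin d₁ → ℝ) => p.1.2 := by fun_prop
    exact this.tendsto ((0, 0), ξ₀)
  filter_upwards [c1.eventually hgood, c2.eventually hgood, c3.eventually hK] with p h1 h2 h3
  refine ⟨fun h0 => ?_, ?_⟩
  · have h4 := h1.2.2.self_of_nhds (by simp)
    simp only [weightedMap] at h4
    rw [h4]
    exact mul_ne_zero (pow_ne_zero _ (pow_ne_zero _ h0)) h1.1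
  · have c4 : Tendsto (fun t : ℝ => ((1, t ^ m, t, p.2, p.1.2) : ℝ × WSpace d₁ d₂)) (𝓝[≠] 0)
        (𝓝 (1, 0, 0, p.2, p.1.2)) := by
      have : Continuous fun t : ℝ => ((1, t ^ m, t, p.2, p.1.2) : ℝ × WSpace d₁ d₂) := by fun_prop
      have h := this.tendsto 0
      rw [zero_pow (by omega)] at h
      exact h.mono_left nhdsWithin_le_nhds
    rw [h3.eq_of_tendsto (h2.2.1.tendsto.comp c4) (by
      filter_upwards [c4.eventually h2.2.2] with t ht
      have := ht (by simp)
      simp only [weightedMap] at this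
      rw [this, Function.comp]; ring)]
    exact h2.1

/-- By weighted homogeneity a nonzero `ξ` can be moved to the unit sphere. -/
theorem eventually_leadingForm_ne_zero (hm : 1 ≤ m)
    (hK : ∀ᶠ τ in 𝓝 (0 : Fin d₂ → ℝ), HasLeadingForm K r m D τ) (hD : ∀ ξ, D ξ 0 = 0 → ξ = 0) :
    ∀ᶠ τ in 𝓝 (0 : Fin d₂ → ℝ), ∀ ξ, D ξ τ = 0 → ξ = 0 := by
  have h1 : Tendsto (fun τ : Fin d₂ → ℝ => ((0, τ) : ℝ × (Fin d₂ → ℝ))) (𝓝 0) (𝓝 (0, 0)) :=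
    (Continuous.prodMk_right 0).tendsto _
  filter_upwards [h1.eventually (uniform_nonvanishing hm hK hD), hK] with τ h2 h3 ξ hξ
  by_contra h0
  obtain ⟨t, ξ', ht, hn, -, rfl⟩ := exists_weighted_polar r hm h0
  rw [h3.wscale ht.ne', mul_eq_zero] at hξ
  exact (h2 ξ' (by simpa using hn)).2 (hξ.resolve_left (pow_ne_zero _ ht.ne'))

theorem eventually_mem_centre (hm : 1 ≤ m)
    (hK : ∀ᶠ τ in 𝓝 (0 : Fin d₂ → ℝ), HasLeadingForm K r m D τ) (hD : ∀ ξ, D ξ 0 = 0 → ξ = 0) :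
    ∀ᶠ w in 𝓝 (0 : Param d₁ d₂), K w = 0 → w ∈ centre d₁ d₂ := by
  obtain ⟨δ, hδ, hball⟩ := Metric.eventually_nhds_iff.1 (uniform_nonvanishing hm hK hD)
  -- With `ε ≤ 1`, the radius `ε ^ m` of the ball is at most `ε`, so both alternatives of
  -- `exists_weighted_polar` give `t < ε`.
  set ε : ℝ := min δ 1 with hε
  have hε0 : 0 < ε := lt_min hδ one_pos
  have hε1 : ε ≤ 1 := min_le_right _ _
  filter_upwards [Metric.ball_mem_nhds (0 : Param d₁ d₂) (pow_pos hε0 m)] with w hw h0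
  rw [mem_ball_zero_iff] at hw
  by_contra hc
  have hpow : ε ^ m ≤ ε := pow_le_of_le_one hε0.le hε1 (by omega)
  set θ : Fin d₁ → ℝ := fun l => w (Sum.inl l) with hθ
  have hθ0 : θ ≠ 0 := fun h => hc fun j => congrFun h j
  have hθw : ‖θ‖ ≤ ‖w‖ := (pi_norm_le_iff_of_nonneg (norm_nonneg _)).2 fun l => norm_le_pi_norm w _
  obtain ⟨t, ξ, ht, hn, hle, hwt⟩ := exists_weighted_polar r hm hθ0
  have htε : t < ε := by
    rcases hle with h | h
    · exact lt_of_pow_lt_pow_left₀ m hε0.le (by linarith)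
    · linarith
  set τ : Fin d₂ → ℝ := fun l => w (Sum.inr l) with hτ
  have hτw : ‖τ‖ ≤ ‖w‖ := (pi_norm_le_iff_of_nonneg (norm_nonneg _)).2 fun l => norm_le_pi_norm w _
  have hwe : w = weighted r (t ^ m) t ξ τ := by
    funext i
    rcases i with l | l
    · exact congrFun hwt l
    · rfl
  have hd : dist ((t, τ) : ℝ × (Fin d₂ → ℝ)) (0, 0) < δ := by
    rw [Prod.dist_eq, max_lt_iff, dist_zero_right, dist_zero_right, Real.norm_eq_abs, abs_of_pos ht]
    have : ε ≤ δ := min_le_left _ _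
    exact ⟨by linarith, by linarith⟩
  refine (hball hd ξ (by simpa using hn)).1 ht.ne' ?_
  rw [← hwe]; exact h0

end Uniform

/-! ### The charts in coordinates -/

section Charts

variable {d₁ d₂ r m : ℕ}

/-- The monomial `∏ u_l ^ e_l` in the coordinates `θ`. -/
def mono (e : Fin d₁ → ℕ) (u : Param d₁ d₂) : ℝ := ∏ l, u (Sum.inl l) ^ e l

theorem mono_add (e f : Fin d₁ → ℕ) (u : Param d₁ d₂) : mono (e + f) u = mono e u * mono f u := by
  simp [mono, pow_add, Finset.prod_mul_distrib]

theorem mono_smul (n : ℕ) (e : Fin d₁ → ℕ) (u : Param d₁ d₂) : mono (n • e) u = mono e u ^ n := by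
  simp [mono, pow_mul', Finset.prod_pow]

theorem mono_single (i : Fin d₁) (n : ℕ) (u : Param d₁ d₂) :
    mono (Pi.single i n) u = u (Sum.inl i) ^ n := by
  rw [mono, Finset.prod_eq_single i]
  · simp
  · intro b _ hb; simp [hb]
  · simp

theorem mono_zero (u : Param d₁ d₂) : mono 0 u = 1 := by simp [mono]

theorem mono_eq_zero {e : Fin d₁ → ℕ} {u : Param d₁ d₂} :
    mono e u = 0 ↔ ∃ l, u (Sum.inl l) = 0 ∧ e l ≠ 0 := by
  simp [mono, Finset.prod_eq_zero_iff, pow_eq_zero_iff']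

theorem contDiff_mono (e : Fin d₁ → ℕ) : ContDiff ℝ ω (mono e : Param d₁ d₂ → ℝ) := by
  unfold mono; fun_prop

/-- The multiplicities along the coordinate hyperplanes of a chart of the pull-back of the first `r`
coordinates. -/
def BlowupChart.mult : {n : ℕ} → {j : Fin d₁} → BlowupChart d₁ r n j → Fin d₁ → ℕ
  | _, _, .first j => Pi.single j 1
  | _, _, .next (n := n) (i := i) _ _ j _ =>
      if j = i then Pi.single i (n + 1) else Pi.single i n + Pi.single j (n + 1)

theorem BlowupChart.one_le {n : ℕ} {j : Fin d₁} (c : BlowupChart d₁ r n j) : 1 ≤ n := by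
  cases c <;> omega

/-- Blowing up continues only in charts with `i > r`, where a repeated step stays on the same index.
Hence a second exceptional coordinate can appear only at the very last step, when it moves to an
index `j ≤ r`. -/
theorem BlowupChart.mult_cases {n : ℕ} {j : Fin d₁} (c : BlowupChart d₁ r n j) :
    ((r ≤ (j : ℕ) ∨ n = 1) ∧ c.mult = Pi.single j n) ∨
    ∃ (i : Fin d₁) (n' : ℕ), r ≤ (i : ℕ) ∧ (j : ℕ) < r ∧ 1 ≤ n' ∧ n = n' + 1 ∧
      c.mult = Pi.single i n' + Pi.single j n := by
  cases c with
  | first j => exact Or.inl ⟨Or.inr rfl, rfl⟩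
  | next c hi j hj =>
    rename_i n i
    by_cases h : j = i
    · subst h; left; exact ⟨Or.inl hi, by simp [mult]⟩
    · right
      exact ⟨i, n, hi, hj.resolve_right h, c.one_le, rfl, by simp [mult, h]⟩

theorem BlowupChart.mult_tail {n : ℕ} {j : Fin d₁} (c : BlowupChart d₁ r n j) (h : r ≤ (j : ℕ)) :
    c.mult = Pi.single j n := by
  rcases c.mult_cases with h1 | ⟨i, n', _, h1, _⟩
  · exact h1.2
  · omega

theorem BlowupChart.mult_last {n : ℕ} {j : Fin d₁} (c : BlowupChart d₁ r n j) : c.mult j = n := by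
  rcases c.mult_cases with ⟨-, h⟩ | ⟨i, n', h1, h2, -, h3, h⟩
  · rw [h]; simp
  · have : j ≠ i := fun h => by subst h; omega
    rw [h]; simp [this]

/-- The strictness here is the source of the multiplicity one. -/
theorem BlowupChart.mult_lt {n : ℕ} {j l : Fin d₁} (c : BlowupChart d₁ r n j) (hl : l ≠ j) :
    c.mult l < n := by
  have := c.one_le
  rcases c.mult_cases with ⟨-, h⟩ | ⟨i, n', h1, h2, -, h3, h⟩
  · rw [h]; simp [hl]; omega
  · rw [h]
    by_cases hi : l = i
    · subst hi; simp [hl]; omega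
    · simp [hl, hi]; omega

theorem BlowupChart.mult_le {n : ℕ} {j : Fin d₁} (c : BlowupChart d₁ r n j) (l : Fin d₁) :
    c.mult l ≤ n := by
  by_cases h : l = j
  · rw [h, c.mult_last]
  · exact (c.mult_lt h).le

/-- The exponents cut off at `1`. -/
def red (ν : Fin d₁ → ℕ) : Fin d₁ → ℕ := fun l => min (ν l) 1

theorem red_single (i : Fin d₁) {n : ℕ} (hn : 1 ≤ n) :
    red (Pi.single i n : Fin d₁ → ℕ) = Pi.single i 1 := by
  funext l
  by_cases h : l = i
  · subst h; simp [red, hn]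
  · simp [red, h]

theorem red_pair {i j : Fin d₁} (hij : i ≠ j) {a b : ℕ} (ha : 1 ≤ a) (hb : 1 ≤ b) :
    red (Pi.single i a + Pi.single j b : Fin d₁ → ℕ) = Pi.single i 1 + Pi.single j 1 := by
  funext l
  by_cases h : l = i
  · subst h; simp [red, hij, ha]
  · by_cases h' : l = j
    · subst h'; simp [red, hij.symm, hb]
    · simp [red, h, h']

/-- The coordinates `θ` with those of the exceptional surfaces replaced by `1`. -/
def strict (ν : Fin d₁ → ℕ) (u : Param d₁ d₂) : Fin d₁ → ℝ :=
  fun l => if ν l = 0 then u (Sum.inl l) else 1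

/-- The toric map with multiplicities `ν`. -/
def toricMap (r : ℕ) (ν : Fin d₁ → ℕ) (u : Param d₁ d₂) : Param d₁ d₂ :=
  weighted r (mono ν u) (mono (red ν) u) (strict ν u) fun j => u (Sum.inr j)

/-- In the inductive step the previous chart has the single exceptional coordinate `u_i`, with
multiplicity `n`. A step to `j ≠ i` replaces `u_i` by `u_i u_j` and brings one more factor `u_j`
into the first `r` coordinates, which gives the exponents `n` and `n + 1`. -/
theorem BlowupChart.toMap_eq {n : ℕ} {j : Fin d₁} (c : BlowupChart d₁ r n j) (u : Param d₁ d₂) :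
    c.toMap d₂ u = toricMap r c.mult u := by
  induction c generalizing u with
  | first j =>
    funext k
    rcases k with l | l
    · simp only [toMap, coordBlowup, toricMap, weighted, mult, Sum.elim_inl, red_single j le_rfl,
        mono_single, strict, Set.mem_range, Sum.inl.injEq, exists_eq, true_and, ite_self, pow_one]
      by_cases h : l = j
      · subst h; simp
      · simp [h]
    · simp [toMap, coordBlowup, toricMap, weighted]
  | next c hi j hj ih =>
    rename_i n i
    have hn := c.one_le
    rw [toMap, Function.comp, ih]
    simp only [toricMap, c.mult_tail hi, red_single i hn, mono_single, pow_one]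
    funext k
    rcases k with l | l
    · by_cases hji : j = i
      · subst hji
        simp only [mult, if_true, weighted, Sum.elim_inl, coordBlowup, strict,
          red_single j (Nat.succ_pos n), mono_single]
        by_cases hlj : l = j
        · subst hlj
          have : ¬ ((l : ℕ) < r) := by omega
          simp [this, show n ≠ 0 by omega]
        · by_cases hlr : (l : ℕ) < r
          · simp [hlr, hlj, pow_succ, mul_assoc]
          · simp [hlr, hlj]
      · have hj' := hj.resolve_right hji
        have hij : i ≠ j := fun h => hji h.symm
        simp only [mult, hji, if_false, weighted, Sum.elim_inl, coordBlowup, strict,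
          red_pair hij hn (Nat.succ_pos n), mono_add, mono_single]
        by_cases hlj : l = j
        · subst hlj
          simp [hj', hij, hji, show n ≠ 0 by omega]
          ring
        · by_cases hli : l = i
          · subst hli
            have : ¬ ((l : ℕ) < r) := by omega
            simp [this, hij, show n ≠ 0 by omega]
            ring
          · by_cases hlr : (l : ℕ) < r
            · simp [hlr, hlj, hli, hij]; ring
            · simp [hlr, hlj, hli, hij, mul_comm]
    · simp [weighted, coordBlowup]

theorem contDiff_toricMap (r : ℕ) (ν : Fin d₁ → ℕ) : ContDiff ℝ ω (toricMap r ν : Param d₁ d₂ → _) := by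
  rw [contDiff_pi]
  intro k
  have h1 := contDiff_mono (d₂ := d₂) ν
  have h2 := contDiff_mono (d₂ := d₂) (red ν)
  rcases k with l | l
  · by_cases hl : (l : ℕ) < r <;> by_cases hν : ν l = 0 <;>
      simp only [toricMap, weighted, Sum.elim_inl, hl, strict, hν, if_true, if_false] <;> fun_prop
  · simp only [toricMap, weighted, Sum.elim_inr]; fun_prop

theorem toMap_eq_toricMap {n : ℕ} {j : Fin d₁} (c : BlowupChart d₁ r n j) :
    c.toMap d₂ = toricMap r c.mult := funext c.toMap_eq

/-! ### Jacobians -/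

/-- The Jacobian matrix of a coordinate blow-up has this shape. It factors as `(1 + c e_jᵀ) diag a`
because `a j = 1`, and the first factor has determinant `1 + c j = 1`. -/
theorem det_diag_add_col {ι : Type*} [Fintype ι] [DecidableEq ι] (a c : ι → ℝ) (j : ι) (ha : a j = 1)
    (hc : c j = 0) : (Matrix.diagonal a + Matrix.vecMulVec c (Pi.single j (1 : ℝ))).det = ∏ k, a k := by
  have h1 : Matrix.diagonal a + Matrix.vecMulVec c (Pi.single j (1 : ℝ)) =
      (1 + Matrix.replicateCol Unit c * Matrix.replicateRow Unit (Pi.single j (1 : ℝ))) *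
        Matrix.diagonal a := by
    ext k l
    rw [Matrix.mul_diagonal]
    by_cases hl : l = j
    · subst hl
      by_cases hk : k = l
      · subst hk; simp [Matrix.vecMulVec_apply, Matrix.mul_apply, ha]
      · simp [Matrix.vecMulVec_apply, Matrix.mul_apply, ha, hk]
    · by_cases hk : k = l
      · subst hk; simp [Matrix.vecMulVec_apply, Matrix.mul_apply, hl]
      · simp [Matrix.vecMulVec_apply, Matrix.mul_apply, hk, hl]
  rw [h1, Matrix.det_mul, Matrix.det_one_add_replicateCol_mul_replicateRow, Matrix.det_diagonal]
  simp [hc]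

theorem det_fderiv_coordBlowup {ι : Type*} [Fintype ι] (J : Set ι) (j : ι) (u : ι → ℝ) {a : ι → ℝ}
    (ha : ∀ k ∈ J, k ≠ j → a k = u j) (ha' : ∀ k, ¬ (k ∈ J ∧ k ≠ j) → a k = 1) :
    DifferentiableAt ℝ (coordBlowup J j) u ∧ (fderiv ℝ (coordBlowup J j) u).det = ∏ k, a k := by
  classical
  set c : ι → ℝ := fun k => if k ∈ J ∧ k ≠ j then u k else 0 with hc
  have h : HasFDerivAt (coordBlowup J j)
      (Matrix.toLin' (Matrix.diagonal a + Matrix.vecMulVec c (Pi.single j (1 : ℝ)))).toContinuousLinearMap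
      u := by
    rw [hasFDerivAt_pi']
    intro k
    have hj := hasFDerivAt_apply (𝕜 := ℝ) j u
    have hk := hasFDerivAt_apply (𝕜 := ℝ) k u
    by_cases hkJ : k ∈ J ∧ k ≠ j
    · have := hj.mul hk
      have e1 : (fun x : ι → ℝ => coordBlowup J j x k) = fun x => x j * x k := by
        funext x; simp [coordBlowup, hkJ]
      rw [e1]
      refine this.congr_fderiv ?_
      ext v
      simp [ha k hkJ.1 hkJ.2, hc, hkJ, Matrix.mulVec_diagonal, Matrix.vecMulVec_mulVec]
      ring
    · have e1 : (fun x : ι → ℝ => coordBlowup J j x k) = fun x => x k := by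
        funext x; simp only [coordBlowup, hkJ, if_false]
      rw [e1]
      refine hk.congr_fderiv ?_
      ext v
      simp [ha' k hkJ, hc, hkJ, Matrix.mulVec_diagonal, Matrix.vecMulVec_mulVec]
  refine ⟨h.differentiableAt, ?_⟩
  rw [h.fderiv]
  exact (LinearMap.det_toLin' _).trans (det_diag_add_col a c j (ha' j (by simp)) (by simp [hc]))

/-- The exponents of the Jacobian of a chart with multiplicities `ν`. -/
def jac (d₁ r : ℕ) (ν : Fin d₁ → ℕ) : Fin d₁ → ℕ :=
  fun l => if ν l = 0 then 0 else r * ν l + (d₁ - r) - 1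

theorem jac_single (i : Fin d₁) {n : ℕ} (hn : 1 ≤ n) :
    jac d₁ r (Pi.single i n) = Pi.single i (r * n + (d₁ - r) - 1) := by
  funext l
  by_cases h : l = i
  · subst h; simp [jac, show n ≠ 0 by omega]
  · simp [jac, h]

theorem jac_pair {i j : Fin d₁} (hij : i ≠ j) {a b : ℕ} (ha : 1 ≤ a) (hb : 1 ≤ b) :
    jac d₁ r (Pi.single i a + Pi.single j b) =
      Pi.single i (r * a + (d₁ - r) - 1) + Pi.single j (r * b + (d₁ - r) - 1) := by
  funext l
  by_cases h : l = i
  · subst h; simp [jac, hij, show a ≠ 0 by omega]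
  · by_cases h' : l = j
    · subst h'; simp [jac, hij.symm, show b ≠ 0 by omega]
    · simp [jac, h, h']

/-- The later centres have codimension `r + 1`, so each later blow-up contributes `u_j ^ r` to the
Jacobian. -/
theorem card_erase_insert (hr : r ≤ d₁) {i j : Fin d₁} (hi : r ≤ (i : ℕ)) (hj : (j : ℕ) < r ∨ j = i) :
    (Finset.univ.filter fun l : Fin d₁ => ((l : ℕ) < r ∨ l = i) ∧ l ≠ j).card = r := by
  have h1 : (Finset.univ.filter fun l : Fin d₁ => ((l : ℕ) < r ∨ l = i) ∧ l ≠ j) =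
      (insert i (Finset.univ.filter fun l : Fin d₁ => (l : ℕ) < r)).erase j := by
    ext l; simp; tauto
  have h2 : i ∉ Finset.univ.filter fun l : Fin d₁ => (l : ℕ) < r := by simp [hi]
  rw [h1, Finset.card_erase_of_mem (by simp; tauto), Finset.card_insert_of_notMem h2,
    Fin.card_filter_val_lt]
  omega

/-- Chain rule: the first blow-up contributes the exponent `d₁ - 1` and each further one adds `r`.
When the index changes from `i` to `j`, the old factor is also evaluated at `u_i u_j`. -/
theorem BlowupChart.det_fderiv (hr : r ≤ d₁) {n : ℕ} {j : Fin d₁} (c : BlowupChart d₁ r n j)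
    (u : Param d₁ d₂) : (fderiv ℝ (c.toMap d₂) u).det = mono (jac d₁ r c.mult) u := by
  classical
  induction c generalizing u with
  | first j =>
    rw [toMap, (det_fderiv_coordBlowup _ _ u
      (a := Sum.elim (fun l => if l ≠ j then u (Sum.inl j) else 1) 1)
      (by rintro k ⟨l, rfl⟩ hk; simp_all) (by rintro (l | l) hk <;> simp_all)).2,
      Fintype.prod_sum_type]
    simp only [mult, jac_single j le_rfl, mono_single, Sum.elim_inl, Sum.elim_inr, Pi.one_apply,
      Finset.prod_const_one, mul_one]
    rw [← Finset.prod_filter, Finset.prod_const, Finset.filter_ne', Finset.card_erase_of_mem (by simp),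
      Finset.card_univ, Fintype.card_fin]
    congr 1
    omega
  | next c hi j hj ih =>
    rename_i n i
    have hn := c.one_le
    obtain ⟨hd, hdet⟩ := det_fderiv_coordBlowup
      {k : Fin d₁ ⊕ Fin d₂ | ∃ l : Fin d₁, k = Sum.inl l ∧ ((l : ℕ) < r ∨ l = i)} (Sum.inl j) u
      (a := Sum.elim (fun l => if ((l : ℕ) < r ∨ l = i) ∧ l ≠ j then u (Sum.inl j) else 1) 1)
      (by rintro k ⟨l, rfl, hl⟩ hk; simp_all) (by rintro (l | l) hk <;> simp_all)
    have hd2 : DifferentiableAt ℝ (c.toMap d₂) (coordBlowup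
      {k : Fin d₁ ⊕ Fin d₂ | ∃ l : Fin d₁, k = Sum.inl l ∧ ((l : ℕ) < r ∨ l = i)} (Sum.inl j) u) := by
      rw [toMap_eq_toricMap]
      exact (contDiff_toricMap r _).differentiable (by simp) _
    rw [toMap, fderiv_comp _ hd2 hd]
    have hcomp : ∀ A B : Param d₁ d₂ →L[ℝ] Param d₁ d₂, (A.comp B).det = A.det * B.det :=
      fun A B => LinearMap.det_comp _ _
    rw [hcomp, ih, hdet, c.mult_tail hi, jac_single i hn, mono_single, Fintype.prod_sum_type]
    simp only [Sum.elim_inl, Sum.elim_inr, Pi.one_apply, Finset.prod_const_one, mul_one]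
    rw [← Finset.prod_filter, Finset.prod_const, card_erase_insert hr hi hj]
    have hi' := i.2
    by_cases hji : j = i
    · subst hji
      simp only [mult, if_true, jac_single j (Nat.succ_pos n), mono_single]
      have h2 : r * (n + 1) + (d₁ - r) - 1 = (r * n + (d₁ - r) - 1) + r := by
        rw [mul_add, mul_one]; omega
      simp [coordBlowup, h2, pow_add]
    · have hj' := hj.resolve_right hji
      have hij : i ≠ j := fun h => hji h.symm
      simp only [mult, hji, if_false, jac_pair hij hn (Nat.succ_pos n), mono_add, mono_single]
      have h2 : r * (n + 1) + (d₁ - r) - 1 = (r * n + (d₁ - r) - 1) + r := by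
        rw [mul_add, mul_one]; omega
      simp [coordBlowup, h2, pow_add, hij, mul_pow]
      ring

end Charts

/-! ### Normal crossings in the charts -/

section Crossing

variable {d₁ d₂ r m : ℕ}

/-- The exponents at `Q` of a monomial, in coordinates centred at `Q`. -/
def localExp (e : Fin d₁ → ℕ) (Q : Param d₁ d₂) : Fin d₁ → ℕ :=
  fun l => if Q (Sum.inl l) = 0 then e l else 0

/-- The factors whose coordinate does not vanish at `Q` are units there and go into `a`. -/
theorem mono_translate (e : Fin d₁ → ℕ) (Q : Param d₁ d₂) : ∃ a : Param d₁ d₂ → ℝ,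
    AnalyticAt ℝ a 0 ∧ a 0 ≠ 0 ∧ ∀ u, mono e (Q + u) =
      a u * ∏ i, u i ^ (Sum.elim (localExp e Q) 0 : Fin d₁ ⊕ Fin d₂ → ℕ) i := by
  refine ⟨fun u => ∏ l, if Q (Sum.inl l) = 0 then 1 else (Q (Sum.inl l) + u (Sum.inl l)) ^ e l,
    ?_, ?_, fun u => ?_⟩
  · refine ContDiffAt.analyticAt (ContDiff.contDiffAt (contDiff_prod fun l _ => ?_))
    by_cases h : Q (Sum.inl l) = 0
    · simp only [h, if_true]; fun_prop
    · simp only [h, if_false]; fun_prop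
  · rw [Finset.prod_ne_zero_iff]
    intro l _
    by_cases h : Q (Sum.inl l) = 0 <;> simp [h]
  · rw [Fintype.prod_sum_type, mono]
    simp only [Sum.elim_inl, Sum.elim_inr, Pi.zero_apply, pow_zero, Finset.prod_const_one, mul_one,
      localExp, Pi.add_apply]
    rw [← Finset.prod_mul_distrib]
    refine Finset.prod_congr rfl fun l _ => ?_
    by_cases h : Q (Sum.inl l) = 0 <;> simp [h]

theorem isNormalCrossing_of_monomial {F : Param d₁ d₂ → ℝ} {g : Param d₁ d₂ → Param d₁ d₂}
    {e f : Fin d₁ → ℕ} {A : Param d₁ d₂ → ℝ} {Q : Param d₁ d₂} (hA : AnalyticAt ℝ A Q)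
    (hAQ : A Q ≠ 0) (hF : ∀ᶠ u in 𝓝 Q, F (g u) = mono e u * A u)
    (hdet : ∀ u, (fderiv ℝ g u).det = mono f u) :
    IsNormalCrossing F (fun u => g (Q + u)) (Sum.elim (localExp e Q) 0)
      (Sum.elim (localExp f Q) 0) := by
  obtain ⟨a, ha, ha0, hae⟩ := mono_translate e Q
  obtain ⟨b, hb, hb0, hbe⟩ := mono_translate f Q
  have ht : Tendsto (fun u : Param d₁ d₂ => Q + u) (𝓝 0) (𝓝 Q) := by
    have : Continuous fun u : Param d₁ d₂ => Q + u := by fun_prop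
    simpa using this.tendsto 0
  have hta : AnalyticAt ℝ (fun u : Param d₁ d₂ => Q + u) 0 := by fun_prop
  refine ⟨⟨fun u => a u * A (Q + u), ha.mul ?_, ?_, ?_⟩, b, hb, hb0, Eventually.of_forall fun u => ?_⟩
  · refine AnalyticAt.comp (g := A) (f := fun u : Param d₁ d₂ => Q + u) (x := 0) ?_ hta
    simpa using hA
  · simpa using ⟨ha0, hAQ⟩
  · filter_upwards [ht.eventually hF] with u hu
    rw [hu, hae]; ring
  · rw [fderiv_comp_add_left, hdet, hbe]

theorem FinalChart.map_eq (c : FinalChart d₁ r m) : c.map d₂ = toricMap r c.chart.mult :=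
  toMap_eq_toricMap c.chart

theorem FinalChart.mult_le (c : FinalChart d₁ r m) (l : Fin d₁) : c.chart.mult l ≤ m :=
  (c.chart.mult_le l).trans c.le

/-- The coordinate function with index `last` pulls back to a pure monomial in the exceptional
coordinates, so its vanishing alone already suffices. -/
theorem mem_excSet {c : FinalChart d₁ r m} {Q : Param d₁ d₂} :
    Q ∈ excSet d₂ c ↔ ∃ l, Q (Sum.inl l) = 0 ∧ c.chart.mult l ≠ 0 := by
  rw [excSet, Set.mem_preimage, c.map_eq]
  have h1 : mono c.chart.mult Q = 0 ↔ ∃ l, Q (Sum.inl l) = 0 ∧ c.chart.mult l ≠ 0 := mono_eq_zero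
  have h2 : mono (red c.chart.mult) Q = 0 ↔ ∃ l, Q (Sum.inl l) = 0 ∧ c.chart.mult l ≠ 0 := by
    rw [mono_eq_zero]
    refine exists_congr fun l => and_congr_right fun _ => ?_
    simp only [red]; omega
  constructor
  · intro h
    have h3 := h c.last
    have h4 : c.chart.mult c.last ≠ 0 := by
      rw [c.chart.mult_last]; have := c.chart.one_le; omega
    simp only [toricMap, weighted, Sum.elim_inl, strict, h4, if_false, mul_one] at h3
    split_ifs at h3
    · exact h1.1 h3
    · exact h2.1 h3
  · intro h l
    simp only [toricMap, weighted, Sum.elim_inl, h1.2 h, h2.2 h, zero_mul, ite_self]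

/-- The complementary exponents: `z` with `s z = y ^ m`. -/
def compl (m : ℕ) (ν : Fin d₁ → ℕ) : Fin d₁ → ℕ := fun l => if ν l = 0 then 0 else m - ν l

/-- The relation `y ^ m = s z` under which `exists_factorization` applies to a chart. -/
theorem mono_red_pow {ν : Fin d₁ → ℕ} (h : ∀ l, ν l ≤ m) (u : Param d₁ d₂) :
    mono (red ν) u ^ m = mono ν u * mono (compl m ν) u := by
  rw [← mono_smul, ← mono_add]
  congr 1
  funext l
  have := h l
  simp only [red, compl, Pi.smul_apply, Pi.add_apply, smul_eq_mul]
  split_ifs with h0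
  · simp [h0]
  · rw [min_eq_right (by omega)]; omega

/-- The exponents of the divergence at a point of a chart. -/
def expK (c : FinalChart d₁ r m) (Q : Param d₁ d₂) : Fin d₁ → ℕ := localExp (2 • c.chart.mult) Q

/-- The exponents of the Jacobian at a point of a chart. -/
def expJ (c : FinalChart d₁ r m) (Q : Param d₁ d₂) : Fin d₁ → ℕ := localExp (jac d₁ r c.chart.mult) Q

/-- The function is normal crossing at the point `Q` of a chart, with the expected exponents. -/
def CrossingAt (K : Param d₁ d₂ → ℝ) (c : FinalChart d₁ r m) (Q : Param d₁ d₂) : Prop :=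
  IsNormalCrossing K (fun u => c.map d₂ (Q + u)) (Sum.elim (expK c Q) 0) (Sum.elim (expJ c Q) 0)

variable {K : Param d₁ d₂ → ℝ} {D : (Fin d₁ → ℝ) → (Fin d₂ → ℝ) → ℝ}

/-- The factorization is pulled back along `u ↦ (z, s, y, strict, τ)`, and `s ^ 2` becomes the
monomial with exponents `2 ν`. The hypothesis `hne` excludes a zero of `D` related to `Q` as in
`exists_factorization`, so the remaining factor is a unit. -/
theorem eventually_crossingAt (hm : 1 ≤ m) (hr : r ≤ d₁) (c : FinalChart d₁ r m) {Q : Param d₁ d₂}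
    (hQ : Q ∈ excSet d₂ c)
    (hK : ∀ᶠ τ in 𝓝 (fun j => Q (Sum.inr j)), HasLeadingForm K r m D τ)
    (hne : ∀ ξ : Fin d₁ → ℝ, D ξ (fun j => Q (Sum.inr j)) = 0 →
      (∀ l : Fin d₁, (l : ℕ) < r → ξ l = 0 → strict c.chart.mult Q l = 0) →
      (mono (compl m c.chart.mult) Q ≠ 0 → tail r ξ = tail r (strict c.chart.mult Q)) → False) :
    ∀ᶠ u in 𝓝 Q, CrossingAt K c u := by
  set ν := c.chart.mult with hν
  obtain ⟨B, hB, hfac, ξ, -, hBD, h1, h2⟩ := exists_factorization hm hK (strict ν Q)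
    (mono (compl m ν) Q)
  set Λ : Param d₁ d₂ → ℝ × WSpace d₁ d₂ := fun u => (mono (compl m ν) u, mono ν u, mono (red ν) u,
    strict ν u, fun j => u (Sum.inr j)) with hΛ
  obtain ⟨l, hl, hl0⟩ := mem_excSet.1 hQ
  rw [← hν] at hl0
  have hΛQ : Λ Q = (mono (compl m ν) Q, 0, 0, strict ν Q, fun j => Q (Sum.inr j)) := by
    have e1 : mono ν Q = 0 := mono_eq_zero.2 ⟨l, hl, hl0⟩
    have e2 : mono (red ν) Q = 0 := mono_eq_zero.2 ⟨l, hl, by simp only [red]; omega⟩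
    simp only [hΛ, e1, e2]
  have hs : ContDiff ℝ ω (strict ν : Param d₁ d₂ → _) := by
    rw [contDiff_pi]; intro l
    by_cases h : ν l = 0
    · simp only [strict, h, if_true]; fun_prop
    · simp only [strict, h, if_false]; fun_prop
  have hΛa : AnalyticAt ℝ Λ Q := by
    refine ContDiffAt.analyticAt (ContDiff.contDiffAt ?_)
    have e1 := contDiff_mono (d₂ := d₂) (compl m ν)
    have e2 := contDiff_mono (d₂ := d₂) ν
    have e3 := contDiff_mono (d₂ := d₂) (red ν)
    have e4 : ContDiff ℝ ω fun u : Param d₁ d₂ => fun j : Fin d₂ => u (Sum.inr j) := by fun_prop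
    exact e1.prodMk (e2.prodMk (e3.prodMk (hs.prodMk e4)))
  rw [← hΛQ] at hB hfac hBD
  have hA : AnalyticAt ℝ (B ∘ Λ) Q := hB.comp hΛa
  have hA0 : (B ∘ Λ) Q ≠ 0 := fun h => hne ξ (hBD h) h1 h2
  have hF : ∀ᶠ u in 𝓝 Q, K (c.map d₂ u) = mono (2 • ν) u * (B ∘ Λ) u := by
    filter_upwards [hΛa.continuousAt.eventually hfac] with u hu
    have := hu (mono_red_pow c.mult_le u)
    rw [c.map_eq, mono_smul]
    exact this
  filter_upwards [hA.eventually_analyticAt, hA.continuousAt.eventually_ne hA0,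
    hF.eventually_nhds] with u a1 a2 a3
  exact isNormalCrossing_of_monomial a1 a2 a3 fun u => c.chart.det_fderiv hr u

theorem strict_last (c : FinalChart d₁ r m) (Q : Param d₁ d₂) : strict c.chart.mult Q c.last = 1 := by
  have := c.chart.one_le
  simp [strict, c.chart.mult_last, show c.n ≠ 0 by omega]

/-- In these charts the only multiplicity is `m`, so `z = 1` and the tail of the direction is
remembered by `exists_factorization`. -/
theorem compl_tail (c : FinalChart d₁ r m) (h : r ≤ (c.last : ℕ)) : compl m c.chart.mult = 0 := by
  funext l
  rw [c.chart.mult_tail h, c.halted h]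
  by_cases hl : l = c.last
  · subst hl; simp [compl]
  · simp [compl, hl]

/-- The strict direction has the entry `1` at the last exceptional index, so it cannot come from `ξ
= 0`: for `last < r` the head condition contradicts this, otherwise the tail condition does. -/
theorem eventually_crossingAt_of_forall (hm : 1 ≤ m) (hr : r ≤ d₁) (c : FinalChart d₁ r m)
    {Q : Param d₁ d₂} (hQ : Q ∈ excSet d₂ c)
    (hK : ∀ᶠ τ in 𝓝 (fun j => Q (Sum.inr j)), HasLeadingForm K r m D τ)
    (hne : ∀ ξ : Fin d₁ → ℝ, D ξ (fun j => Q (Sum.inr j)) = 0 → ξ = 0) :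
    ∀ᶠ u in 𝓝 Q, CrossingAt K c u := by
  refine eventually_crossingAt hm hr c hQ hK fun ξ hξ h1 h2 => ?_
  obtain rfl := hne ξ hξ
  have h3 := strict_last c Q
  by_cases hl : (c.last : ℕ) < r
  · rw [h1 c.last hl rfl] at h3; exact zero_ne_one h3
  · have h4 := congrFun (h2 (by simp [compl_tail c (not_lt.1 hl), mono_zero])) c.last
    simp [tail, hl, h3] at h4

/-- A zero of `D` is impossible in a chart with `last < r`, since its head vanishes while the strict
entry at `last` is `1`. In the remaining charts it yields exactly the conditions that define
`badSet`. -/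
theorem eventually_crossingAt_of_notMem_badSet {χ : Type*} [MeasurableSpace χ] {μ : Measure χ}
    {q : χ → ℝ} {p : χ → Param d₁ d₂ → ℝ} (hm : 1 ≤ m) (hr : r ≤ d₁) (c : FinalChart d₁ r m)
    (hK : ∀ᶠ τ in 𝓝 (0 : Fin d₂ → ℝ), HasLeadingForm K r m D τ)
    (hD : ∀ ξ, D ξ 0 = 0 → (∀ l : Fin d₁, (l : ℕ) < r → ξ l = 0) ∧ VanishingDir μ q p r m ξ)
    {Q : Param d₁ d₂} (hQ : Q ∈ excSet d₂ c) (hQS : Q ∉ badSet μ q p c)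
    (hτ : ∀ j, Q (Sum.inr j) = 0) : ∀ᶠ u in 𝓝 Q, CrossingAt K c u := by
  have hτ' : (fun j => Q (Sum.inr j)) = 0 := funext hτ
  refine eventually_crossingAt (D := D) hm hr c hQ (by rwa [hτ']) fun ξ hξ h1 h2 => hQS ?_
  rw [hτ'] at hξ
  obtain ⟨h3, h4⟩ := hD ξ hξ
  have h5 := strict_last c Q
  have hl : r ≤ (c.last : ℕ) := by
    by_contra h
    rw [h1 c.last (not_le.1 h) (h3 _ (not_le.1 h))] at h5; exact zero_ne_one h5
  have hmult := c.chart.mult_tail hl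
  have h6 := h2 (by simp [compl_tail c hl, mono_zero])
  have hn := c.chart.one_le
  refine ⟨hl, fun j hj => ?_, ?_, hτ, ?_⟩
  · have h7 := h1 j hj (h3 j hj)
    have h8 : j ≠ c.last := fun h => by subst h; omega
    simpa [strict, hmult, h8] using h7
  · obtain ⟨l, h7, h8⟩ := mem_excSet.1 hQ
    rw [hmult] at h8
    have : l = c.last := by
      by_contra h; simp [h] at h8
    rwa [← this]
  · have h7 : strict c.chart.mult Q = Function.update (fun j => Q (Sum.inl j)) c.last 1 := by
      funext j
      by_cases hj : j = c.last
      · rw [hj, h5]; simp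
      · simp [strict, hmult, hj]
    rw [VanishingDir, ← h7, ← h6]
    exact h4

/-! ### The ratios -/

theorem ratio_eq_top {h k : ℕ} (hk : k = 0) : ratio h k = ⊤ := by
  subst hk
  simp [ratio, ENNReal.div_zero]

theorem ratio_exp (hd : 1 ≤ d₁) (hr : r ≤ d₁) (c : FinalChart d₁ r m) {Q : Param d₁ d₂} {i : Fin d₁}
    (hQ : Q (Sum.inl i) = 0) (hν : c.chart.mult i ≠ 0) :
    ratio (expJ c Q i) (expK c Q i) = ENNReal.ofReal
      (((d₁ : ℝ) - r + r * c.chart.mult i) / (2 * c.chart.mult i)) := by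
  set n := c.chart.mult i with hn
  -- This makes the truncated subtraction in `jac` a genuine one.
  have h0 : 1 ≤ r * n + (d₁ - r) := by
    have : 1 ≤ n := by omega
    nlinarith [Nat.sub_add_cancel hr]
  have hK : expK c Q i = 2 * n := by simp [expK, localExp, hQ, hn]
  have hJ : expJ c Q i = r * n + (d₁ - r) - 1 := by simp [expJ, localExp, hQ, jac, ← hn, hν]
  have hnpos : (0 : ℝ) < n := by exact_mod_cast Nat.pos_of_ne_zero hν
  rw [ratio, hK, hJ, ENNReal.ofReal_div_of_pos (by positivity)]
  congr 1
  · have : ((d₁ : ℝ) - r + r * n) = ((r * n + (d₁ - r) - 1 + 1 : ℕ) : ℝ) := by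
      rw [Nat.sub_add_cancel h0]; push_cast [Nat.cast_sub hr]; ring
    rw [this, ENNReal.ofReal_natCast]; push_cast; rfl
  · have : (2 * (n : ℝ)) = ((2 * n : ℕ) : ℝ) := by push_cast; rfl
    rw [this, ENNReal.ofReal_natCast]

/-- The quotient is `(d₁ - r) / (2 ν) + r / 2`, which does not increase with `ν`, and `ν ≤ m`. -/
theorem lam_le_ratio (hd : 1 ≤ d₁) (hr : r ≤ d₁) (c : FinalChart d₁ r m)
    (Q : Param d₁ d₂) (i : Fin d₁) : lam d₁ r m ≤ ratio (expJ c Q i) (expK c Q i) := by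
  by_cases hQ : Q (Sum.inl i) = 0 ∧ c.chart.mult i ≠ 0
  · rw [ratio_exp hd hr c hQ.1 hQ.2, lam]
    refine ENNReal.ofReal_le_ofReal ?_
    have h1 : (c.chart.mult i : ℝ) ≤ m := by exact_mod_cast c.mult_le i
    have h2 : (0 : ℝ) < c.chart.mult i := by exact_mod_cast Nat.pos_of_ne_zero hQ.2
    have h3 : (r : ℝ) ≤ d₁ := by exact_mod_cast hr
    rw [div_le_div_iff₀ (by linarith) (by linarith)]
    nlinarith [mul_nonneg (sub_nonneg.2 h3) (sub_nonneg.2 h1)]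
  · rw [ratio_eq_top]
    · exact le_top
    · simp only [expK, localExp, Pi.smul_apply, smul_eq_mul]
      split_ifs with h
      · have : c.chart.mult i = 0 := by by_contra h'; exact hQ ⟨h, h'⟩
        rw [this, mul_zero]
      · rfl

theorem ratio_eq_lam (hd : 1 ≤ d₁) (hr : r ≤ d₁) (c : FinalChart d₁ r m)
    {Q : Param d₁ d₂} {i : Fin d₁} (hQ : Q (Sum.inl i) = 0) (hi : c.chart.mult i = m) (hm : 1 ≤ m) :
    ratio (expJ c Q i) (expK c Q i) = lam d₁ r m := by
  rw [ratio_exp hd hr c hQ (by omega), lam, hi]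

/-- For `r < d₁` the quotient is strictly decreasing in `ν`. For `r = d₁` it is constant, but then
`m = 1` leaves a single possible multiplicity. -/
theorem mult_of_ratio_eq_lam (hd : 1 ≤ d₁) (hr : r ≤ d₁) (hrm : r < d₁ ↔ 2 ≤ m) (c : FinalChart d₁ r m)
    {Q : Param d₁ d₂} {i : Fin d₁} (h : ratio (expJ c Q i) (expK c Q i) = lam d₁ r m) :
    Q (Sum.inl i) = 0 ∧ c.chart.mult i = m := by
  by_cases hQ : Q (Sum.inl i) = 0 ∧ c.chart.mult i ≠ 0
  · refine ⟨hQ.1, ?_⟩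
    rw [ratio_exp hd hr c hQ.1 hQ.2, lam] at h
    have h1 : (c.chart.mult i : ℝ) ≤ m := by exact_mod_cast c.mult_le i
    have h2 : (0 : ℝ) < c.chart.mult i := by exact_mod_cast Nat.pos_of_ne_zero hQ.2
    have h3 : (r : ℝ) ≤ d₁ := by exact_mod_cast hr
    have h4 : (0 : ℝ) ≤ r := Nat.cast_nonneg r
    rw [ENNReal.ofReal_eq_ofReal_iff
      (div_nonneg (add_nonneg (by linarith) (mul_nonneg h4 h2.le)) (by linarith))
      (div_nonneg (add_nonneg (by linarith) (mul_nonneg h4 (by linarith))) (by linarith)),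
      div_eq_div_iff (by linarith) (by linarith)] at h
    have h5 : ((d₁ : ℝ) - r) * (m - c.chart.mult i) = 0 := by linarith
    rcases mul_eq_zero.1 h5 with h6 | h6
    · have h7 : d₁ = r := by exact_mod_cast (sub_eq_zero.1 h6)
      have := c.mult_le i
      have h8 := hQ.2
      have h9 : ¬ 2 ≤ m := fun h => by have := hrm.2 h; omega
      omega
    · have : (c.chart.mult i : ℝ) = m := by linarith
      exact_mod_cast this
  · rw [ratio_eq_top] at h
    · exact absurd h.symm ENNReal.ofReal_ne_top
    · simp only [expK, localExp, Pi.smul_apply, smul_eq_mul]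
      split_ifs with h
      · have : c.chart.mult i = 0 := by by_contra h'; exact hQ ⟨h, h'⟩
        rw [this, mul_zero]
      · rfl

theorem ratio_eq_lam_subset (hd : 1 ≤ d₁) (hr : r ≤ d₁) (hrm : r < d₁ ↔ 2 ≤ m) (c : FinalChart d₁ r m)
    (Q : Param d₁ d₂) : {i : Fin d₁ | ratio (expJ c Q i) (expK c Q i) = lam d₁ r m} ⊆ {c.last} := by
  intro i hi
  have h1 := (mult_of_ratio_eq_lam hd hr hrm c hi).2
  by_contra h
  have := c.chart.mult_lt (l := i) h
  have := c.le
  omega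

/-! ### Existence of charts -/

/-- The chart after `n + 1` blow-ups with exceptional surface `{θ_i = 0}`, `i > r`. -/
def BlowupChart.ofTail {i : Fin d₁} (hi : r ≤ (i : ℕ)) : (n : ℕ) → BlowupChart d₁ r (n + 1) i
  | 0 => .first i
  | n + 1 => .next (ofTail hi n) hi i (Or.inr rfl)

/-- The final chart with exceptional surface `{θ_i = 0}`, `i > r`. -/
def FinalChart.ofTail (hm : 1 ≤ m) {i : Fin d₁} (hi : r ≤ (i : ℕ)) : FinalChart d₁ r m where
  n := m - 1 + 1
  last := i
  chart := .ofTail hi (m - 1)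
  le := by omega
  halted _ := by omega

/-- The final chart of the first blow-up with exceptional surface `{θ_j = 0}`, `j ≤ r`. -/
def FinalChart.ofHead (hm : 1 ≤ m) {j : Fin d₁} (hj : (j : ℕ) < r) : FinalChart d₁ r m where
  n := 1
  last := j
  chart := .first j
  le := hm
  halted h := absurd h (not_le.2 hj)

/-- The final chart of the blow-up number `n + 2` with exceptional surface `{θ_j = 0}`, `j ≤ r`, over
the chart of index `i`. -/
def FinalChart.ofPair {i j : Fin d₁} (hi : r ≤ (i : ℕ)) (hj : (j : ℕ) < r) {n : ℕ} (hn : n + 2 ≤ m) :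
    FinalChart d₁ r m where
  n := n + 1 + 1
  last := j
  chart := .next (.ofTail hi n) hi j (Or.inl hj)
  le := hn
  halted h := absurd h (not_le.2 hj)

end Crossing

/-! ### The blow-ups off the exceptional subset -/

section Blowups

variable {χ : Type*} [MeasurableSpace χ] {μ : Measure χ} {q : χ → ℝ} {d₁ d₂ r m : ℕ}
  {Θ : Set (Param d₁ d₂)} {p : χ → Param d₁ d₂ → ℝ}

theorem FinalChart.map_tail (c : FinalChart d₁ r m) (hc : r ≤ (c.last : ℕ)) (u : Param d₁ d₂) :
    c.map d₂ u = Sum.elim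
      (fun j : Fin d₁ => if (j : ℕ) < r then u (Sum.inl c.last) ^ m * u (Sum.inl j)
        else if j = c.last then u (Sum.inl j) else u (Sum.inl c.last) * u (Sum.inl j))
      (fun j : Fin d₂ => u (Sum.inr j)) := by
  have hn := c.chart.one_le
  have hm := c.halted hc
  rw [c.map_eq, c.chart.mult_tail hc, toricMap, red_single _ hn, mono_single, mono_single, pow_one, hm]
  funext k
  rcases k with l | l
  · by_cases hl : l = c.last
    · subst hl
      have h1 : ¬ ((c.last : ℕ) < r) := not_lt.2 hc
      simp [weighted, strict, h1, show m ≠ 0 by omega]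
    · simp [weighted, strict, hl]
  · rfl

/-- The open set on which the exceptional set consists of normal crossing points. -/
def crossingSet (K : Param d₁ d₂ → ℝ) (c : FinalChart d₁ r m) : Set (Param d₁ d₂) :=
  {Q | ∀ᶠ u in 𝓝 Q, u ∈ excSet d₂ c → CrossingAt K c u}

theorem isOpen_crossingSet (K : Param d₁ d₂ → ℝ) (c : FinalChart d₁ r m) :
    IsOpen (crossingSet K c) :=
  isOpen_iff_mem_nhds.2 fun _ hQ => hQ.eventually_nhds

theorem CrossingAt.of_mem {K : Param d₁ d₂ → ℝ} {c : FinalChart d₁ r m} {Q : Param d₁ d₂}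
    (h : Q ∈ crossingSet K c) (hQ : Q ∈ excSet d₂ c) : CrossingAt K c Q :=
  Eventually.self_of_nhds h hQ

theorem zero_mem_excSet (c : FinalChart d₁ r m) : (0 : Param d₁ d₂) ∈ excSet d₂ c := by
  have := c.chart.one_le
  exact mem_excSet.2 ⟨c.last, rfl, by rw [c.chart.mult_last]; omega⟩

theorem eq_zero_of_leadingForm {hr : r ≤ d₁} {D : (Fin d₁ → ℝ) → (Fin d₂ → ℝ) → ℝ}
    (hD : ∀ ξ, D ξ 0 = 0 → (∀ l : Fin d₁, (l : ℕ) < r → ξ l = 0) ∧ VanishingDir μ q p r m ξ)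
    (hind : ∀ v : Fin d₁ → ℝ, tail r v ≠ 0 → IndependentDir μ q p hr m v) :
    ∀ ξ, D ξ 0 = 0 → ξ = 0 := by
  intro ξ hξ
  obtain ⟨h1, h2⟩ := hD ξ hξ
  have h3 : tail r ξ = 0 := by
    by_contra h
    exact (hind ξ h).not_vanishing h2
  funext l
  by_cases hl : (l : ℕ) < r
  · exact h1 l hl
  · simpa [tail, hl] using congrFun h3 l

/-- There is a point of `U₀ \ S` over the origin at which the exponent `lam` is attained. -/
theorem exists_attaining (hm : 1 ≤ m) (hr : r ≤ d₁) (hrm : r < d₁ ↔ 2 ≤ m)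
    (h : 0 < r ∨ ∃ v : Fin d₁ → ℝ, tail r v ≠ 0 ∧ IndependentDir μ q p hr m v) :
    ∃ (c : FinalChart d₁ r m) (Q : Param d₁ d₂), Q ∈ excSet d₂ c ∧ Q ∉ badSet μ q p c ∧
      (∀ j, Q (Sum.inr j) = 0) ∧ Q (Sum.inl c.last) = 0 ∧ c.n = m := by
  rcases h with h0 | ⟨v, hv, hvi⟩
  -- For `r ≥ 1` the origin of a chart with `last < r` reached after exactly `m` blow-ups will do,
  -- since `S` does not meet such charts. For `m ≥ 2` the last step must leave a chart of index `i >
  -- r`.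
  · have : ∃ c : FinalChart d₁ r m, (c.last : ℕ) < r ∧ c.n = m := by
      by_cases h1 : r < d₁
      · have h2 := hrm.1 h1
        exact ⟨.ofPair (i := ⟨r, h1⟩) (j := ⟨0, by omega⟩) le_rfl h0 (n := m - 2) (by omega), h0,
          show m - 2 + 1 + 1 = m by omega⟩
      · have h2 : m = 1 := by
          by_contra h; exact h1 (hrm.2 (by omega))
        exact ⟨.ofHead hm (j := ⟨0, by omega⟩) h0, h0, h2.symm⟩
    obtain ⟨c, hc, hn⟩ := this
    exact ⟨c, 0, zero_mem_excSet c, fun h => absurd h.1 (not_le.2 hc), fun _ => rfl, rfl, hn⟩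
  · obtain ⟨i, hi⟩ := Function.ne_iff.1 hv
    have hir : r ≤ (i : ℕ) := by
      by_contra h; simp [tail, not_le.1 h] at hi
    have hvi0 : v i ≠ 0 := by simpa [tail, not_lt.2 hir] using hi
    set c : FinalChart d₁ r m := .ofTail hm hir with hc
    have hlast : c.last = i := rfl
    have hn : c.n = m := Nat.sub_add_cancel hm
    -- The independent direction is normalized to have `i`-th entry `1`, which is the entry that
    -- `badSet` inserts; homogeneity of `F_m` undoes the scaling.
    set Q : Param d₁ d₂ := Sum.elim (Function.update (fun l => (v i)⁻¹ * tail r v l) i 0) 0 with hQ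
    have hQi : Q (Sum.inl c.last) = 0 := by
      rw [hlast, hQ, Sum.elim_inl, Function.update_self]
    refine ⟨c, Q, mem_excSet.2 ⟨c.last, hQi, ?_⟩, fun hb => ?_, fun _ => rfl, hQi, hn⟩
    · rw [c.chart.mult_last]; omega
    · have h1 := hb.2.2.2.2
      rw [hlast] at h1
      have h2 : tail r (Function.update (fun j => Q (Sum.inl j)) i 1) = (v i)⁻¹ • tail r v := by
        funext l
        by_cases hl : l = i
        · subst hl; simp [tail, not_lt.2 hir, hvi0]
        · have h3 : Q (Sum.inl l) = (v i)⁻¹ * tail r v l := by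
            rw [hQ, Sum.elim_inl, Function.update_of_ne hl]
          rw [tail, Function.update_of_ne hl, h3, Pi.smul_apply, smul_eq_mul]
          by_cases hlr : (l : ℕ) < r
          · rw [if_pos hlr, tail, if_pos hlr, mul_zero]
          · rw [if_neg hlr]
      refine hvi.not_vanishing ?_
      filter_upwards [h1] with x hx
      rw [h2, taylorTerm] at hx
      have h3 : (fun _ : Fin m => (Sum.elim ((v i)⁻¹ • tail r v) 0 : Param d₁ d₂)) =
          fun _ => (v i)⁻¹ • (Sum.elim (tail r v) 0 : Param d₁ d₂) := by
        funext _ k; rcases k with l | l <;> simp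
      rw [h3] at hx
      have h4 := (iteratedFDeriv ℝ m (logRatio p x) (Sum.elim 0 0)).map_smul_univ
        (fun _ => (v i)⁻¹) (fun _ => (Sum.elim (tail r v) 0 : Param d₁ d₂))
      rw [h4] at hx
      have h5 : (m.factorial : ℝ) ≠ 0 := by positivity
      simpa [taylorTerm, h5, hvi0] using hx

theorem normal_crossing_off_badSet (hd : 1 ≤ d₁) (hr : r ≤ d₁) (hmodel : IsModel μ q Θ p)
    (hass : MainAssumption μ q p hr m) :
    ∃ (Ω : FinalChart d₁ r m → Set (Param d₁ d₂))
      (k h : FinalChart d₁ r m → Param d₁ d₂ → Fin d₁ → ℕ),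
      (∀ c, IsOpen (Ω c)) ∧
      (∀ c, ∀ Q ∈ excSet d₂ c \ badSet μ q p c, (∀ j, Q (Sum.inr j) = 0) → Q ∈ Ω c) ∧
      ((∀ v : Fin d₁ → ℝ, tail r v ≠ 0 → IndependentDir μ q p hr m v) →
        ∃ T ∈ 𝓝 (0 : Fin d₂ → ℝ), ∀ c, ∀ Q ∈ excSet d₂ c, (fun j => Q (Sum.inr j)) ∈ T → Q ∈ Ω c) ∧
      (∀ c, ∀ Q ∈ Ω c ∩ (excSet d₂ c \ badSet μ q p c),
        IsNormalCrossing (klDiv μ q p) (fun u => c.map d₂ (Q + u))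
          (Sum.elim (k c Q) 0) (Sum.elim (h c Q) 0)) ∧
      ((0 < r ∨ ∃ v : Fin d₁ → ℝ, tail r v ≠ 0 ∧ IndependentDir μ q p hr m v) →
        (⨅ (c : FinalChart d₁ r m) (Q : Param d₁ d₂)
          (_ : Q ∈ Ω c ∩ (excSet d₂ c \ badSet μ q p c)) (i : Fin d₁),
          ratio (h c Q i) (k c Q i)) = lam d₁ r m ∧
        IsGreatest {N : ℕ | ∃ (c : FinalChart d₁ r m),
          ∃ Q ∈ Ω c ∩ (excSet d₂ c \ badSet μ q p c),
            N = {i : Fin d₁ | ratio (h c Q i) (k c Q i) = lam d₁ r m}.ncard} 1) := by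
  have hm := hass.one_le
  have hrm := hass.lt_iff
  obtain ⟨D, hK, hD⟩ := exists_leadingForm hmodel hass
  have hΩ : ∀ c : FinalChart d₁ r m, ∀ Q ∈ excSet d₂ c \ badSet μ q p c, (∀ j, Q (Sum.inr j) = 0) →
      Q ∈ crossingSet (klDiv μ q p) c := fun c Q hQ hτ =>
    (eventually_crossingAt_of_notMem_badSet hm hr c hK hD hQ.1 hQ.2 hτ).mono fun _ h _ => h
  refine ⟨crossingSet (klDiv μ q p), expK, expJ, isOpen_crossingSet _, hΩ, fun hind => ?_,
    fun c Q hQ => CrossingAt.of_mem hQ.1 hQ.2.1, fun hex => ?_⟩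
  · have hD' : ∀ ξ, D ξ 0 = 0 → ξ = 0 := eq_zero_of_leadingForm hD hind
    refine ⟨{τ | (∀ᶠ τ in 𝓝 τ, HasLeadingForm (klDiv μ q p) r m D τ) ∧ ∀ ξ, D ξ τ = 0 → ξ = 0},
      hK.eventually_nhds.and (eventually_leadingForm_ne_zero hm hK hD'), fun c Q hQ hτ => ?_⟩
    exact (eventually_crossingAt_of_forall hm hr c hQ hτ.1 hτ.2).mono fun _ h _ => h
  · obtain ⟨c, Q, hQ1, hQ2, hQ3, hQ4, hn⟩ := exists_attaining (μ := μ) (q := q) (p := p) hm hr hrm hex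
    have hQΩ := hΩ c Q ⟨hQ1, hQ2⟩ hQ3
    have hlam := ratio_eq_lam hd hr c hQ4 (c.chart.mult_last.trans hn) hm
    refine ⟨le_antisymm ?_ ?_, ?_, ?_⟩
    · exact (iInf_le _ c).trans ((iInf_le _ Q).trans ((iInf_le _ (⟨hQΩ, hQ1, hQ2⟩ : Q ∈
        crossingSet (klDiv μ q p) c ∩ (excSet d₂ c \ badSet μ q p c))).trans
        ((iInf_le _ c.last).trans hlam.le)))
    · exact le_iInf fun c => le_iInf fun Q => le_iInf fun _ => le_iInf fun i => lam_le_ratio hd hr c Q i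
    · refine ⟨c, Q, ⟨hQΩ, hQ1, hQ2⟩, ?_⟩
      have : {i : Fin d₁ | ratio (expJ c Q i) (expK c Q i) = lam d₁ r m} = {c.last} :=
        (ratio_eq_lam_subset hd hr hrm c Q).antisymm (Set.singleton_subset_iff.2 hlam)
      rw [this, Set.ncard_singleton]
    · rintro N ⟨c, Q, -, rfl⟩
      rw [← Set.ncard_singleton c.last]
      exact Set.ncard_le_ncard (ratio_eq_lam_subset hd hr hrm c Q) (Set.finite_singleton _)

end Blowups

/-! ### Resolutions from embedded charts -/

theorem IsNormalCrossing.congr {ι : Type*} [Fintype ι] {F : (ι → ℝ) → ℝ}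
    {γ γ' : (ι → ℝ) → (ι → ℝ)} {k h : ι → ℕ} (hγ : IsNormalCrossing F γ k h) (he : γ' =ᶠ[𝓝 0] γ) :
    IsNormalCrossing F γ' k h := by
  obtain ⟨⟨a, ha, ha0, hae⟩, b, hb, hb0, hbe⟩ := hγ
  refine ⟨⟨a, ha, ha0, ?_⟩, b, hb, hb0, ?_⟩
  · filter_upwards [hae, he] with u h1 h2
    rw [h2, h1]
  · filter_upwards [hbe, he.fderiv (𝕜 := ℝ)] with u h1 h2
    rw [h2, h1]

/-- A modification of `ℝ ^ ι` with centre `Z`, given by finitely many charts `map c` and embedded in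
`ℝ ^ ι × Y` by the functions `ext c`, which extend the function `graph` defined off `Z`. -/
structure BlowupAtlas (ι κ Y : Type) [Fintype ι] [NormedAddCommGroup Y] [NormedSpace ℝ Y]
    (Z : Set (ι → ℝ)) where
  /-- the blow-down in a chart -/
  map : κ → (ι → ℝ) → (ι → ℝ)
  /-- the second component of the embedding in a chart -/
  ext : κ → (ι → ℝ) → Y
  /-- the coordinates of a chart in terms of the embedding -/
  coord : κ → (ι → ℝ) × Y → (ι → ℝ)
  /-- the domain of the coordinates -/
  dom : κ → Set ((ι → ℝ) × Y)
  /-- the second component of the embedding off `Z` -/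
  graph : (ι → ℝ) → Y
  isClosed_centre : IsClosed Z
  isOpen_dom : ∀ c, IsOpen (dom c)
  contDiff_map : ∀ c, ContDiff ℝ ω (map c)
  contDiff_ext : ∀ c, ContDiff ℝ ω (ext c)
  contDiffOn_coord : ∀ c, ContDiffOn ℝ ω (coord c) (dom c)
  contDiffAt_graph : ∀ w ∉ Z, ContDiffAt ℝ ω graph w
  mem_dom : ∀ c u, (map c u, ext c u) ∈ dom c
  coord_apply : ∀ c u, coord c (map c u, ext c u) = u
  dense_compl : ∀ c, Dense {u | map c u ∉ Z}
  ext_eq : ∀ c u, map c u ∉ Z → ext c u = graph (map c u)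
  map_coord : ∀ c, ∀ w ∉ Z, (w, graph w) ∈ dom c → map c (coord c (w, graph w)) = w
  bounded : ∀ R : ℝ, ∃ R' : ℝ, ∀ w ∉ Z, ‖w‖ ≤ R → ∃ c u, ‖u‖ ≤ R' ∧ map c u = w

namespace BlowupAtlas

variable {ι κ Y : Type} [Fintype ι] [NormedAddCommGroup Y] [NormedSpace ℝ Y] {Z : Set (ι → ℝ)}
  (A : BlowupAtlas ι κ Y Z)

/-- The embedding of a chart. -/
def param (c : κ) (u : ι → ℝ) : (ι → ℝ) × Y := (A.map c u, A.ext c u)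

theorem contDiff_param (c : κ) : ContDiff ℝ ω (A.param c) :=
  (A.contDiff_map c).prodMk (A.contDiff_ext c)

theorem param_eq_graph {c : κ} {u : ι → ℝ} (h : A.map c u ∉ Z) :
    A.param c u = (A.map c u, A.graph (A.map c u)) := by rw [param, A.ext_eq c u h]

/-- Off the centre both sides lie on the graph, where `map_coord` gives the equality. It extends
across the exceptional set by continuity and density. -/
theorem param_coord {c c' : κ} {u : ι → ℝ} (h : A.param c' u ∈ A.dom c) :
    A.param c (A.coord c (A.param c' u)) = A.param c' u := by
  by_contra hne
  have h1 : ContinuousAt (A.param c') u := (A.contDiff_param c').continuous.continuousAt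
  have h2 : ContinuousAt (A.coord c) (A.param c' u) :=
    (A.contDiffOn_coord c).continuousOn.continuousAt ((A.isOpen_dom c).mem_nhds h)
  have h3 : ContinuousAt (fun v => A.param c (A.coord c (A.param c' v)) - A.param c' v) u :=
    ((A.contDiff_param c).continuous.continuousAt.comp (h2.comp h1)).sub h1
  have h4 := (h3.eventually_ne (sub_ne_zero.2 hne)).and
    (h1.eventually ((A.isOpen_dom c).mem_nhds h))
  obtain ⟨v, hv3, hv1, hv2⟩ := (A.dense_compl c').inter_nhds_nonempty h4
  rw [A.param_eq_graph hv3] at hv1 hv2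
  have h5 := A.map_coord c _ hv3 hv2
  refine hv1 (sub_eq_zero.2 ?_)
  rw [A.param_eq_graph (by rw [h5]; exact hv3), h5]

/-- Finitely many charts restricted to a closed ball have a compact image, hence a closed one. It
contains the points off the centre by `bounded`, hence their limits; the bound `R + 1` leaves room
for the approximation. -/
theorem exists_bound [Finite κ] (R : ℝ) : ∃ R' : ℝ, ∀ c' u', ‖A.map c' u'‖ ≤ R →
    ∃ c u, ‖u‖ ≤ R' ∧ A.param c u = A.param c' u' := by
  obtain ⟨R', hR'⟩ := A.bounded (R + 1)
  refine ⟨R', fun c' u' hu' => ?_⟩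
  set C : Set ((ι → ℝ) × Y) := ⋃ c, A.param c '' Metric.closedBall 0 R' with hC
  have hCc : IsCompact C := isCompact_iUnion fun c =>
    (isCompact_closedBall _ _).image (A.contDiff_param c).continuous
  have hmem : A.param c' u' ∈ C := by
    by_contra hn
    have h1 : ∀ᶠ v in 𝓝 u', A.param c' v ∉ C :=
      (A.contDiff_param c').continuous.continuousAt.eventually
        (hCc.isClosed.isOpen_compl.mem_nhds hn)
    have h2 : ∀ᶠ v in 𝓝 u', ‖A.map c' v‖ < R + 1 :=
      (A.contDiff_map c').continuous.norm.continuousAt.eventually_lt continuousAt_const (by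
        linarith)
    obtain ⟨v, hv3, hv1, hv2⟩ := (A.dense_compl c').inter_nhds_nonempty (h1.and h2)
    obtain ⟨c, u, hu, hcu⟩ := hR' _ hv3 hv2.le
    refine hv1 (Set.mem_iUnion.2 ⟨c, u, by simpa using hu, ?_⟩)
    rw [A.param_eq_graph hv3, A.param_eq_graph (by rw [hcu]; exact hv3), hcu]
  obtain ⟨c, u, hu, h⟩ := Set.mem_iUnion.1 hmem
  exact ⟨c, u, by simpa using hu, h⟩

/-- The total space over the open set `W`. -/
def Space (W : Set (ι → ℝ)) : Type := {x : (ι → ℝ) × Y // (∃ c u, A.param c u = x) ∧ x.1 ∈ W}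

instance (W : Set (ι → ℝ)) : TopologicalSpace (A.Space W) := instTopologicalSpaceSubtype

instance (W : Set (ι → ℝ)) : T2Space (A.Space W) :=
  inferInstanceAs (T2Space {x : (ι → ℝ) × Y // (∃ c u, A.param c u = x) ∧ x.1 ∈ W})

instance (W : Set (ι → ℝ)) [SecondCountableTopology Y] : SecondCountableTopology (A.Space W) :=
  TopologicalSpace.Subtype.secondCountableTopology _

variable {W : Set (ι → ℝ)}

theorem isInducing_val : Topology.IsInducing (fun x : A.Space W => x.1) := ⟨rfl⟩

/-- The point of the total space over a point off the centre. -/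
def graphPoint {w : ι → ℝ} (h : ∃ c u, A.param c u = (w, A.graph w)) (hw : w ∈ W) : A.Space W :=
  ⟨(w, A.graph w), h, hw⟩

/-- The point of the total space with given coordinates in a chart. -/
def point (c : κ) (u : ι → ℝ) (h : A.map c u ∈ W) : A.Space W := ⟨A.param c u, ⟨c, u, rfl⟩, h⟩

theorem Space.param_coord {A : BlowupAtlas ι κ Y Z} (x : A.Space W) {c : κ} (h : x.1 ∈ A.dom c) :
    A.param c (A.coord c x.1) = x.1 := by
  obtain ⟨x, ⟨c', u, rfl⟩, hx⟩ := x
  exact A.param_coord h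

theorem Space.map_coord {A : BlowupAtlas ι κ Y Z} (x : A.Space W) {c : κ} (h : x.1 ∈ A.dom c) :
    A.map c (A.coord c x.1) = x.1.1 := congrArg Prod.fst (x.param_coord h)

open Classical in
/-- The chart `c`, with origin of the coordinates at `q`. -/
def chart [Nonempty (A.Space W)] (hW : IsOpen W) (c : κ) (q : ι → ℝ) :
    OpenPartialHomeomorph (A.Space W) (ι → ℝ) where
  toFun x := A.coord c x.1 - q
  invFun u := if h : A.map c (q + u) ∈ W then A.point c (q + u) h else Classical.arbitrary _
  source := {x | x.1 ∈ A.dom c}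
  target := {u | A.map c (q + u) ∈ W}
  map_source' x hx := by
    have h1 := x.map_coord hx
    simp only [Set.mem_ofPred_eq, add_sub_cancel, h1]
    exact x.2.2
  map_target' u hu := by
    have hu' : A.map c (q + u) ∈ W := hu
    simp only [hu', dif_pos, Set.mem_ofPred_eq]
    exact A.mem_dom c _
  left_inv' x hx := by
    have h1 := x.map_coord hx
    have h2 : A.map c (q + (A.coord c x.1 - q)) ∈ W := by
      rw [add_sub_cancel, h1]; exact x.2.2
    simp only [h2, dif_pos]
    refine Subtype.ext ?_
    simp only [point, add_sub_cancel]
    exact x.param_coord hx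
  right_inv' u hu := by
    have hu' : A.map c (q + u) ∈ W := hu
    simp only [hu', dif_pos]
    have : A.coord c (A.point c (q + u) hu').1 = q + u := A.coord_apply c _
    rw [this]; abel
  open_source := (A.isOpen_dom c).preimage continuous_subtype_val
  open_target := by
    have : Continuous fun u => A.map c (q + u) :=
      (A.contDiff_map c).continuous.comp (continuous_const.add continuous_id)
    exact hW.preimage this
  continuousOn_toFun := by
    refine ContinuousOn.sub ?_ continuousOn_const
    exact (A.contDiffOn_coord c).continuousOn.comp continuous_subtype_val.continuousOn fun x hx => hx
  continuousOn_invFun := by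
    rw [A.isInducing_val.continuousOn_iff]
    have : Continuous fun u => A.param c (q + u) :=
      (A.contDiff_param c).continuous.comp (continuous_const.add continuous_id)
    refine this.continuousOn.congr fun u hu => ?_
    have hu' : A.map c (q + u) ∈ W := hu
    simp only [Function.comp, hu', dif_pos]
    rfl

section Manifold

variable [Nonempty (A.Space W)] (hW : IsOpen W)

theorem chart_apply (c : κ) (q : ι → ℝ) (x : A.Space W) : A.chart hW c q x = A.coord c x.1 - q := rfl

theorem chart_target (c : κ) (q : ι → ℝ) : (A.chart hW c q).target = {u | A.map c (q + u) ∈ W} := rfl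

theorem chart_symm_val (c : κ) (q : ι → ℝ) {u : ι → ℝ} (hu : A.map c (q + u) ∈ W) :
    ((A.chart hW c q).symm u).1 = A.param c (q + u) := by
  have : (A.chart hW c q).symm u = A.point c (q + u) hu := dif_pos hu
  rw [this]; rfl

/-- The manifold structure with a prescribed choice `sel` of a chart at each point. -/
abbrev chartedSpace (sel : A.Space W → κ) (hsel : ∀ x, x.1 ∈ A.dom (sel x)) :
    ChartedSpace (ι → ℝ) (A.Space W) where
  atlas := {e | ∃ c q, e = A.chart hW c q}
  chartAt x := A.chart hW (sel x) (A.coord (sel x) x.1)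
  mem_chart_source x := hsel x
  chart_mem_atlas _ := ⟨_, _, rfl⟩

theorem isManifold (sel : A.Space W → κ) (hsel : ∀ x, x.1 ∈ A.dom (sel x)) :
    let := A.chartedSpace hW sel hsel
    IsManifold 𝓘(ℝ, ι → ℝ) ω (A.Space W) := by
  let := A.chartedSpace hW sel hsel
  refine isManifold_of_contDiffOn _ _ _ ?_
  rintro _ _ ⟨c, q, rfl⟩ ⟨c', q', rfl⟩
  have h1 : ContDiffOn ℝ ω (fun u => A.coord c' (A.param c (q + u)) - q')
      {u | A.param c (q + u) ∈ A.dom c'} := by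
    refine ContDiffOn.sub ?_ contDiffOn_const
    refine (A.contDiffOn_coord c').comp (ContDiff.contDiffOn ?_) fun u hu => hu
    exact (A.contDiff_param c).comp (contDiff_const.add contDiff_id)
  have h2 : ∀ u ∈ ((A.chart hW c q).symm ≫ₕ A.chart hW c' q').source,
      A.map c (q + u) ∈ W ∧ A.param c (q + u) ∈ A.dom c' := by
    intro u hu
    rw [OpenPartialHomeomorph.trans_source, OpenPartialHomeomorph.symm_source] at hu
    have hu1 : A.map c (q + u) ∈ W := hu.1
    have hu2 : ((A.chart hW c q).symm u).1 ∈ A.dom c' := hu.2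
    rw [A.chart_symm_val hW c q hu1] at hu2
    exact ⟨hu1, hu2⟩
  refine (h1.mono fun u hu => (h2 u ?_).2).congr fun u hu => ?_
  · simpa using hu
  · have h3 := h2 u (by simpa using hu)
    have : ((A.chart hW c q).symm ≫ₕ A.chart hW c' q') u = A.coord c' ((A.chart hW c q).symm u).1 - q' :=
      rfl
    simp only [modelWithCornersSelf_coe, modelWithCornersSelf_coe_symm, Function.comp, id]
    rw [this, A.chart_symm_val hW c q h3.1]

end Manifold

/-- The manifold is the part over `W` of the union of the embedded charts, `g` is the projection to
the base, and its inverse off the zero set is the graph. Being a subspace of `ℝ ^ ι × Y`, it is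
Hausdorff and second countable without gluing arguments. -/
theorem exists_resolution [Finite κ] [SecondCountableTopology Y] {F : (ι → ℝ) → ℝ} {P : ι → ℝ}
    (hW : IsOpen W) (hP : P ∈ W) (hF : AnalyticOnNhd ℝ F W) (hFZ : ∀ w ∈ W, F w = 0 ↔ w ∈ Z)
    (hPZ : P ∈ Z) (k h : κ → (ι → ℝ) → ι → ℕ)
    (hcr : ∀ c Q, A.map c Q ∈ W → A.map c Q ∈ Z →
      IsNormalCrossing F (fun u => A.map c (Q + u)) (k c Q) (h c Q))
    {c₀ : κ} {Q₀ : ι → ℝ} (h₀ : A.map c₀ Q₀ = P) :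
    ∃ R : Resolution F P,
      (∀ Q, ∃ c u, R.k Q = k c u ∧ R.h Q = h c u) ∧
      ∃ Q, R.g Q = P ∧ R.k Q = k c₀ Q₀ ∧ R.h Q = h c₀ Q₀ := by
  classical
  set x₀ : A.Space W := A.point c₀ Q₀ (h₀ ▸ hP) with hx₀
  have : Nonempty (A.Space W) := ⟨x₀⟩
  have hex : ∀ x : A.Space W, ∃ c, x.1 ∈ A.dom c := by
    rintro ⟨x, ⟨c, u, rfl⟩, hx⟩
    exact ⟨c, A.mem_dom c u⟩
  choose sel' hsel' using hex
  -- The recorded exponents depend on the chart selected at a point. Forcing the chart `c₀` at `x₀`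
  -- makes the prescribed exponents occur in the resolution.
  set sel : A.Space W → κ := fun x => if x = x₀ then c₀ else sel' x with hseldef
  have hsel : ∀ x, x.1 ∈ A.dom (sel x) := by
    intro x
    by_cases hx : x = x₀
    · simp only [hseldef, hx, if_true]; exact A.mem_dom c₀ Q₀
    · simp only [hseldef, hx, if_false]; exact hsel' x
  let cs := A.chartedSpace hW sel hsel
  have := A.isManifold hW sel hsel
  have hatlas : ∀ c q, A.chart hW c q ∈ IsManifold.maximalAtlas 𝓘(ℝ, ι → ℝ) ω (A.Space W) :=
    fun c q => IsManifold.subset_maximalAtlas ⟨c, q, rfl⟩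
  have hgraph : ∀ w ∈ W, w ∉ Z → (∃ c u, A.param c u = (w, A.graph w)) := by
    intro w hw hwZ
    obtain ⟨R', hR'⟩ := A.bounded ‖w‖
    obtain ⟨c, u, -, hcu⟩ := hR' w hwZ le_rfl
    exact ⟨c, u, by rw [A.param_eq_graph (by rw [hcu]; exact hwZ), hcu]⟩
  set s : (ι → ℝ) → A.Space W := fun w =>
    if hw : w ∈ W ∧ w ∉ Z then A.graphPoint (hgraph w hw.1 hw.2) hw.1 else x₀ with hs
  have hsv : ∀ w ∈ W, w ∉ Z → (s w).1 = (w, A.graph w) := by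
    intro w h1 h2
    simp only [hs]
    rw [dif_pos ⟨h1, h2⟩]
    rfl
  let R : Resolution F P :=
    { W := W
      isOpen_W := hW
      mem_W := hP
      analytic_F := hF
      zero_F := (hFZ P hP).2 hPZ
      U := A.Space W
      charted := cs
      mfd := this
      g := fun x => x.1.1
      mapsTo := fun x => x.2.2
      analytic_g := by
        intro x
        have h1 := contMDiffAt_of_mem_maximalAtlas (hatlas (sel x) 0) (hsel x)
        have h2 : ContMDiffAt 𝓘(ℝ, ι → ℝ) 𝓘(ℝ, ι → ℝ) ω (A.map (sel x) ∘ A.chart hW (sel x) 0) x :=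
          (A.contDiff_map (sel x)).contMDiff.contMDiffAt.comp x h1
        refine h2.congr_of_eventuallyEq ?_
        filter_upwards [(A.chart hW (sel x) 0).open_source.mem_nhds (hsel x)] with y hy
        rw [Function.comp, chart_apply, sub_zero, y.map_coord hy]
      proper := by
        intro C hCW hC
        obtain ⟨B, hB⟩ := hC.isBounded.exists_norm_le
        obtain ⟨R', hR'⟩ := A.exists_bound B
        rw [A.isInducing_val.isCompact_iff]
        -- By `exists_bound` the preimage of `C` is covered by bounded, hence compact, pieces of the
        -- charts.
        have : (fun x : A.Space W => x.1) '' ((fun x : A.Space W => x.1.1) ⁻¹' C) =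
            ⋃ c, A.param c '' (Metric.closedBall 0 R' ∩ A.map c ⁻¹' C) := by
          ext y
          simp only [Set.mem_image, Set.mem_iUnion, Set.mem_preimage, Set.mem_inter_iff,
            mem_closedBall_zero_iff]
          constructor
          · rintro ⟨⟨y, ⟨c', u', rfl⟩, hy⟩, hyC, rfl⟩
            obtain ⟨c, u, hu, hcu⟩ := hR' c' u' (hB _ hyC)
            refine ⟨c, u, ⟨hu, ?_⟩, hcu⟩
            have : A.map c u = A.map c' u' := congrArg Prod.fst hcu
            rw [this]; exact hyC
          · rintro ⟨c, u, ⟨-, hu⟩, rfl⟩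
            exact ⟨A.point c u (hCW hu), hu, rfl⟩
        rw [this]
        refine isCompact_iUnion fun c => IsCompact.image ?_ (A.contDiff_param c).continuous
        exact (isCompact_closedBall _ _).inter_right
          (hC.isClosed.preimage (A.contDiff_map c).continuous)
      iso := by
        refine ⟨s, ?_, ?_, ?_⟩
        · rintro w ⟨hw, hFw⟩
          refine ContMDiffAt.contMDiffWithinAt ?_
          have hwZ : w ∉ Z := fun h => hFw ((hFZ w hw).2 h)
          set c := sel (s w) with hc
          have hdom : (w, A.graph w) ∈ A.dom c := by
            have := hsel (s w)
            rwa [hsv w hw hwZ] at this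
          have hga : ContDiffAt ℝ ω (fun w => (w, A.graph w)) w :=
            contDiffAt_id.prodMk (A.contDiffAt_graph w hwZ)
          have hca : ContDiffAt ℝ ω (fun w => A.coord c (w, A.graph w)) w :=
            ContDiffAt.comp w ((A.contDiffOn_coord c).contDiffAt ((A.isOpen_dom c).mem_nhds hdom)) hga
          have hev : ∀ᶠ w' in 𝓝 w, w' ∈ W ∧ w' ∉ Z ∧ (w', A.graph w') ∈ A.dom c :=
            (hW.eventually_mem hw).and ((A.isClosed_centre.isOpen_compl.eventually_mem hwZ).and
              (hga.continuousAt.eventually ((A.isOpen_dom c).mem_nhds hdom)))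
          have hmap := A.map_coord c w hwZ hdom
          have h1 : ContMDiffAt 𝓘(ℝ, ι → ℝ) 𝓘(ℝ, ι → ℝ) ω (A.chart hW c 0).symm
              (A.coord c (w, A.graph w)) :=
            contMDiffAt_symm_of_mem_maximalAtlas (hatlas c 0) (by
              rw [chart_target, Set.mem_ofPred_eq, zero_add, hmap]; exact hw)
          have h2 : ContMDiffAt 𝓘(ℝ, ι → ℝ) 𝓘(ℝ, ι → ℝ) ω
              ((A.chart hW c 0).symm ∘ fun w => A.coord c (w, A.graph w)) w :=
            ContMDiffAt.comp w h1 hca.contMDiffAt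
          refine h2.congr_of_eventuallyEq ?_
          filter_upwards [hev] with w' hw'
          refine Subtype.ext ?_
          have h3 := A.map_coord c w' hw'.2.1 hw'.2.2
          rw [hsv w' hw'.1 hw'.2.1, Function.comp, A.chart_symm_val hW c 0 (by
            rw [zero_add, h3]; exact hw'.1), zero_add,
            A.param_eq_graph (by rw [h3]; exact hw'.2.1), h3]
        · intro w hw hFw
          have hwZ : w ∉ Z := fun h => hFw ((hFZ w hw).2 h)
          simp only [hsv w hw hwZ]
        · rintro ⟨x, ⟨c, u, rfl⟩, hx⟩ hFx
          have hwZ : A.map c u ∉ Z := fun h => hFx ((hFZ _ hx).2 h)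
          refine Subtype.ext ?_
          exact (hsv _ hx hwZ).trans (A.param_eq_graph hwZ).symm
      k := fun x => k (sel x) (A.coord (sel x) x.1)
      h := fun x => h (sel x) (A.coord (sel x) x.1)
      crossing := by
        intro x hx
        have hmap := x.map_coord (hsel x)
        refine ⟨A.chart hW (sel x) (A.coord (sel x) x.1), hatlas _ _, hsel x, ?_, ?_⟩
        · rw [chart_apply, sub_self]
        · refine (hcr (sel x) (A.coord (sel x) x.1) (by rw [hmap]; exact x.2.2)
            (by rw [hmap]; exact (hFZ _ x.2.2).1 hx)).congr ?_
          have : Continuous fun u => A.map (sel x) (A.coord (sel x) x.1 + u) :=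
            (A.contDiff_map _).continuous.comp (continuous_const.add continuous_id)
          have h1 : ∀ᶠ u in 𝓝 (0 : ι → ℝ), A.map (sel x) (A.coord (sel x) x.1 + u) ∈ W :=
            (hW.preimage this).mem_nhds (by
              have h2 : A.map (sel x) (A.coord (sel x) x.1 + 0) ∈ W := by
                rw [add_zero, hmap]; exact x.2.2
              exact h2)
          filter_upwards [h1] with u hu
          rw [Function.comp, A.chart_symm_val hW _ _ hu]
          rfl }
  have hsel₀ : sel x₀ = c₀ := by simp [hseldef]
  have hco : A.coord (sel x₀) x₀.1 = Q₀ := by rw [hsel₀]; exact A.coord_apply c₀ Q₀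
  refine ⟨R, fun x => ⟨sel x, A.coord (sel x) x.1, rfl, rfl⟩, x₀, h₀, ?_, ?_⟩
  · change k (sel x₀) (A.coord (sel x₀) x₀.1) = _
    rw [hco, hsel₀]
  · change h (sel x₀) (A.coord (sel x₀) x₀.1) = _
    rw [hco, hsel₀]

end BlowupAtlas

/-! ### The toric modification -/

section Projective

variable {ι : Type*} [Fintype ι]

/-- The orthogonal projection matrix onto the line spanned by `a`, an affine embedding of the
projective space. -/
def projMatrix (a : ι → ℝ) : ι → ι → ℝ := fun x y => a x * a y / ∑ z, a z ^ 2

theorem sum_sq_ne_zero {a : ι → ℝ} {x : ι} (h : a x ≠ 0) : ∑ z, a z ^ 2 ≠ 0 := by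
  have h1 : a x ^ 2 ≤ ∑ z, a z ^ 2 :=
    Finset.single_le_sum (f := fun z => a z ^ 2) (fun z _ => sq_nonneg _) (Finset.mem_univ x)
  have h2 : 0 < a x ^ 2 := by positivity
  exact (h2.trans_le h1).ne'

theorem projMatrix_smul {c : ℝ} (hc : c ≠ 0) (a : ι → ℝ) : projMatrix (c • a) = projMatrix a := by
  funext x y
  simp only [projMatrix, Pi.smul_apply, smul_eq_mul, mul_pow, ← Finset.mul_sum]
  rw [show c * a x * (c * a y) = c ^ 2 * (a x * a y) by ring, mul_div_mul_left _ _ (by positivity)]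

theorem projMatrix_diag_ne_zero {a : ι → ℝ} {y : ι} : projMatrix a y y ≠ 0 ↔ a y ≠ 0 := by
  refine ⟨fun h h0 => h (by simp [projMatrix, h0]), fun h => ?_⟩
  exact div_ne_zero (mul_ne_zero h h) (sum_sq_ne_zero h)

theorem projMatrix_div {a : ι → ℝ} {x y : ι} (h : a y ≠ 0) :
    projMatrix a x y / projMatrix a y y = a x / a y := by
  have := sum_sq_ne_zero h
  simp only [projMatrix]
  field_simp

theorem contDiffAt_projMatrix {E : Type*} [NormedAddCommGroup E] [NormedSpace ℝ E] {f : E → ι → ℝ}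
    {e : E} (hf : ContDiffAt ℝ ω f e) {x : ι} (hx : f e x ≠ 0) :
    ContDiffAt ℝ ω (fun e => projMatrix (f e)) e := by
  have h1 : ∀ x, ContDiffAt ℝ ω (fun e => f e x) e := contDiffAt_pi.1 hf
  refine contDiffAt_pi.2 fun x => contDiffAt_pi.2 fun y => ?_
  refine ((h1 x).mul (h1 y)).div (ContDiffAt.sum fun z _ => (h1 z).pow 2) (sum_sq_ne_zero hx)

end Projective

variable {d₁ d₂ r m : ℕ}

/-! ### Generators of the blown-up ideals and their strict transforms. -/

/-- The generators `θ_1, …, θ_r, θ_{r+1} ^ n, …, θ_{d₁} ^ n`. -/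
def powerTail (r n : ℕ) (w : Param d₁ d₂) : Fin d₁ → ℝ :=
  fun l => if (l : ℕ) < r then w (Sum.inl l) else w (Sum.inl l) ^ n

/-- The strict transforms of the generators in the chart with multiplicities `ν`. -/
def strictGen (r : ℕ) (ν : Fin d₁ → ℕ) (n : ℕ) (u : Param d₁ d₂) : Fin d₁ → ℝ :=
  fun l => if (l : ℕ) < r then mono (fun k => ν k - n) u * strict ν u l
    else mono (fun k => if ν k = 0 then 0 else n - ν k) u * strict ν u l ^ n

/-- In a chart the generators share a monomial factor, which is irrelevant in projective space where
it does not vanish; the strict transforms then extend the projective point across the exceptional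
set. -/
theorem powerTail_toricMap (ν : Fin d₁ → ℕ) (n : ℕ) (u : Param d₁ d₂) :
    powerTail r n (toricMap r ν u) = mono (fun k => min (ν k) n) u • strictGen r ν n u := by
  funext l
  by_cases hl : (l : ℕ) < r
  · have h : ν = (fun k => min (ν k) n) + fun k => ν k - n := by
      funext k; simp only [Pi.add_apply]; omega
    have h' := congrArg (fun e => mono e u) h
    simp only [mono_add] at h'
    simp only [powerTail, toricMap, weighted, Sum.elim_inl, hl, if_true, Pi.smul_apply, smul_eq_mul,
      strictGen]
    rw [← mul_assoc, ← h']
  · have h : n • red ν = (fun k => min (ν k) n) + fun k => if ν k = 0 then 0 else n - ν k := by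
      funext k
      simp only [Pi.add_apply, Pi.smul_apply, smul_eq_mul, red]
      split_ifs with hk
      · simp [hk]
      · rw [min_eq_right (by omega : 1 ≤ ν k)]; omega
    have h' := congrArg (fun e => mono e u) h
    simp only [mono_add, mono_smul] at h'
    simp only [powerTail, toricMap, weighted, Sum.elim_inl, hl, if_false, Pi.smul_apply, smul_eq_mul,
      strictGen]
    rw [mul_pow, ← mul_assoc, ← h']

theorem contDiff_strictGen (r : ℕ) (ν : Fin d₁ → ℕ) (n : ℕ) :
    ContDiff ℝ ω (strictGen r ν n : Param d₁ d₂ → _) := by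
  rw [contDiff_pi]
  intro l
  have h1 := contDiff_mono (d₂ := d₂) (fun k => ν k - n)
  have h2 := contDiff_mono (d₂ := d₂) (fun k => if ν k = 0 then 0 else n - ν k)
  by_cases hl : (l : ℕ) < r <;> by_cases hν : ν l = 0 <;>
    simp only [strictGen, hl, strict, hν, if_true, if_false] <;> fun_prop

theorem contDiff_powerTail (r n : ℕ) : ContDiff ℝ ω (powerTail r n : Param d₁ d₂ → _) := by
  rw [contDiff_pi]
  intro l
  by_cases hl : (l : ℕ) < r <;> simp only [powerTail, hl, if_true, if_false] <;> fun_prop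

theorem strictGen_head {ν : Fin d₁ → ℕ} {n : ℕ} {l : Fin d₁} (hl : (l : ℕ) < r) (h : ∀ k, ν k ≤ n)
    (u : Param d₁ d₂) : strictGen r ν n u l = strict ν u l := by
  have : (fun k => ν k - n) = 0 := funext fun k => Nat.sub_eq_zero_of_le (h k)
  simp [strictGen, hl, this, mono_zero]

theorem strictGen_tail {ν : Fin d₁ → ℕ} {n : ℕ} {l : Fin d₁} (hl : r ≤ (l : ℕ))
    (h : ∀ k, ν k ≠ 0 → n ≤ ν k) (u : Param d₁ d₂) : strictGen r ν n u l = strict ν u l ^ n := by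
  have : (fun k => if ν k = 0 then 0 else n - ν k) = 0 := by
    funext k
    by_cases hk : ν k = 0
    · simp [hk]
    · simp [hk, h k hk]
  simp [strictGen, not_lt.2 hl, this, mono_zero]

theorem powerTail_ne_zero (r : ℕ) {n : ℕ} {w : Param d₁ d₂} {l : Fin d₁} (h : w (Sum.inl l) ≠ 0) :
    powerTail r n w l ≠ 0 := by
  by_cases hl : (l : ℕ) < r <;> simp [powerTail, hl, h]

/-! ### The covering charts and their coordinates as ratios of generators. -/

/-- The charts that cover the modification: the charts in which the last exceptional surface is
`{θ_i = 0}`, `i > r`, after `m` blow-ups, or `{θ_j = 0}`, `j ≤ r`, after the first or a later blow-up. -/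
inductive ToricIndex (d₁ r m : ℕ) : Type
  | tail (i : Fin d₁) (hi : r ≤ (i : ℕ)) : ToricIndex d₁ r m
  | head (j : Fin d₁) (hj : (j : ℕ) < r) : ToricIndex d₁ r m
  | pair (i j : Fin d₁) (hi : r ≤ (i : ℕ)) (hj : (j : ℕ) < r) (n : ℕ) (hn : n + 2 ≤ m) :
      ToricIndex d₁ r m

namespace ToricIndex

instance : Finite (ToricIndex d₁ r m) := by
  let f : ToricIndex d₁ r m → Fin d₁ ⊕ Fin d₁ ⊕ (Fin d₁ × Fin d₁ × Fin m)
    | tail i _ => Sum.inl i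
    | head j _ => Sum.inr (Sum.inl j)
    | pair i j _ _ n hn => Sum.inr (Sum.inr (i, j, ⟨n, by omega⟩))
  refine Finite.of_injective f ?_
  rintro (_ | _ | _) (_ | _ | _) h <;> simp_all [f]

/-- The final chart. -/
def toFinal (hm : 1 ≤ m) : ToricIndex d₁ r m → FinalChart d₁ r m
  | tail _ hi => .ofTail hm hi
  | head _ hj => .ofHead hm hj
  | pair _ _ hi hj _ hn => .ofPair hi hj hn

/-- The multiplicities of the chart. -/
def mult : ToricIndex d₁ r m → Fin d₁ → ℕ
  | tail i _ => Pi.single i m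
  | head j _ => Pi.single j 1
  | pair i j _ _ n _ => Pi.single i (n + 1) + Pi.single j (n + 2)

theorem mult_toFinal (hm : 1 ≤ m) (c : ToricIndex d₁ r m) : (c.toFinal hm).chart.mult = c.mult := by
  rcases c with ⟨i, hi⟩ | ⟨j, hj⟩ | ⟨i, j, hi, hj, n, hn⟩
  · have h1 := (toFinal hm (tail i hi)).chart.mult_tail hi
    rw [h1, FinalChart.halted _ hi]; rfl
  · rfl
  · have hji : j ≠ i := fun h => by subst h; omega
    simp only [toFinal, FinalChart.ofPair, BlowupChart.mult, hji, if_false, mult]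

/-- The coordinate relative to which a coordinate function is a ratio of generators. It is the
coordinate itself if this is the restriction of a coordinate function of the base. -/
def pivot : ToricIndex d₁ r m → Fin d₁ → Fin d₁
  | tail i _, _ => i
  | head j _, _ => j
  | pair i j _ _ _ _, x => if (x : ℕ) < r then (if x = j then i else j) else (if x = i then j else i)

/-- The generators of which a coordinate function is a ratio. -/
def level : ToricIndex d₁ r m → Fin d₁ → ℕ
  | tail _ _, x => if (x : ℕ) < r then m else 1
  | head _ _, _ => 1
  | pair i j _ _ n _, x =>
      if (x : ℕ) < r then (if x = j then n + 1 else n + 2) else (if x = i then n + 2 else 1)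

theorem level_pos (hm : 1 ≤ m) (c : ToricIndex d₁ r m) (x : Fin d₁) : 1 ≤ c.level x := by
  rcases c with ⟨i, hi⟩ | ⟨j, hj⟩ | ⟨i, j, hi, hj, n, hn⟩ <;> simp only [level] <;>
    (try split_ifs) <;> omega

theorem level_le (hm : 1 ≤ m) (c : ToricIndex d₁ r m) (x : Fin d₁) : c.level x ≤ m := by
  rcases c with ⟨i, hi⟩ | ⟨j, hj⟩ | ⟨i, j, hi, hj, n, hn⟩ <;> simp only [level] <;>
    (try split_ifs) <;> omega

/-- The pulled-back generators are divisible by one of them. In a chart of type `pair` with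
parameter `s` it is the `i`-th up to the power `s + 1` and the `j`-th from `s + 2` on. -/
theorem exists_strictGen_eq_one (c : ToricIndex d₁ r m) {n : ℕ} (h1 : 1 ≤ n) (hn : n ≤ m)
    (u : Param d₁ d₂) : ∃ x, strictGen r c.mult n u x = 1 := by
  rcases c with ⟨i, hi⟩ | ⟨j, hj⟩ | ⟨i, j, hi, hj, s, hs⟩
  · refine ⟨i, ?_⟩
    rw [strictGen_tail hi]
    · simp [mult, strict, show m ≠ 0 by omega]
    · intro k
      by_cases hk : k = i
      · subst hk; simp [mult, hn]
      · simp [mult, hk]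
  · refine ⟨j, ?_⟩
    rw [strictGen_head hj]
    · simp [mult, strict]
    · intro k
      by_cases hk : k = j
      · subst hk; simp [mult, h1]
      · simp [mult, hk]
  · have hij : i ≠ j := fun h => by subst h; omega
    by_cases hns : n ≤ s + 1
    · refine ⟨i, ?_⟩
      rw [strictGen_tail hi]
      · simp [mult, strict]
      · intro k
        by_cases hk : k = i
        · subst hk; simp [mult, hij, hns]
        · by_cases hk' : k = j
          · subst hk'; simp [mult, hk]; omega
          · simp [mult, hk, hk']
    · refine ⟨j, ?_⟩
      rw [strictGen_head hj]
      · simp [mult, strict]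
      · intro k
        by_cases hk : k = i
        · subst hk; simp [mult, hij]; omega
        · by_cases hk' : k = j
          · subst hk'; simp [mult, hk]; omega
          · simp [mult, hk, hk']

/-- Together with `strictGen_level`, this recovers each chart coordinate from the embedding: either
it is a coordinate of the base, or it is the ratio of the generators `x` and `pivot x` of the given
level. -/
theorem strictGen_pivot (hm : 1 ≤ m) (c : ToricIndex d₁ r m) (x : Fin d₁) (u : Param d₁ d₂) :
    strictGen r c.mult (c.level x) u (c.pivot x) = 1 := by
  rcases c with ⟨i, hi⟩ | ⟨j, hj⟩ | ⟨i, j, hi, hj, s, hs⟩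
  · simp only [pivot]
    rw [strictGen_tail hi]
    · simp [mult, strict, show m ≠ 0 by omega]
    · intro k
      by_cases hk : k = i
      · subst hk; simpa [mult] using fun _ => level_le hm (tail k hi) x
      · simp [mult, hk]
  · simp only [pivot, level]
    rw [strictGen_head hj]
    · simp [mult, strict]
    · intro k
      by_cases hk : k = j
      · subst hk; simp [mult]
      · simp [mult, hk]
  · have hij : i ≠ j := fun h => by subst h; omega
    have hti : ∀ n, n ≤ s + 1 → strictGen r (pair i j hi hj s hs).mult n u i = 1 := by
      intro n hns
      rw [strictGen_tail hi]
      · simp [mult, strict]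
      · intro k
        by_cases hk : k = i
        · subst hk; simp [mult, hij, hns]
        · by_cases hk' : k = j
          · subst hk'; simp [mult, hk]; omega
          · simp [mult, hk, hk']
    have hhj : strictGen r (pair i j hi hj s hs).mult (s + 2) u j = 1 := by
      rw [strictGen_head hj]
      · simp [mult, strict]
      · intro k
        by_cases hk : k = i
        · subst hk; simp [mult, hij]
        · by_cases hk' : k = j
          · subst hk'; simp [mult, hk]
          · simp [mult, hk, hk']
    simp only [pivot, level]
    split_ifs
    · exact hti _ le_rfl
    · exact hhj
    · exact hhj
    · exact hti _ (by omega)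

theorem strictGen_level (hm : 1 ≤ m) (c : ToricIndex d₁ r m) {x : Fin d₁} (hx : c.pivot x ≠ x)
    (u : Param d₁ d₂) : strictGen r c.mult (c.level x) u x = u (Sum.inl x) := by
  rcases c with ⟨i, hi⟩ | ⟨j, hj⟩ | ⟨i, j, hi, hj, s, hs⟩
  · have hxi : x ≠ i := fun h => hx h.symm
    by_cases hxr : (x : ℕ) < r
    · rw [strictGen_head hxr]
      · simp [mult, strict, hxi]
      · intro k
        by_cases hk : k = i
        · subst hk; simp [mult, level, hxr]
        · simp [mult, hk]
    · rw [strictGen_tail (not_lt.1 hxr)]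
      · simp [mult, strict, hxi, level, hxr]
      · intro k
        by_cases hk : k = i
        · subst hk; simp [mult, level, hxr, hm]
        · simp [mult, hk]
  · have hxj : x ≠ j := fun h => hx h.symm
    by_cases hxr : (x : ℕ) < r
    · rw [strictGen_head hxr]
      · simp [mult, strict, hxj]
      · intro k
        by_cases hk : k = j
        · subst hk; simp [mult, level]
        · simp [mult, hk]
    · rw [strictGen_tail (not_lt.1 hxr)]
      · simp [mult, strict, hxj, level]
      · intro k
        by_cases hk : k = j
        · subst hk; simp [mult, level]
        · simp [mult, hk]
  · have hij : i ≠ j := fun h => by subst h; omega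
    by_cases hxr : (x : ℕ) < r
    · have hxi : x ≠ i := fun h => by subst h; omega
      by_cases hxj : x = j
      · subst hxj
        have : (fun k => (pair i x hi hj s hs).mult k - (s + 1)) = Pi.single x 1 := by
          funext k
          by_cases hk : k = i
          · subst hk; simp [mult, hij]
          · by_cases hk' : k = x
            · subst hk'; simp [mult, hk]
            · simp [mult, hk, hk']
        simp only [strictGen, level, hxr, if_true, this, mono_single]
        simp [mult, strict]
      · rw [strictGen_head hxr]
        · simp [mult, strict, hxj, hxi]
        · intro k
          by_cases hk : k = i
          · subst hk; simp [mult, hij, level, hxr, hxj]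
          · by_cases hk' : k = j
            · subst hk'; simp [mult, hk, level, hxr, hxj]
            · simp [mult, hk, hk']
    · have hxj : x ≠ j := fun h => by subst h; omega
      by_cases hxi : x = i
      · subst hxi
        have : (fun k => if (pair x j hi hj s hs).mult k = 0 then 0 else
            s + 2 - (pair x j hi hj s hs).mult k) = Pi.single x 1 := by
          funext k
          by_cases hk : k = x
          · subst hk; simp [mult, hij]
          · by_cases hk' : k = j
            · subst hk'; simp [mult, hk]
            · simp [mult, hk, hk']
        simp only [strictGen, level, hxr, if_true, if_false, this, mono_single]
        simp [mult, strict]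
      · rw [strictGen_tail (not_lt.1 hxr)]
        · simp [mult, strict, hxj, hxi, level, hxr]
        · intro k
          by_cases hk : k = i
          · subst hk; simp [mult, hij, level, hxr, hxi]
          · by_cases hk' : k = j
            · subst hk'; simp [mult, hk, level, hxr, hxi]
            · simp [mult, hk, hk']

/-- The inverse of the toric map off the centre. -/
def ratios (c : ToricIndex d₁ r m) (w : Param d₁ d₂) : Param d₁ d₂ :=
  Sum.elim (fun x => if c.pivot x = x then w (Sum.inl x) else
    powerTail r (c.level x) w x / powerTail r (c.level x) w (c.pivot x)) fun j => w (Sum.inr j)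

theorem toricMap_ratios (hm : 1 ≤ m) (c : ToricIndex d₁ r m) {w : Param d₁ d₂}
    (h : ∀ x, powerTail r (c.level x) w (c.pivot x) ≠ 0) : toricMap r c.mult (c.ratios w) = w := by
  rcases c with ⟨i, hi⟩ | ⟨j, hj⟩ | ⟨i, j, hi, hj, s, hs⟩
  · have hir : ¬ (i : ℕ) < r := not_lt.2 hi
    have hθ : w (Sum.inl i) ≠ 0 := by
      have := h i
      simp only [pivot, level, powerTail, hir, if_false, pow_one] at this
      exact this
    have hui : (tail i hi : ToricIndex d₁ r m).ratios w (Sum.inl i) = w (Sum.inl i) := by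
      simp [ratios, pivot]
    funext k
    rcases k with l | l
    · simp only [toricMap, weighted, Sum.elim_inl, mult, mono_single, red_single i hm, hui, strict]
      by_cases hl : l = i
      · subst hl
        simp [hir, show m ≠ 0 by omega]
      · by_cases hlr : (l : ℕ) < r
        · simp [hlr, hl, ratios, pivot, Ne.symm hl, level, powerTail, hir]
          field_simp
        · simp [hlr, hl, ratios, pivot, Ne.symm hl, level, powerTail, hir]
          field_simp
    · simp [toricMap, weighted, ratios]
  · have hθ : w (Sum.inl j) ≠ 0 := by
      have := h j
      simp only [pivot, level, powerTail, hj, if_true] at this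
      exact this
    have huj : (head j hj : ToricIndex d₁ r m).ratios w (Sum.inl j) = w (Sum.inl j) := by
      simp [ratios, pivot]
    funext k
    rcases k with l | l
    · simp only [toricMap, weighted, Sum.elim_inl, mult, mono_single, red_single j le_rfl, huj, strict]
      by_cases hl : l = j
      · subst hl
        simp
      · simp [hl, ratios, pivot, Ne.symm hl, level, powerTail, hj]
        field_simp
    · simp [toricMap, weighted, ratios]
  · have hij : i ≠ j := fun h => by subst h; omega
    have hir : ¬ (i : ℕ) < r := not_lt.2 hi
    have hi0 : w (Sum.inl i) ≠ 0 := by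
      have := h j
      simp only [pivot, level, powerTail, hj, hir, if_true, if_false] at this
      exact fun h0 => this (by simp [h0])
    have hj0 : w (Sum.inl j) ≠ 0 := by
      have := h i
      simp only [pivot, level, powerTail, hj, hir, if_true, if_false] at this
      exact this
    have hui : (pair i j hi hj s hs).ratios w (Sum.inl i) =
        w (Sum.inl i) ^ (s + 2) / w (Sum.inl j) := by
      simp [ratios, pivot, hir, hij.symm, level, powerTail, hj]
    have huj : (pair i j hi hj s hs).ratios w (Sum.inl j) =
        w (Sum.inl j) / w (Sum.inl i) ^ (s + 1) := by
      simp [ratios, pivot, hir, hij, level, powerTail, hj]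
    -- The exponents of `θ_j = u_i ^ (s + 1) u_j ^ (s + 2)` and `θ_i = u_i u_j` form a unimodular
    -- matrix, so `u_i` and `u_j` are the Laurent monomials found above.
    have hm1 : mono (pair i j hi hj s hs).mult ((pair i j hi hj s hs).ratios w) = w (Sum.inl j) := by
      rw [mult, mono_add, mono_single, mono_single, hui, huj, div_pow, div_pow, ← pow_mul, ← pow_mul,
        mul_comm (s + 2) (s + 1)]
      field_simp
      ring
    have hm2 : mono (red (pair i j hi hj s hs).mult) ((pair i j hi hj s hs).ratios w) =
        w (Sum.inl i) := by
      rw [mult, red_pair hij (by omega) (by omega), mono_add, mono_single, mono_single, hui, huj]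
      field_simp
      ring
    funext k
    rcases k with l | l
    · simp only [toricMap, weighted, Sum.elim_inl, hm1, hm2, strict]
      by_cases hli : l = i
      · subst hli
        simp [hir, mult]
      · by_cases hlj : l = j
        · subst hlj
          simp [hj, mult]
        · by_cases hlr : (l : ℕ) < r
          · simp [hlr, hli, hlj, mult, ratios, pivot, Ne.symm hlj, level, powerTail, hj]
            field_simp
          · simp [hlr, hli, hlj, mult, ratios, pivot, Ne.symm hli, level, powerTail, hir]
            field_simp
    · simp [toricMap, weighted, ratios]

/-- Let `θ_i` and `θ_j` be largest in absolute value among the last `d₁ - r` and the first `r`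
coordinates. If `|θ_j| ≤ |θ_i| ^ m`, a chart of type `tail` works; if `|θ_i| ≤ |θ_j|`, one of type
`head`; otherwise `|θ_i| ^ (s + 2) ≤ |θ_j| < |θ_i| ^ (s + 1)` for some `s` with `s + 2 ≤ m`, and the
chart of type `pair` with this `s` works. If one of the two groups is empty, the other decides. -/
theorem exists_ratios (hm : 1 ≤ m) {w : Param d₁ d₂} (hw : w ∉ centre d₁ d₂) :
    ∃ c : ToricIndex d₁ r m, ∀ x, powerTail r (c.level x) w (c.pivot x) ≠ 0 ∧
      (c.pivot x ≠ x →
        |powerTail r (c.level x) w x| ≤ |powerTail r (c.level x) w (c.pivot x)|) := by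
  set θ : Fin d₁ → ℝ := fun l => w (Sum.inl l) with hθ
  have hw' : ∃ l, θ l ≠ 0 := by
    by_contra hcon
    push Not at hcon
    exact hw hcon
  have case_tail : ∀ i : Fin d₁, r ≤ (i : ℕ) → θ i ≠ 0 → (∀ k : Fin d₁, r ≤ (k : ℕ) → |θ k| ≤ |θ i|) →
      (∀ l : Fin d₁, (l : ℕ) < r → |θ l| ≤ |θ i| ^ m) → ∃ c : ToricIndex d₁ r m, ∀ x,
      powerTail r (c.level x) w (c.pivot x) ≠ 0 ∧ (c.pivot x ≠ x →
        |powerTail r (c.level x) w x| ≤ |powerTail r (c.level x) w (c.pivot x)|) := by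
    intro i hi h0 hk hl
    refine ⟨tail i hi, fun x => ⟨powerTail_ne_zero r h0, fun _ => ?_⟩⟩
    by_cases hx : (x : ℕ) < r
    · simpa [level, pivot, hx, powerTail, not_lt.2 hi] using hl x hx
    · simpa [level, pivot, hx, powerTail, not_lt.2 hi] using hk x (not_lt.1 hx)
  have case_head : ∀ j : Fin d₁, (j : ℕ) < r → θ j ≠ 0 → (∀ x, |θ x| ≤ |θ j|) →
      ∃ c : ToricIndex d₁ r m, ∀ x, powerTail r (c.level x) w (c.pivot x) ≠ 0 ∧ (c.pivot x ≠ x →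
        |powerTail r (c.level x) w x| ≤ |powerTail r (c.level x) w (c.pivot x)|) := by
    intro j hj h0 hx
    refine ⟨head j hj, fun x => ⟨powerTail_ne_zero r h0, fun _ => ?_⟩⟩
    by_cases hxr : (x : ℕ) < r <;> simpa [level, pivot, hxr, powerTail, hj] using hx x
  have hmax : ∀ q : Fin d₁ → Prop, (∃ l, q l) → ∃ i, q i ∧ ∀ l, q l → |θ l| ≤ |θ i| := by
    classical
    rintro q ⟨l, hl⟩
    obtain ⟨i, hi, h⟩ := (Finset.univ.filter q).exists_max_image (fun l => |θ l|)
      ⟨l, by simpa using hl⟩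
    exact ⟨i, by simpa using hi, fun l hl => h l (by simpa using hl)⟩
  by_cases hT : ∃ i : Fin d₁, r ≤ (i : ℕ)
  swap
  · push Not at hT
    obtain ⟨l, hl⟩ := hw'
    obtain ⟨j, hj, hjm⟩ := hmax (fun l => (l : ℕ) < r) ⟨l, hT l⟩
    refine case_head j hj (fun h0 => hl ?_) fun x => hjm x (hT x)
    have := hjm l (hT l)
    rw [h0, abs_zero] at this
    exact abs_nonpos_iff.1 this
  obtain ⟨i, hi, him⟩ := hmax _ hT
  by_cases hH : ∃ j : Fin d₁, (j : ℕ) < r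
  swap
  · push Not at hH
    obtain ⟨l, hl⟩ := hw'
    refine case_tail i hi (fun h0 => hl ?_) him fun l hl => absurd (hH l) (not_le.2 hl)
    have := him l (hH l)
    rw [h0, abs_zero] at this
    exact abs_nonpos_iff.1 this
  obtain ⟨j, hj, hjm⟩ := hmax _ hH
  have hle : ∀ l, θ l ≠ 0 → 0 < |θ i| ∨ 0 < |θ j| := by
    intro l hl
    by_cases hlr : (l : ℕ) < r
    · exact Or.inr ((abs_pos.2 hl).trans_le (hjm l hlr))
    · exact Or.inl ((abs_pos.2 hl).trans_le (him l (not_lt.1 hlr)))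
  obtain ⟨l₀, hl₀⟩ := hw'
  have hpos := hle l₀ hl₀
  by_cases h1 : |θ j| ≤ |θ i| ^ m
  · have hi0 : θ i ≠ 0 := by
      intro h0
      rw [h0, abs_zero, zero_pow (by omega)] at h1
      rcases hpos with h | h
      · rw [h0, abs_zero] at h; exact lt_irrefl _ h
      · exact absurd h (not_lt.2 h1)
    exact case_tail i hi hi0 him fun l hl => (hjm l hl).trans h1
  by_cases h2 : |θ i| ≤ |θ j|
  · have hj0 : θ j ≠ 0 := by
      intro h0
      rw [h0, abs_zero] at h2 hpos
      rcases hpos with h | h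
      · exact absurd h (not_lt.2 h2)
      · exact lt_irrefl _ h
    refine case_head j hj hj0 fun x => ?_
    by_cases hx : (x : ℕ) < r
    · exact hjm x hx
    · exact (him x (not_lt.1 hx)).trans h2
  push Not at h1 h2
  have hj0 : 0 < |θ j| := (pow_nonneg (abs_nonneg _) m).trans_lt h1
  have hi0 : 0 < |θ i| := hj0.trans h2
  classical
  have hex : ∃ n, |θ i| ^ (n + 1) ≤ |θ j| := ⟨m - 1, by rw [Nat.sub_add_cancel hm]; exact h1.le⟩
  have hsp := Nat.find_spec hex
  have hmin : ∀ n, n < Nat.find hex → |θ j| < |θ i| ^ (n + 1) := fun n hn =>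
    not_le.1 (Nat.find_min hex hn)
  have hfm : Nat.find hex ≤ m - 1 := Nat.find_min' hex (by rw [Nat.sub_add_cancel hm]; exact h1.le)
  obtain ⟨s, hs⟩ : ∃ s, Nat.find hex = s + 1 := by
    refine Nat.exists_eq_succ_of_ne_zero fun h0 => ?_
    rw [h0] at hsp
    simp only [zero_add, pow_one] at hsp
    exact absurd h2 (not_lt.2 hsp)
  rw [hs] at hsp
  have hsm := hmin s (by omega)
  have hij : i ≠ j := fun h => by subst h; omega
  have hir : ¬ (i : ℕ) < r := not_lt.2 hi
  have hi0' : θ i ≠ 0 := abs_pos.1 hi0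
  have hj0' : θ j ≠ 0 := abs_pos.1 hj0
  refine ⟨pair i j hi hj s (by omega), fun x => ?_⟩
  by_cases hxr : (x : ℕ) < r
  · by_cases hxj : x = j
    · subst hxj
      refine ⟨by simpa [pivot, level, hxr] using powerTail_ne_zero r hi0', fun _ => ?_⟩
      simpa [pivot, level, powerTail, hxr, hir] using hsm.le
    · refine ⟨by simpa [pivot, level, hxr, hxj] using powerTail_ne_zero r hj0', fun _ => ?_⟩
      simpa [pivot, level, powerTail, hxr, hj, hxj] using hjm x hxr
  · by_cases hxi : x = i
    · subst hxi
      refine ⟨by simpa [pivot, level, hxr] using powerTail_ne_zero r hj0', fun _ => ?_⟩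
      simpa [pivot, level, powerTail, hxr, hj] using hsp
    · refine ⟨by simpa [pivot, level, hxr, hxi] using powerTail_ne_zero r hi0', fun _ => ?_⟩
      simpa [pivot, level, powerTail, hxr, hxi, hir] using him x (not_lt.1 hxr)

end ToricIndex

/-! ### The toric atlas and the threshold at the origin. -/

theorem isClosed_centre : IsClosed (centre d₁ d₂) := by
  rw [centre, Set.ofPred_forall]
  exact isClosed_iInter fun j => isClosed_eq (continuous_apply _) continuous_const

theorem toricMap_mem_centre (hm : 1 ≤ m) (c : ToricIndex d₁ r m) (u : Param d₁ d₂) :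
    toricMap r c.mult u ∈ centre d₁ d₂ ↔ ∃ l, u (Sum.inl l) = 0 ∧ c.mult l ≠ 0 := by
  have := mem_excSet (c := c.toFinal hm) (Q := u)
  rwa [excSet, Set.mem_preimage, FinalChart.map_eq, c.mult_toFinal hm] at this

namespace ToricIndex

/-- The level of a coordinate, counted from `0`. -/
def levelFin (hm : 1 ≤ m) (c : ToricIndex d₁ r m) (x : Fin d₁) : Fin m :=
  ⟨c.level x - 1, by have := c.level_pos hm x; have := c.level_le hm x; omega⟩

theorem levelFin_add_one (hm : 1 ≤ m) (c : ToricIndex d₁ r m) (x : Fin d₁) :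
    (c.levelFin hm x : ℕ) + 1 = c.level x := Nat.sub_add_cancel (c.level_pos hm x)

/-- The coordinates of a chart in terms of the embedding into the product of projective spaces. -/
def embCoord (hm : 1 ≤ m) (c : ToricIndex d₁ r m)
    (y : Param d₁ d₂ × (Fin m → Fin d₁ → Fin d₁ → ℝ)) : Param d₁ d₂ :=
  Sum.elim (fun x => if c.pivot x = x then y.1 (Sum.inl x) else
    y.2 (c.levelFin hm x) x (c.pivot x) / y.2 (c.levelFin hm x) (c.pivot x) (c.pivot x))
    fun j => y.1 (Sum.inr j)

theorem embCoord_graph (hm : 1 ≤ m) (c : ToricIndex d₁ r m) {w : Param d₁ d₂}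
    (h : ∀ x, powerTail r (c.level x) w (c.pivot x) ≠ 0) :
    c.embCoord hm (w, fun n => projMatrix (powerTail r (n + 1) w)) = c.ratios w := by
  funext k
  rcases k with x | x
  · by_cases hx : c.pivot x = x
    · simp [embCoord, ratios, hx]
    · simp only [embCoord, ratios, Sum.elim_inl, hx, if_false, levelFin_add_one]
      exact projMatrix_div (h x)
  · rfl

theorem toricMap_pivot (hm : 1 ≤ m) (c : ToricIndex d₁ r m) {x : Fin d₁} (hx : c.pivot x = x)
    (u : Param d₁ d₂) : toricMap r c.mult u (Sum.inl x) = u (Sum.inl x) := by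
  rcases c with ⟨i, hi⟩ | ⟨j, hj⟩ | ⟨i, j, hi, hj, n, hn⟩
  · obtain rfl : i = x := hx
    simp [toricMap, weighted, not_lt.2 hi, mult, red_single i hm, mono_single, strict,
      show m ≠ 0 by omega]
  · obtain rfl : j = x := hx
    simp [toricMap, weighted, hj, mult, mono_single, strict]
  · have hij : i ≠ j := fun h => by subst h; omega
    simp only [pivot] at hx
    split_ifs at hx with h1 h2 h2
    · exact absurd (hx.trans h2) hij
    · exact absurd hx.symm h2
    · exact absurd (hx.trans h2).symm hij
    · exact absurd hx.symm h2

theorem norm_ratios_le (c : ToricIndex d₁ r m) {w : Param d₁ d₂}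
    (h : ∀ x, c.pivot x ≠ x →
      |powerTail r (c.level x) w x| ≤ |powerTail r (c.level x) w (c.pivot x)|) :
    ‖c.ratios w‖ ≤ max 1 ‖w‖ := by
  refine (pi_norm_le_iff_of_nonneg (zero_le_one.trans (le_max_left _ _))).2 ?_
  rintro (x | x)
  · by_cases hx : c.pivot x = x
    · simp only [ratios, Sum.elim_inl, hx, if_true]
      exact (norm_le_pi_norm w _).trans (le_max_right _ _)
    · simp only [ratios, Sum.elim_inl, hx, if_false, Real.norm_eq_abs, abs_div]
      exact (div_le_one_of_le₀ (h x hx) (abs_nonneg _)).trans (le_max_left _ _)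
  · exact (norm_le_pi_norm w _).trans (le_max_right _ _)

end ToricIndex

/-- The composite of the blow-ups as a modification of the parameter space. -/
def toricAtlas (d₁ d₂ r : ℕ) {m : ℕ} (hm : 1 ≤ m) : BlowupAtlas (Fin d₁ ⊕ Fin d₂) (ToricIndex d₁ r m)
    (Fin m → Fin d₁ → Fin d₁ → ℝ) (centre d₁ d₂) where
  map c := toricMap r c.mult
  ext c u := fun n => projMatrix (strictGen r c.mult (n + 1) u)
  coord c := c.embCoord hm
  dom c := {y | ∀ x, y.2 (c.levelFin hm x) (c.pivot x) (c.pivot x) ≠ 0}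
  graph w := fun n => projMatrix (powerTail r (n + 1) w)
  isClosed_centre := isClosed_centre
  isOpen_dom c := by
    rw [Set.ofPred_forall]
    refine isOpen_iInter_of_finite fun x => isOpen_ne_fun ?_ continuous_const
    fun_prop
  contDiff_map c := contDiff_toricMap r _
  contDiff_ext c := by
    refine contDiff_pi.2 fun n => contDiff_iff_contDiffAt.2 fun u => ?_
    obtain ⟨x, hx⟩ := c.exists_strictGen_eq_one (n := n + 1) (by omega) (by omega) u
    exact contDiffAt_projMatrix (contDiff_strictGen r _ _).contDiffAt (x := x) (by simp [hx])
  contDiffOn_coord c := by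
    intro y hy
    refine ContDiffAt.contDiffWithinAt (contDiffAt_pi.2 ?_)
    have h2 : ∀ n x z, ContDiffAt ℝ ω
        (fun y : Param d₁ d₂ × (Fin m → Fin d₁ → Fin d₁ → ℝ) => y.2 n x z) y := by
      intro n x z; fun_prop
    rintro (x | x)
    · by_cases hx : c.pivot x = x
      · simp only [ToricIndex.embCoord, Sum.elim_inl, hx, if_true]
        fun_prop
      · simp only [ToricIndex.embCoord, Sum.elim_inl, hx, if_false]
        exact (h2 _ _ _).div (h2 _ _ _) (hy x)
    · simp only [ToricIndex.embCoord, Sum.elim_inr]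
      fun_prop
  contDiffAt_graph w hw := by
    obtain ⟨l, hl⟩ : ∃ l, w (Sum.inl l) ≠ 0 := by
      by_contra h
      push Not at h
      exact hw h
    exact contDiffAt_pi.2 fun n => contDiffAt_projMatrix (contDiff_powerTail r _).contDiffAt
      (powerTail_ne_zero r hl)
  mem_dom c u x := by
    refine projMatrix_diag_ne_zero.2 ?_
    rw [c.levelFin_add_one hm, c.strictGen_pivot hm]
    exact one_ne_zero
  coord_apply c u := by
    funext k
    rcases k with x | x
    · by_cases hx : c.pivot x = x
      · simp only [ToricIndex.embCoord, Sum.elim_inl, hx, if_true]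
        exact c.toricMap_pivot hm hx u
      · simp only [ToricIndex.embCoord, Sum.elim_inl, hx, if_false]
        rw [projMatrix_div, c.levelFin_add_one hm, c.strictGen_pivot hm, c.strictGen_level hm hx,
          div_one]
        rw [c.levelFin_add_one hm, c.strictGen_pivot hm]
        exact one_ne_zero
    · rfl
  dense_compl c := by
    refine Dense.mono ?_ (dense_pi Set.univ
      (fun (_ : Fin d₁ ⊕ Fin d₂) _ => dense_compl_singleton (0 : ℝ)))
    intro u hu h
    obtain ⟨l, hl, -⟩ := (toricMap_mem_centre hm c u).1 h
    exact hu (Sum.inl l) trivial hl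
  ext_eq c u hu := by
    funext n
    rw [powerTail_toricMap, projMatrix_smul]
    rw [Ne, mono_eq_zero]
    rintro ⟨l, hl, hl'⟩
    exact hu ((toricMap_mem_centre hm c u).2 ⟨l, hl, fun h => hl' (by simp [h])⟩)
  map_coord c w hw hd := by
    have h : ∀ x, powerTail r (c.level x) w (c.pivot x) ≠ 0 := fun x => by
      have := projMatrix_diag_ne_zero.1 (hd x)
      rwa [c.levelFin_add_one hm] at this
    rw [c.embCoord_graph hm h, c.toricMap_ratios hm h]
  bounded R := by
    refine ⟨max 1 R, fun w hw hwR => ?_⟩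
    obtain ⟨c, hc⟩ := ToricIndex.exists_ratios (r := r) hm hw
    exact ⟨c, c.ratios w, (c.norm_ratios_le fun x => (hc x).2).trans (max_le_max le_rfl hwR),
      c.toricMap_ratios hm fun x => (hc x).1⟩

theorem eventually_zero_iff (hm : 1 ≤ m) {K : Param d₁ d₂ → ℝ}
    {D : (Fin d₁ → ℝ) → (Fin d₂ → ℝ) → ℝ}
    (hK : ∀ᶠ τ in 𝓝 (0 : Fin d₂ → ℝ), HasLeadingForm K r m D τ)
    (hD : ∀ ξ, D ξ 0 = 0 → ξ = 0) :
    ∀ᶠ w in 𝓝 (0 : Param d₁ d₂), K w = 0 ↔ w ∈ centre d₁ d₂ := by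
  have hτ0 : Tendsto (fun (w : Param d₁ d₂) (j : Fin d₂) => w (Sum.inr j)) (𝓝 (0 : Param d₁ d₂))
      (𝓝 (0 : Fin d₂ → ℝ)) :=
    Continuous.tendsto' (by fun_prop) _ _ rfl
  filter_upwards [eventually_mem_centre hm hK hD, hτ0.eventually hK] with w h1 h2
  refine ⟨h1, fun h => ?_⟩
  have hw : w = Sum.elim (0 : Fin d₁ → ℝ) fun j => w (Sum.inr j) := by
    funext k
    rcases k with k | k
    · exact h k
    · rfl
  rw [hw]
  exact h2.zero hm

/-- On a small `W` the leading form keeps its only zero at `0`, so every point over `W₀` in the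
toric atlas is a normal crossing. The lower bound holds at all of them and is attained at the origin
of a chart with a multiplicity `m`. -/
theorem isRLCT_lam (hd : 1 ≤ d₁) (hr : r ≤ d₁) (hm : 1 ≤ m) (hrm : r < d₁ ↔ 2 ≤ m)
    {K : Param d₁ d₂ → ℝ} {D : (Fin d₁ → ℝ) → (Fin d₂ → ℝ) → ℝ}
    (hK : ∀ᶠ τ in 𝓝 (0 : Fin d₂ → ℝ), HasLeadingForm K r m D τ)
    (hD : ∀ ξ, D ξ 0 = 0 → ξ = 0) : IsRLCT K 0 (lam d₁ r m) := by
  have hτ0 : Tendsto (fun (w : Param d₁ d₂) (j : Fin d₂) => w (Sum.inr j)) (𝓝 (0 : Param d₁ d₂))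
      (𝓝 (0 : Fin d₂ → ℝ)) :=
    Continuous.tendsto' (by fun_prop) _ _ rfl
  have hKan : ∀ᶠ w in 𝓝 (0 : Param d₁ d₂), AnalyticAt ℝ K w := by
    have := hK.self_of_nhds.1
    have h0 : (Sum.elim (0 : Fin d₁ → ℝ) (0 : Fin d₂ → ℝ) : Param d₁ d₂) = 0 := by
      funext k; rcases k with k | k <;> rfl
    rw [h0] at this
    exact this.eventually_analyticAt
  have hev := hKan.and ((eventually_zero_iff hm hK hD).and ((hτ0.eventually
    hK.eventually_nhds).and (hτ0.eventually (eventually_leadingForm_ne_zero hm hK hD))))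
  obtain ⟨W, hWs, hW, hW0⟩ := eventually_nhds_iff.1 hev
  -- A chart of type `tail` has multiplicity `m`; if there is none, then `r = d₁`, hence `m = 1`,
  -- and the first blow-up suffices.
  obtain ⟨c₀, i₀, hc₀⟩ : ∃ (c₀ : ToricIndex d₁ r m) (i : Fin d₁), c₀.mult i = m := by
    by_cases h : r < d₁
    · exact ⟨.tail ⟨r, h⟩ le_rfl, ⟨r, h⟩, by simp [ToricIndex.mult]⟩
    · have h1 : m = 1 := by
        have : ¬ 2 ≤ m := fun h' => h (hrm.2 h')
        omega
      refine ⟨.head ⟨0, hd⟩ (by simp; omega), ⟨0, hd⟩, by simp [ToricIndex.mult, h1]⟩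
  have h00 : toricMap r c₀.mult (0 : Param d₁ d₂) = 0 := by
    funext k
    rcases k with k | k
    · exact (toricMap_mem_centre hm c₀ 0).2 ⟨i₀, rfl, by omega⟩ k
    · rfl
  obtain ⟨R, hR, Q₀, hQ₀, hk₀, hh₀⟩ := (toricAtlas d₁ d₂ r hm).exists_resolution (F := K) (P := 0) hW hW0
    (fun w hw => (hWs w hw).1) (fun w hw => (hWs w hw).2.1) (fun j => rfl)
    (fun c Q => Sum.elim (expK (c.toFinal hm) Q) 0) (fun c Q => Sum.elim (expJ (c.toFinal hm) Q) 0)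
    (by
      intro c Q hQW hQ
      have hmap : (c.toFinal hm).map d₂ = toricMap r c.mult := by
        rw [FinalChart.map_eq, c.mult_toFinal hm]
      have hQ' : Q ∈ excSet d₂ (c.toFinal hm) := by
        rw [excSet, hmap]; exact hQ
      have h1 := hWs _ hQW
      have h2 := (eventually_crossingAt_of_forall hm hr (c.toFinal hm) hQ' h1.2.2.1
        h1.2.2.2).self_of_nhds
      rw [CrossingAt, hmap] at h2
      exact h2)
    (c₀ := c₀) (Q₀ := 0) h00
  refine ⟨R, le_antisymm ?_ ?_⟩
  · refine (iInf₂_le Q₀ hQ₀).trans ((iInf_le _ (Sum.inl i₀)).trans ?_)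
    rw [hk₀, hh₀]
    refine (ratio_eq_lam hd hr (c₀.toFinal hm) rfl ?_ hm).le
    rw [c₀.mult_toFinal hm, hc₀]
  · refine le_iInf₂ fun Q _ => le_iInf fun i => ?_
    obtain ⟨c, u, hk, hh⟩ := hR Q
    rw [hk, hh]
    rcases i with i | i
    · exact lam_le_ratio hd hr _ u i
    -- The coordinates `τ` have exponent zero in `K`, so their quotient is infinite.
    · exact le_top.trans (ratio_eq_top rfl).ge

end RealLogCanonical

end

/-! ### Assembly of the three conclusions. -/

theorem theorem2 {χ : Type*} [MeasurableSpace χ] (μ : Measure χ) {d₁ d₂ r m : ℕ} (hd : 1 ≤ d₁)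
    (hr : r ≤ d₁) (q : χ → ℝ) (Θ : Set (Param d₁ d₂)) (p : χ → Param d₁ d₂ → ℝ)
    (hmodel : IsModel μ q Θ p) (hass : MainAssumption μ q p hr m) :
    -- the explicit form `g_i` of the composite of the `m` blow-ups
    (∀ c : FinalChart d₁ r m, r ≤ (c.last : ℕ) → ∀ u : Param d₁ d₂, c.map d₂ u = Sum.elim
      (fun j : Fin d₁ => if (j : ℕ) < r then u (Sum.inl c.last) ^ m * u (Sum.inl j)
        else if j = c.last then u (Sum.inl j) else u (Sum.inl c.last) * u (Sum.inl j))
      (fun j : Fin d₂ => u (Sum.inr j))) ∧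
    -- normal crossings off `S` for `τ` near `0`, the infimum and the multiplicity
    (∃ (Ω : FinalChart d₁ r m → Set (Param d₁ d₂))
      (k h : FinalChart d₁ r m → Param d₁ d₂ → Fin d₁ → ℕ),
      (∀ c, IsOpen (Ω c)) ∧
      (∀ c, ∀ Q ∈ excSet d₂ c \ badSet μ q p c, (∀ j, Q (Sum.inr j) = 0) → Q ∈ Ω c) ∧
      ((∀ v : Fin d₁ → ℝ, tail r v ≠ 0 → IndependentDir μ q p hr m v) →
        ∃ T ∈ 𝓝 (0 : Fin d₂ → ℝ), ∀ c, ∀ Q ∈ excSet d₂ c, (fun j => Q (Sum.inr j)) ∈ T → Q ∈ Ω c) ∧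
      (∀ c, ∀ Q ∈ Ω c ∩ (excSet d₂ c \ badSet μ q p c),
        IsNormalCrossing (klDiv μ q p) (fun u => c.map d₂ (Q + u))
          (Sum.elim (k c Q) 0) (Sum.elim (h c Q) 0)) ∧
      ((0 < r ∨ ∃ v : Fin d₁ → ℝ, tail r v ≠ 0 ∧ IndependentDir μ q p hr m v) →
        (⨅ (c : FinalChart d₁ r m) (Q : Param d₁ d₂)
          (_ : Q ∈ Ω c ∩ (excSet d₂ c \ badSet μ q p c)) (i : Fin d₁),
          ratio (h c Q i) (k c Q i)) = lam d₁ r m ∧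
        IsGreatest {N : ℕ | ∃ (c : FinalChart d₁ r m),
          ∃ Q ∈ Ω c ∩ (excSet d₂ c \ badSet μ q p c),
            N = {i : Fin d₁ | ratio (h c Q i) (k c Q i) = lam d₁ r m}.ncard} 1)) ∧
    -- the real log canonical threshold at the origin and the zero set of `K` near the origin
    ((∀ v : Fin d₁ → ℝ, tail r v ≠ 0 → IndependentDir μ q p hr m v) →
      IsRLCT (klDiv μ q p) 0 (lam d₁ r m) ∧
      ∀ᶠ w in 𝓝 (0 : Param d₁ d₂), (w ∈ Θ ∧ klDiv μ q p w = 0) ↔ w ∈ centre d₁ d₂) := by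
  have hm := hass.one_le
  refine ⟨fun c hc u => c.map_tail hc u, normal_crossing_off_badSet hd hr hmodel hass,
    fun hind => ?_⟩
  obtain ⟨D, hK, hD⟩ := exists_leadingForm hmodel hass
  have hD0 := eq_zero_of_leadingForm hD hind
  refine ⟨isRLCT_lam hd hr hm hass.lt_iff hK hD0, ?_⟩
  filter_upwards [hmodel.nhds, eventually_zero_iff hm hK hD0] with w hw h
  rw [← h]
  exact and_iff_right hw
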